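/- Let $G$ be a finite simple undirected graph. Write $N[v]$ for the closed neighbourhood of a vertex $v$. Vertices $u,v$ are (true) twins if $N[u]=N[v]$; a set $S\subseteq V(G)$ is a twin cover if for every edge $\{u,v\}$ the vertices $u,v$ are twins or at least one of them is in $S$; the twin cover number $\tau=\tau(G)$ is the minimum size of a twin cover. For a positive integer $r$, an $r$-grouped dominating set with $m$ units is a family $D_1,\dots,D_m$ of pairwise disjoint subsets of $V(G)$ such that $|D_i|=r$ and $G[D_i]$ is connected for every $i$, and every vertex of $G$ lies in $D_1\cup\dots\cup D_m$ or is adjacent to a vertex of it. The problem $r$-Grouped Dominating Set asks, given a graph $G$ and positive integers $r$ and $k$, all three being part of the input ($G$ as an adjacency matrix, $r$ and $k$ in binary), whether $G$ has an $r$-grouped dominating set with at most $k$ units. Running time is the number of steps of a program over binary-tree (list) data in which every elementary list operation, assignment and test costs one step. 1. There are an algorithm for $r$-Grouped Dominating Set and a polynomial $p$ such that the algorithm halts with the correct answer after at most $(2\tau)^{2\tau}\cdot p(N)$ steps on every input of size $N$ whose graph has twin cover number $\tau$ (with $0^0=1$); that is, the problem can be solved in $O^*((2\tau)^{2\tau})$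 time. 2. Consequently $r$-Grouped Dominating Set is fixed-parameter tractable when parameterized by $\tau$ alone: it can be solved in $f(\tau)\cdot p(N)$ time for a computable function $f$ and a polynomial $p$. 3. If $r\ge 1$ and $r\ge 2\tau(G)-1$, then for every minimum twin cover $K$ of $G$ and every connected component $C$ of $G$ with at least $r$ vertices there is a set $D$ with $K\cap V(C)\subseteq D\subseteq V(C)$ and $|D|=r$ such that $G[D]$ is connected and every vertex of $C$ is in $D$ or adjacent to a vertex of $D$. -/

import Mathlib

namespace GroupedDom

/-! ### Graph notions -/

section Graph

variable {V : Type*}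

/-- Closed neighbourhood `N[v]`. -/
def closedNbhd (G : SimpleGraph V) (v : V) : Set V := {w | w = v ∨ G.Adj v w}

/-- `u` and `v` are (true) twins. -/
def AreTwins (G : SimpleGraph V) (u v : V) : Prop := closedNbhd G u = closedNbhd G v

/-- Every edge is a twin edge or has an endpoint in `S`. -/
def IsTwinCover (G : SimpleGraph V) (S : Finset V) : Prop :=
  ∀ u v, G.Adj u v → AreTwins G u v ∨ u ∈ S ∨ v ∈ S

/-- The minimum size of a twin cover. For finite `V` the set below is non-empty, since the set of
all vertices is a twin cover. -/
noncomputable def twinCoverNumber (G : SimpleGraph V) : ℕ :=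
  sInf {m | ∃ S : Finset V, IsTwinCover G S ∧ S.card = m}

/-- Every vertex of `A` is in `S` or adjacent to a vertex of `S`. -/
def Dominates (G : SimpleGraph V) (S A : Set V) : Prop :=
  ∀ v ∈ A, v ∈ S ∨ ∃ u ∈ S, G.Adj u v

/-- `D` is an `r`-grouped dominating set with `m` units. -/
structure IsGroupedDominatingSet (G : SimpleGraph V) (r m : ℕ) (D : Fin m → Finset V) : Prop where
  disjoint : ∀ i j, i ≠ j → Disjoint (D i) (D j)
  card_eq : ∀ i, (D i).card = r
  connected : ∀ i, (G.induce (D i : Set V)).Connected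
  dominating : Dominates G (⋃ i, (D i : Set V)) Set.univ

/-- There is an `r`-grouped dominating set with at most `k` units. -/
def HasGroupedDominatingSet (G : SimpleGraph V) (r k : ℕ) : Prop :=
  ∃ m ≤ k, ∃ D : Fin m → Finset V, IsGroupedDominatingSet G r m D

end Graph

/-! ### Machine model

Programs of the language WHILE: imperative programs over LISP data (binary trees without atoms
other than `nil`). A data value is thought of as a pointer to a cell, so each operator (`nil`,
variable access, `cons`, `hd`, `tl`), each assignment and each test against `nil` takes one step.
No operation copies, compares or numerically processes an unbounded amount of data: one step is a
bounded number of pointer operations. Thus `t` steps are `O(t)` steps of a random access machine,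
with addresses of `O(log (t + input size))` bits. -/

/-- LISP data. -/
inductive Data : Type
  | nil : Data
  | cons : Data → Data → Data

namespace Data

/-- Head; the head of `nil` is `nil`. -/
def hd : Data → Data
  | nil => nil
  | cons a _ => a

/-- Tail; the tail of `nil` is `nil`. -/
def tl : Data → Data
  | nil => nil
  | cons _ b => b

/-- Number of nodes of the tree. -/
def size : Data → ℕ
  | nil => 1
  | cons a b => 1 + a.size + b.size

/-- A list as a right comb ending in `nil`. -/
def ofList : List Data → Data
  | [] => nil
  | a :: l => cons a (ofList l)

/-- `false` is `nil`, `true` is `cons nil nil`. -/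
def ofBool : Bool → Data
  | false => nil
  | true => cons nil nil

/-- The binary expansion of `m`, least significant bit first. -/
def ofNat (m : ℕ) : Data := ofList (m.bits.map ofBool)

end Data

/-- Expressions; variables are named by natural numbers. -/
inductive Expr : Type
  | var : ℕ → Expr
  | nil : Expr
  | cons : Expr → Expr → Expr
  | hd : Expr → Expr
  | tl : Expr → Expr

/-- Contents of the variables. -/
abbrev Store : Type := ℕ → Data

namespace Expr

/-- Value of an expression. -/
def eval (s : Store) : Expr → Data
  | var i => s i
  | nil => Data.nil
  | cons e f => Data.cons (e.eval s) (f.eval s)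
  | hd e => (e.eval s).hd
  | tl e => (e.eval s).tl

/-- Number of steps to evaluate an expression: one for each operator. -/
def cost : Expr → ℕ
  | var _ => 1
  | nil => 1
  | cons e f => 1 + e.cost + f.cost
  | hd e => 1 + e.cost
  | tl e => 1 + e.cost

end Expr

/-- Commands. A test succeeds when the value of the expression is not `nil`. -/
inductive Cmd : Type
  | assign : ℕ → Expr → Cmd
  | seq : Cmd → Cmd → Cmd
  | ite : Expr → Cmd → Cmd → Cmd
  | loop : Expr → Cmd → Cmd

/-- `Exec c s s' t`: started in the store `s`, the command `c` terminates in the store `s'` after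
exactly `t` steps. -/
inductive Exec : Cmd → Store → Store → ℕ → Prop
  | assign (i : ℕ) (e : Expr) (s : Store) :
      Exec (Cmd.assign i e) s (Function.update s i (e.eval s)) (1 + e.cost)
  | seq {c d : Cmd} {s₁ s₂ s₃ : Store} {t u : ℕ} :
      Exec c s₁ s₂ t → Exec d s₂ s₃ u → Exec (Cmd.seq c d) s₁ s₃ (t + u)
  | ite_true {e : Expr} {c d : Cmd} {s s' : Store} {t : ℕ} :
      e.eval s ≠ Data.nil → Exec c s s' t → Exec (Cmd.ite e c d) s s' (1 + e.cost + t)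
  | ite_false {e : Expr} {c d : Cmd} {s s' : Store} {t : ℕ} :
      e.eval s = Data.nil → Exec d s s' t → Exec (Cmd.ite e c d) s s' (1 + e.cost + t)
  | loop_true {e : Expr} {c : Cmd} {s₁ s₂ s₃ : Store} {t u : ℕ} :
      e.eval s₁ ≠ Data.nil → Exec c s₁ s₂ t → Exec (Cmd.loop e c) s₂ s₃ u →
      Exec (Cmd.loop e c) s₁ s₃ (1 + e.cost + t + u)
  | loop_false {e : Expr} {c : Cmd} {s : Store} :
      e.eval s = Data.nil → Exec (Cmd.loop e c) s s (1 + e.cost)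

/-- A command has at most one terminating run from a given store. -/
theorem Exec.deterministic {c : Cmd} {s s₁ s₂ : Store} {t₁ t₂ : ℕ}
    (h₁ : Exec c s s₁ t₁) (h₂ : Exec c s s₂ t₂) : s₁ = s₂ ∧ t₁ = t₂ := by
  induction h₁ generalizing s₂ t₂ with
  | assign => cases h₂; exact ⟨rfl, rfl⟩
  | seq _ _ ih ih' =>
    cases h₂ with
    | seq a b =>
      obtain ⟨rfl, rfl⟩ := ih a
      obtain ⟨rfl, rfl⟩ := ih' b
      exact ⟨rfl, rfl⟩
  | ite_true h _ ih =>
    cases h₂ with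
    | ite_true _ a => obtain ⟨rfl, rfl⟩ := ih a; exact ⟨rfl, rfl⟩
    | ite_false h' _ => exact absurd h' h
  | ite_false h _ ih =>
    cases h₂ with
    | ite_true h' _ => exact absurd h h'
    | ite_false _ a => obtain ⟨rfl, rfl⟩ := ih a; exact ⟨rfl, rfl⟩
  | loop_true h _ _ ih ih' =>
    cases h₂ with
    | loop_true _ a b =>
      obtain ⟨rfl, rfl⟩ := ih a
      obtain ⟨rfl, rfl⟩ := ih' b
      exact ⟨rfl, rfl⟩
    | loop_false h' => exact absurd h' h
  | loop_false h =>
    cases h₂ with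
    | loop_true h' _ _ => exact absurd h h'
    | loop_false _ => exact ⟨rfl, rfl⟩

/-- The initial store: the input is in variable `0`, all other variables are `nil`. -/
def initStore (d : Data) : Store := fun i => if i = 0 then d else Data.nil

/-- The program `P` solves the decision problem `yes` within time `T`: on each instance `a` it
halts after at most `T a` steps, and it accepts (variable `0` is not `nil` at the end) exactly
the yes-instances. -/
def SolvesWithin {α : Type} (P : Cmd) (enc : α → Data) (yes : α → Prop) (T : α → ℕ) : Prop :=
  ∀ a, ∃ (s : Store) (t : ℕ),
    Exec P (initStore (enc a)) s t ∧ t ≤ T a ∧ (s 0 ≠ Data.nil ↔ yes a)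

/-- The problem can be solved in `O*(g)` time: `g` times a polynomial in the input size. -/
def SolvableInOStar {α : Type} (enc : α → Data) (yes : α → Prop) (g : α → ℕ) : Prop :=
  ∃ (P : Cmd) (p : Polynomial ℕ),
    SolvesWithin P enc yes (fun a => g a * p.eval (enc a).size)

/-- The problem is fixed-parameter tractable for the parameter `κ`: it can be solved in time
`f (κ a)` times a polynomial in the input size, for a computable function `f`. -/
def IsFPT {α : Type} (enc : α → Data) (yes : α → Prop) (κ : α → ℕ) : Prop :=
  ∃ f : ℕ → ℕ, Computable f ∧ SolvableInOStar enc yes (fun a => f (κ a))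

/-! ### The problem -/

/-- An instance: a finite graph and positive integers `r` and `k`. -/
structure Instance where
  n : ℕ
  graph : SimpleGraph (Fin n)
  r : ℕ
  k : ℕ
  r_pos : 0 < r
  k_pos : 0 < k

namespace Instance

open scoped Classical in
/-- The adjacency matrix, as a list of rows. -/
noncomputable def encodeGraph {n : ℕ} (G : SimpleGraph (Fin n)) : Data :=
  Data.ofList (List.ofFn fun u : Fin n =>
    Data.ofList (List.ofFn fun v : Fin n => Data.ofBool (decide (G.Adj u v))))

/-- The graph is given by its adjacency matrix, and `r` and `k` are given in binary. -/
noncomputable def encode (I : Instance) : Data :=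
  Data.cons (encodeGraph I.graph) (Data.cons (Data.ofNat I.r) (Data.ofNat I.k))

/-- The question of `r`-Grouped Dominating Set. -/
def IsYes (I : Instance) : Prop := HasGroupedDominatingSet I.graph I.r I.k

/-- The twin cover number of the graph of the instance. -/
noncomputable def tau (I : Instance) : ℕ := twinCoverNumber I.graph

end Instance

end GroupedDom

/-!
# Grouped domination and twin covers

Adjacent vertices outside a twin cover `K` are twins. So the vertices outside `K` form cliques, and
all vertices of such a clique have the same neighbours in `K`.

**The structure of solutions.** A solution, a set of units, can be chosen to contain as many
vertices of `K` as possible. Then for `r ≥ 2` a unit that avoids `K`, and hence lies in one of the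
cliques, has no neighbour in `K` that is not in the solution (`IsUnitFamily.exists_maximal`). The
other units are held together by their vertices in `K` (`IsTwinCover.exists_ranked_tree`): each of
these vertices, except for a root, is adjacent to another one of smaller rank, or to a vertex
outside `K`, a *connector*, that is adjacent to one of smaller rank. So it suffices to guess for
every vertex of `K` three bits and a pointer to a vertex of `K` (`Guess`): whether it is in the
solution, and how it is attached to its unit or dominated. It then has to be decided whether
connectors exist and whether the units can be filled up to size `r` with further vertices outside
`K`. This is a matching problem, and Hall's theorem turns it into one inequality for every pair of
subsets of `K`. A clique without a neighbour in the solution inside `K` must contain a unit of its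
own, and one such unit dominates the clique. All conditions together are collected in `Guess.Valid`;
they are equivalent to the existence of a solution by `Guess.Valid.hasGroupedDominatingSet` and
`HasGroupedDominatingSet.exists_valid`.

**The algorithm.** A twin cover of size at most `τ` is found by branching on the ends of
an edge that violates the definition, with `2 ^ t` branches of depth `t` for `t = 0, 1, …` until a
twin cover appears, which happens for some `t ≤ τ` (`IsTwinCover.coverAt_card`). For each twin cover
found at this depth there are `(8 * (t + 1)) ^ t` guesses and `4 ^ t` pairs of subsets in Hall's
condition, each of which is tested in polynomial time. The total `(64 * (t + 1)) ^ t` is at most a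
constant times `(2τ)^(2τ)`. Values of `r` and `k` beyond the number of vertices are cut off when the
binary expansions are read, so that all arithmetic can be done in unary.

**The machine.** `Comp g f` says that a WHILE program computes `f` in time `g` times a polynomial,
at any place of the store. This notion is closed under composition, pairing, case distinction, loops
(`Comp.whileLoop`) and exhaustive search over words (`Comp.anyWord`), so that programs are never
written down beyond these closure properties.

**Large units.** If no vertex of `K` can be attached to a connected set `D`, directly or through one
further vertex outside `K`, then `D` already contains all vertices of `K` in its component and
dominates the component (`IsTwinCover.mem_or_adj_of_closed`), since consecutive vertices outside `K`
on a path are twins. Attaching the vertices of `K` one by one thus gives a connected dominating set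
with at most `2τ - 1` vertices, or a single vertex if `K` does not meet the component, and it can be
extended to any larger size within the component.
-/

namespace GroupedDom

/-! ### Encoded types and computation with a cost -/

/-- Types whose elements are represented by LISP data. -/
class Enc (α : Type) where
  /-- The representation of an element. -/
  enc : α → Data

open Enc

instance : Enc Data := ⟨id⟩
instance : Enc Unit := ⟨fun _ => Data.nil⟩
instance : Enc Bool := ⟨Data.ofBool⟩
instance {α β : Type} [Enc α] [Enc β] : Enc (α × β) := ⟨fun x => Data.cons (enc x.1) (enc x.2)⟩
instance {α : Type} [Enc α] : Enc (List α) := ⟨fun l => Data.ofList (l.map enc)⟩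

/-- Natural numbers are represented in unary. -/
instance : Enc ℕ := ⟨fun n => enc (List.replicate n ())⟩

noncomputable instance : Enc Instance := ⟨Instance.encode⟩

/-- Number of nodes of the representation. -/
def sz {α : Type} [Enc α] (a : α) : ℕ := (enc a).size

section Sizes

variable {α β : Type} [Enc α] [Enc β]

@[simp] theorem enc_nil : enc ([] : List α) = Data.nil := rfl
@[simp] theorem enc_cons (a : α) (l : List α) : enc (a :: l) = Data.cons (enc a) (enc l) := rfl
@[simp] theorem enc_pair (a : α) (b : β) : enc (a, b) = Data.cons (enc a) (enc b) := rfl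
@[simp] theorem enc_true : enc true = Data.cons Data.nil Data.nil := rfl
@[simp] theorem enc_false : enc false = Data.nil := rfl

theorem enc_nat (n : ℕ) : enc n = enc (List.replicate n ()) := rfl

theorem Data.one_le_size : ∀ d : Data, 1 ≤ d.size
  | .nil => le_rfl
  | .cons _ _ => by simp only [Data.size]; omega

theorem one_le_sz (a : α) : 1 ≤ sz a := Data.one_le_size _

@[simp] theorem sz_nil : sz ([] : List α) = 1 := rfl
@[simp] theorem sz_cons (a : α) (l : List α) : sz (a :: l) = 1 + sz a + sz l := rfl
@[simp] theorem sz_pair (a : α) (b : β) : sz (a, b) = 1 + sz a + sz b := rfl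

theorem sz_bool_le (b : Bool) : sz b ≤ 3 := by cases b <;> simp [sz, Data.size]

@[simp] theorem sz_nat (n : ℕ) : sz n = 2 * n + 1 := by
  induction n with
  | zero => rfl
  | succ n ih =>
    have : sz (n + 1) = 1 + 1 + sz n := rfl
    omega

theorem sz_append (l l' : List α) : sz (l ++ l') + 1 = sz l + sz l' := by
  induction l with
  | nil => simp [add_comm]
  | cons a l ih => simp only [List.cons_append, sz_cons]; omega

theorem sz_le_of_mem {l : List α} {a : α} (h : a ∈ l) : sz a ≤ sz l := by
  induction l with
  | nil => simp at h
  | cons b l ih =>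
    rcases List.mem_cons.1 h with rfl | h
    · simp only [sz_cons]; omega
    · have := ih h; simp only [sz_cons]; omega

theorem length_lt_sz (l : List α) : l.length < sz l := by
  induction l with
  | nil => simp
  | cons b l ih => simp only [sz_cons, List.length_cons]; omega

theorem sz_le_of_forall {l : List α} {B : ℕ} (h : ∀ a ∈ l, sz a ≤ B) :
    sz l ≤ 1 + l.length * (1 + B) := by
  induction l with
  | nil => simp
  | cons b l ih =>
    have h₁ := h b (by simp)
    have h₂ := ih fun a ha => h a (by simp [ha])
    simp only [sz_cons, List.length_cons, Nat.succ_mul]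
    omega

theorem sz_le_of_suffix {l l' : List α} (h : l <:+ l') : sz l ≤ sz l' := by
  obtain ⟨m, rfl⟩ := h
  have := sz_append m l
  have := one_le_sz m
  omega

theorem sz_le_of_sublist {l l' : List α} (h : l.Sublist l') : sz l ≤ sz l' := by
  induction h with
  | slnil => rfl
  | cons a _ ih => simp only [sz_cons]; omega
  | cons_cons a _ ih => simp only [sz_cons]; omega

end Sizes

theorem polyEval_mono (p : Polynomial ℕ) {m n : ℕ} (h : m ≤ n) : p.eval m ≤ p.eval n := by
  induction p using Polynomial.induction_on' with
  | add p q hp hq => simp only [Polynomial.eval_add]; omega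
  | monomial k a =>
    simp only [Polynomial.eval_monomial]
    exact Nat.mul_le_mul_left _ (Nat.pow_le_pow_left h _)

/-- `Comp g f`: the function `f` is computed in time `g` times a polynomial in the input size, and
its values have polynomial size. For every register `b` there is a program that replaces the
representation of `a` in register `b` by that of `f a`; it may use all higher registers, whatever
they contain, and leaves the lower registers alone. Letting `b` vary is what makes programs
composable without renaming registers. -/
def Comp {α β : Type} [Enc α] [Enc β] (g : α → ℕ) (f : α → β) : Prop :=
  ∃ p : Polynomial ℕ, (∀ a, sz (f a) ≤ p.eval (sz a)) ∧
    ∀ b : ℕ, ∃ P : Cmd, ∀ (s : Store) (a : α), s b = enc a →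
      ∃ (s' : Store) (t : ℕ), Exec P s s' t ∧ s' b = enc (f a) ∧ (∀ i < b, s' i = s i) ∧
        t ≤ g a * p.eval (sz a)

/-- Computable in polynomial time. -/
abbrev PT {α β : Type} [Enc α] [Enc β] (f : α → β) : Prop := Comp (fun _ => 1) f

theorem Exec.pos {c : Cmd} {s s' : Store} {t : ℕ} (h : Exec c s s' t) : 1 ≤ t := by
  induction h <;> omega

namespace Comp

/-! ### Closure properties -/

variable {α β γ σ : Type} [Enc α] [Enc β] [Enc γ] [Enc σ] {g g' : α → ℕ}

theorem one_le {f : α → β} (h : Comp g f) (a : α) : 1 ≤ g a := by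
  obtain ⟨p, -, h⟩ := h
  obtain ⟨P, h⟩ := h 0
  obtain ⟨s', t, h, -, -, ht⟩ := h (fun _ => enc a) a rfl
  by_contra hg
  have hg : g a = 0 := by omega
  have := h.pos
  simp [hg] at ht
  omega

theorem mono {f : α → β} (h : Comp g f) (q : Polynomial ℕ)
    (hg : ∀ a, g a ≤ g' a * q.eval (sz a)) : Comp g' f := by
  obtain ⟨p, hp, h⟩ := h
  refine ⟨p + q * p, fun a => (hp a).trans (by simp), fun b => ?_⟩
  obtain ⟨P, h⟩ := h b
  refine ⟨P, fun s a hs => ?_⟩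
  obtain ⟨s', t, h₁, h₂, h₃, h₄⟩ := h s a hs
  refine ⟨s', t, h₁, h₂, h₃, h₄.trans ?_⟩
  calc g a * p.eval (sz a) ≤ g' a * q.eval (sz a) * p.eval (sz a) := Nat.mul_le_mul_right _ (hg a)
    _ ≤ _ := by simp only [Polynomial.eval_add, Polynomial.eval_mul]; nlinarith

theorem mono' {f : α → β} (h : Comp g f) (hg : ∀ a, g a ≤ g' a) : Comp g' f :=
  h.mono 1 (by simpa using hg)

theorem of_pt {f : α → β} (h : PT f) (hg : ∀ a, 1 ≤ g a) : Comp g f := h.mono' hg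

/-- Only the representations of the values matter. -/
theorem congr_enc {f : α → β} {f' : α → γ} (h : Comp g f) (he : ∀ a, enc (f' a) = enc (f a)) :
    Comp g f' := by
  obtain ⟨p, hp, h⟩ := h
  refine ⟨p, fun a => ?_, fun b => ?_⟩
  · rw [sz, he]; exact hp a
  · obtain ⟨P, h⟩ := h b
    refine ⟨P, fun s a hs => ?_⟩
    rw [he]; exact h s a hs

theorem of_expr {f : α → β} (e : ℕ → Expr) (p : Polynomial ℕ) (c : ℕ)
    (he : ∀ b s a, s b = enc a → (e b).eval s = enc (f a)) (hc : ∀ b, (e b).cost ≤ c)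
    (hp : ∀ a, sz (f a) ≤ p.eval (sz a)) : PT f := by
  refine ⟨p + Polynomial.C (c + 1), fun a => (hp a).trans (by simp), fun b => ?_⟩
  refine ⟨Cmd.assign b (e b), fun s a hs => ⟨_, _, Exec.assign _ _ _, ?_, ?_, ?_⟩⟩
  · simp [he b s a hs]
  · intro i hi; simp [Function.update_of_ne hi.ne]
  · have := hc b
    simp only [one_mul, Polynomial.eval_add, Polynomial.eval_C]
    omega

theorem id : PT (fun a : α => a) :=
  of_expr (fun b => .var b) Polynomial.X 1 (fun _ _ _ h => h) (fun _ => le_rfl) (by simp)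

theorem of_enc_eq {f : α → β} (he : ∀ a, enc (f a) = enc a) : PT f := id.congr_enc he

/-- The expression without variables whose value is `d`. -/
def constExpr : Data → Expr
  | .nil => .nil
  | .cons a b => .cons (constExpr a) (constExpr b)

theorem eval_constExpr (s : Store) : ∀ d, (constExpr d).eval s = d
  | .nil => rfl
  | .cons a b => by simp [constExpr, Expr.eval, eval_constExpr s a, eval_constExpr s b]

theorem const (c : β) : PT (fun _ : α => c) :=
  of_expr (fun _ => constExpr (enc c)) (Polynomial.C (sz c)) (constExpr (enc c)).cost
    (fun _ s _ _ => eval_constExpr s _) (fun _ => le_rfl) (by simp)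

theorem comp {f : α → β} {h : β → γ} {gb : β → ℕ} (hh : Comp gb h) (hf : Comp g f)
    (hg : ∀ a, gb (f a) ≤ g a) : Comp g (fun a => h (f a)) := by
  obtain ⟨p, hp, hf⟩ := hf
  obtain ⟨q, hq, hh⟩ := hh
  refine ⟨p + q.comp p, fun a => ?_, fun b => ?_⟩
  · simp only [Polynomial.eval_add, Polynomial.eval_comp]
    exact (hq _).trans ((polyEval_mono q (hp a)).trans (Nat.le_add_left _ _))
  · obtain ⟨P, hP⟩ := hf b
    obtain ⟨Q, hQ⟩ := hh b
    refine ⟨P.seq Q, fun s a hs => ?_⟩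
    obtain ⟨s₁, t₁, h₁, h₁b, h₁l, ht₁⟩ := hP s a hs
    obtain ⟨s₂, t₂, h₂, h₂b, h₂l, ht₂⟩ := hQ s₁ _ h₁b
    refine ⟨s₂, _, h₁.seq h₂, h₂b, fun i hi => (h₂l i hi).trans (h₁l i hi), ?_⟩
    simp only [Polynomial.eval_add, Polynomial.eval_comp, mul_add]
    exact Nat.add_le_add ht₁
      (ht₂.trans (Nat.mul_le_mul (hg a) (polyEval_mono q (hp a))))

theorem comp_pt {f : α → β} {h : β → γ} (hh : PT h) (hf : Comp g f) : Comp g (fun a => h (f a)) :=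
  hh.comp hf hf.one_le

/-- The components are computed in registers `b + 1` and `b + 2` from copies of the argument. -/
theorem pair {f : α → β} {h : α → γ} (hf : Comp g f) (hh : Comp g h) :
    Comp g (fun a => (f a, h a)) := by
  have h1 := hf.one_le
  obtain ⟨p, hp, hf⟩ := hf
  obtain ⟨q, hq, hh⟩ := hh
  refine ⟨p + q + Polynomial.C 8, fun a => ?_, fun b => ?_⟩
  · have := hp a
    have := hq a
    simp only [Polynomial.eval_add, Polynomial.eval_C, sz_pair]
    omega
  · obtain ⟨P, hP⟩ := hf (b + 1)
    obtain ⟨Q, hQ⟩ := hh (b + 2)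
    refine ⟨(Cmd.assign (b + 1) (.var b)).seq (P.seq ((Cmd.assign (b + 2) (.var b)).seq (Q.seq
      (Cmd.assign b (.cons (.var (b + 1)) (.var (b + 2))))))), fun s a hs => ?_⟩
    obtain ⟨s₁, t₁, h₁, h₁b, h₁l, ht₁⟩ := hP (Function.update s (b + 1) (s b)) a (by simp [hs])
    have hb₁ : s₁ b = enc a := by rw [h₁l b (by omega)]; simp [hs]
    obtain ⟨s₂, t₂, h₂, h₂b, h₂l, ht₂⟩ := hQ (Function.update s₁ (b + 2) (s₁ b)) a (by simp [hb₁])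
    have hb₂ : s₂ (b + 1) = enc (f a) := by
      rw [h₂l (b + 1) (by omega)]; simp [h₁b]
    refine ⟨_, _, (Exec.assign _ _ _).seq (h₁.seq ((Exec.assign _ _ _).seq (h₂.seq
      (Exec.assign _ _ _)))), ?_, ?_, ?_⟩
    · simp [Expr.eval, hb₂, h₂b]
    · intro i hi
      rw [Function.update_of_ne (by omega), h₂l i (by omega), Function.update_of_ne (by omega),
        h₁l i (by omega), Function.update_of_ne (by omega)]
    · simp only [Expr.cost, Polynomial.eval_add, Polynomial.eval_C, mul_add]
      have := h1 a
      omega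

/-- The test is evaluated in register `b + 1`, so that the argument in register `b` survives. -/
theorem iteData {c : α → Data} {f h : α → β} [∀ a, Decidable (c a = Data.nil)] (hc : Comp g c)
    (hf : Comp g f) (hh : Comp g h) : Comp g (fun a => if c a = Data.nil then f a else h a) := by
  have h1 := hf.one_le
  obtain ⟨r, hr, hc⟩ := hc
  obtain ⟨p, hp, hf⟩ := hf
  obtain ⟨q, hq, hh⟩ := hh
  refine ⟨r + p + q + Polynomial.C 4, fun a => ?_, fun b => ?_⟩
  · have := hp a
    have := hq a
    simp only [Polynomial.eval_add, Polynomial.eval_C]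
    split <;> omega
  · obtain ⟨R, hR⟩ := hc (b + 1)
    obtain ⟨P, hP⟩ := hf b
    obtain ⟨Q, hQ⟩ := hh b
    refine ⟨(Cmd.assign (b + 1) (.var b)).seq (R.seq (Cmd.ite (.var (b + 1)) Q P)),
      fun s a hs => ?_⟩
    obtain ⟨s₁, t₁, h₁, h₁b, h₁l, ht₁⟩ := hR (Function.update s (b + 1) (s b)) a (by simp [hs])
    have hb₁ : s₁ b = enc a := by rw [h₁l b (by omega)]; simp [hs]
    have h₁l' : ∀ i < b, s₁ i = s i := fun i hi => by
      rw [h₁l i (by omega), Function.update_of_ne (by omega)]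
    have h1 := h1 a
    by_cases hca : c a = Data.nil
    · obtain ⟨s₂, t₂, h₂, h₂b, h₂l, ht₂⟩ := hP s₁ a hb₁
      refine ⟨_, _, (Exec.assign _ _ _).seq (h₁.seq (Exec.ite_false ?_ h₂)), ?_, ?_, ?_⟩
      · simp only [Expr.eval, h₁b]; exact hca
      · simp [hca, h₂b]
      · exact fun i hi => (h₂l i hi).trans (h₁l' i hi)
      · simp only [Expr.cost, Polynomial.eval_add, Polynomial.eval_C, mul_add]
        omega
    · obtain ⟨s₂, t₂, h₂, h₂b, h₂l, ht₂⟩ := hQ s₁ a hb₁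
      refine ⟨_, _, (Exec.assign _ _ _).seq (h₁.seq (Exec.ite_true ?_ h₂)), ?_, ?_, ?_⟩
      · simp only [Expr.eval, h₁b]; exact hca
      · simp [hca, h₂b]
      · exact fun i hi => (h₂l i hi).trans (h₁l' i hi)
      · simp only [Expr.cost, Polynomial.eval_add, Polynomial.eval_C, mul_add]
        omega

theorem fst {f : α → β × γ} (hf : Comp g f) : Comp g (fun a => (f a).1) :=
  comp_pt (h := Prod.fst) (of_expr (fun b => .hd (.var b)) Polynomial.X 2
    (fun b s a h => by simp [Expr.eval, h, show enc a = Data.cons (enc a.1) (enc a.2) from rfl,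
      Data.hd]) (fun _ => le_rfl)
    (fun a => by have : sz a = 1 + sz a.1 + sz a.2 := rfl; simp only [Polynomial.eval_X]; omega)) hf

theorem snd {f : α → β × γ} (hf : Comp g f) : Comp g (fun a => (f a).2) :=
  comp_pt (h := Prod.snd) (of_expr (fun b => .tl (.var b)) Polynomial.X 2
    (fun b s a h => by simp [Expr.eval, h, show enc a = Data.cons (enc a.1) (enc a.2) from rfl,
      Data.tl]) (fun _ => le_rfl)
    (fun a => by have : sz a = 1 + sz a.1 + sz a.2 := rfl; simp only [Polynomial.eval_X]; omega)) hf

theorem ite {c : α → Bool} {f h : α → β} (hc : Comp g c)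
    (hf : Comp g f) (hh : Comp g h) : Comp g (fun a => if c a then f a else h a) := by
  classical
  have := iteData (c := fun a => enc (c a)) (hc.congr_enc fun _ => rfl) hh hf
  refine this.congr_enc fun a => ?_
  cases h : c a <;> simp

theorem cons {f : α → β} {h : α → List β} (hf : Comp g f) (hh : Comp g h) :
    Comp g (fun a => f a :: h a) := (hf.pair hh).congr_enc fun _ => rfl

/-- Definition by cases on a list. -/
theorem listCase {l : α → List β} {f : α → γ} {h : α → β → List β → γ} (hl : Comp g l)
    (hf : Comp g f) (hh : PT fun x : α × β × List β => h x.1 x.2.1 x.2.2) :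
    Comp g (fun a => match l a with | [] => f a | y :: t => h a y t) := by
  have h1 := hf.one_le
  obtain ⟨r, hr, hl⟩ := hl
  obtain ⟨p, hp, hf⟩ := hf
  obtain ⟨q, hq, hh⟩ := hh
  set q' : Polynomial ℕ := q.comp (1 + Polynomial.X + r) with hq'
  have hsz : ∀ a y t, l a = y :: t → q.eval (sz (a, y, t)) ≤ q'.eval (sz a) := fun a y t h => by
    have := hr a
    have h' : sz (a, y, t) = 1 + sz a + sz (y :: t) := rfl
    rw [h] at this
    simp only [hq', Polynomial.eval_comp, Polynomial.eval_add, Polynomial.eval_one,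
      Polynomial.eval_X]
    exact polyEval_mono q (by omega)
  refine ⟨r + p + q' + Polynomial.C 8, fun a => ?_, fun b => ?_⟩
  · have := hp a
    simp only [Polynomial.eval_add, Polynomial.eval_C]
    split
    · omega
    · rename_i y t h
      have := hq (a, y, t)
      have := hsz a y t h
      simp only at *
      omega
  · obtain ⟨R, hR⟩ := hl (b + 1)
    obtain ⟨P, hP⟩ := hf b
    obtain ⟨Q, hQ⟩ := hh b
    refine ⟨(Cmd.assign (b + 1) (.var b)).seq (R.seq (Cmd.ite (.var (b + 1))
      ((Cmd.assign b (.cons (.var b) (.var (b + 1)))).seq Q) P)), fun s a hs => ?_⟩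
    obtain ⟨s₁, t₁, h₁, h₁b, h₁l, ht₁⟩ := hR (Function.update s (b + 1) (s b)) a (by simp [hs])
    have hb₁ : s₁ b = enc a := by rw [h₁l b (by omega)]; simp [hs]
    have h₁l' : ∀ i < b, s₁ i = s i := fun i hi => by
      rw [h₁l i (by omega), Function.update_of_ne (by omega)]
    have h1 := h1 a
    rcases hla : l a with _ | ⟨y, t⟩
    · obtain ⟨s₂, t₂, h₂, h₂b, h₂l, ht₂⟩ := hP s₁ a hb₁
      refine ⟨_, _, (Exec.assign _ _ _).seq (h₁.seq (Exec.ite_false ?_ h₂)), ?_, ?_, ?_⟩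
      · simp [Expr.eval, h₁b, hla]
      · rw [h₂b]; beta_reduce; rw [hla]
      · exact fun i hi => (h₂l i hi).trans (h₁l' i hi)
      · simp only [Expr.cost, Polynomial.eval_add, Polynomial.eval_C, mul_add]
        omega
    · obtain ⟨s₂, t₂, h₂, h₂b, h₂l, ht₂⟩ :=
        hQ (Function.update s₁ b (.cons (s₁ b) (s₁ (b + 1)))) (a, y, t)
          (by simp [h₁b, hb₁, hla])
      refine ⟨_, _, (Exec.assign _ _ _).seq (h₁.seq (Exec.ite_true ?_
        ((Exec.assign _ _ _).seq h₂))), ?_, ?_, ?_⟩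
      · simp [Expr.eval, h₁b, hla]
      · rw [h₂b]; beta_reduce; rw [hla]
      · intro i hi
        rw [h₂l i hi, Function.update_of_ne (by omega), h₁l' i hi]
      · have := hsz a y t hla
        have : q'.eval (sz a) ≤ g a * q'.eval (sz a) := Nat.le_mul_of_pos_left _ h1
        simp only [Expr.cost, Polynomial.eval_add, Polynomial.eval_C, mul_add]
        simp only [one_mul] at ht₂
        omega

/-! ### Loops -/

/-- A loop with its state in register `b` and its condition in register `b + 1`, whose body takes at
most `T` steps and does not touch the registers below `b`. -/
theorem exec_loop {step : σ → σ} {cont : σ → Bool} {b T : ℕ} {c : Cmd} (n : ℕ) (x : σ)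
    (hc : ∀ s, ∀ i < n, s b = enc (step^[i] x) → ∃ s' t, Exec c s s' t ∧
      s' b = enc (step^[i + 1] x) ∧ s' (b + 1) = enc (cont (step^[i + 1] x)) ∧
      (∀ i < b, s' i = s i) ∧ t ≤ T)
    (ht : ∀ i < n, cont (step^[i] x) = true) (hf : cont (step^[n] x) = false)
    (s : Store) (hs : s b = enc x) (hs' : s (b + 1) = enc (cont x)) :
    ∃ s' t, Exec (Cmd.loop (.var (b + 1)) c) s s' t ∧ s' b = enc (step^[n] x) ∧
      (∀ i < b, s' i = s i) ∧ t ≤ n * (T + 2) + 2 := by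
  induction n generalizing x s with
  | zero =>
    refine ⟨s, _, Exec.loop_false ?_, hs, fun _ _ => rfl, by simp [Expr.cost]⟩
    simp only [Function.iterate_zero, _root_.id] at hf
    simp [Expr.eval, hs', hf]
  | succ n ih =>
    obtain ⟨s₁, t₁, h₁, h₁b, h₁c, h₁l, ht₁⟩ := hc s 0 (by omega) (by simpa using hs)
    obtain ⟨s₂, t₂, h₂, h₂b, h₂l, ht₂⟩ := ih (step x)
      (fun s i hi hs => by
        have := hc s (i + 1) (by omega) (by simpa using hs)
        simpa using this)
      (fun i hi => by simpa using ht (i + 1) (by omega)) (by simpa using hf) s₁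
      (by simpa using h₁b) (by simpa using h₁c)
    refine ⟨s₂, _, Exec.loop_true ?_ h₁ h₂, ?_, fun i hi => (h₂l i hi).trans (h₁l i hi), ?_⟩
    · have := ht 0 (by omega)
      simp only [Function.iterate_zero, _root_.id] at this
      simp [Expr.eval, hs', this]
    · simpa using h₂b
    · simp only [Expr.cost, Nat.succ_mul]
      omega

/-- A `while` loop whose states stay polynomially bounded. The number `N` of iterations need not be
polynomial: it enters the cost. -/
theorem whileLoop {init : α → σ} {step : σ → σ} {cont : σ → Bool} {gs : σ → ℕ} {N G : α → ℕ}
    {out : α → σ} (hi : Comp G init) (hs : Comp gs step) (hc : Comp gs cont) (q : Polynomial ℕ)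
    (H : ∀ a, ∃ n ≤ N a, out a = step^[n] (init a) ∧ cont (step^[n] (init a)) = false ∧
      (∀ i < n, cont (step^[i] (init a)) = true) ∧
      ∀ i ≤ n, gs (step^[i] (init a)) ≤ G a ∧ sz (step^[i] (init a)) ≤ q.eval (sz a)) :
    Comp (fun a => (N a + 1) * G a) out := by
  have h1 := hi.one_le
  obtain ⟨pi, hpi, hi⟩ := hi
  obtain ⟨ps, hps, hs⟩ := hs
  obtain ⟨pc, hpc, hc⟩ := hc
  refine ⟨pi + q + ps.comp q + pc.comp q + 6, fun a => ?_, fun b => ?_⟩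
  · obtain ⟨n, -, h, -, -, h'⟩ := H a
    have := (h' n le_rfl).2
    simp only [Polynomial.eval_add]
    rw [h]; omega
  · -- register `b` holds the state; the condition is computed in register `b + 1` from a copy of it
    obtain ⟨I, hI⟩ := hi b
    obtain ⟨S, hS⟩ := hs b
    obtain ⟨C, hC⟩ := hc (b + 1)
    refine ⟨I.seq (((Cmd.assign (b + 1) (.var b)).seq C).seq (Cmd.loop (.var (b + 1))
      (S.seq ((Cmd.assign (b + 1) (.var b)).seq C)))), fun s a hsa => ?_⟩
    obtain ⟨n, hn, hout, hfin, hcont, hb⟩ := H a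
    have hCb : ∀ s, ∀ i ≤ n, s b = enc (step^[i] (init a)) → ∃ s' t,
        Exec ((Cmd.assign (b + 1) (.var b)).seq C) s s' t ∧ s' b = enc (step^[i] (init a)) ∧
        s' (b + 1) = enc (cont (step^[i] (init a))) ∧ (∀ i < b, s' i = s i) ∧
        t ≤ 2 + G a * (pc.comp q).eval (sz a) := fun s i hi hs => by
      obtain ⟨s₁, t₁, h₁, h₁b, h₁l, ht₁⟩ :=
        hC (Function.update s (b + 1) (s b)) _ (by simpa using hs)
      refine ⟨s₁, _, (Exec.assign _ _ _).seq h₁, ?_, h₁b, ?_, ?_⟩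
      · rw [h₁l b (by omega), Function.update_of_ne (by omega), hs]
      · intro i hi
        rw [h₁l i (by omega), Function.update_of_ne (by omega)]
      · obtain ⟨hg, hz⟩ := hb i hi
        have : gs (step^[i] (init a)) * pc.eval (sz (step^[i] (init a))) ≤
            G a * (pc.comp q).eval (sz a) := by
          rw [Polynomial.eval_comp]
          exact Nat.mul_le_mul hg (polyEval_mono pc hz)
        simp only [Expr.cost]
        omega
    obtain ⟨s₁, t₁, h₁, h₁b, h₁l, ht₁⟩ := hI s a hsa
    obtain ⟨s₂, t₂, h₂, h₂b, h₂c, h₂l, ht₂⟩ := hCb s₁ 0 (by omega) (by simpa using h₁b)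
    obtain ⟨s₃, t₃, h₃, h₃b, h₃l, ht₃⟩ := exec_loop (step := step) (cont := cont)
      (T := G a * (ps.comp q).eval (sz a) + (2 + G a * (pc.comp q).eval (sz a)))
      (c := S.seq ((Cmd.assign (b + 1) (.var b)).seq C)) (b := b) n (init a)
      (fun s i hi hs => by
        obtain ⟨u₁, v₁, k₁, k₁b, k₁l, kt₁⟩ := hS s _ hs
        rw [← Function.iterate_succ_apply' step] at k₁b
        obtain ⟨u₂, v₂, k₂, k₂b, k₂c, k₂l, kt₂⟩ := hCb u₁ (i + 1) hi k₁b
        refine ⟨u₂, _, k₁.seq k₂, k₂b, k₂c, fun i hi => (k₂l i hi).trans (k₁l i hi), ?_⟩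
        obtain ⟨hg, hz⟩ := hb i hi.le
        have : gs (step^[i] (init a)) * ps.eval (sz (step^[i] (init a))) ≤
            G a * (ps.comp q).eval (sz a) := by
          rw [Polynomial.eval_comp]
          exact Nat.mul_le_mul hg (polyEval_mono ps hz)
        omega) hcont hfin s₂ (by simpa using h₂b) (by simpa using h₂c)
    refine ⟨s₃, _, h₁.seq (h₂.seq h₃), by rw [hout, h₃b], fun i hi => ?_, ?_⟩
    · rw [h₃l i hi, h₂l i hi, h₁l i hi]
    · have h1 := h1 a
      have h6 : Polynomial.eval (sz a) (6 : Polynomial ℕ) = 6 := by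
        rw [show (6 : Polynomial ℕ) = Polynomial.C 6 from rfl, Polynomial.eval_C]
      simp only [Polynomial.eval_add, h6]
      set A := pi.eval (sz a)
      set B := (ps.comp q).eval (sz a)
      set D := (pc.comp q).eval (sz a)
      have hn' : n * (G a * B + (2 + G a * D) + 2) ≤ N a * (G a * (B + D + 4)) :=
        Nat.mul_le_mul hn (by nlinarith)
      have e : (N a + 1) * G a * (A + q.eval (sz a) + B + D + 6) =
          N a * (G a * (A + q.eval (sz a) + B + D + 6)) +
            G a * (A + q.eval (sz a) + B + D + 6) := by ring
      have e1 : N a * (G a * (B + D + 4)) ≤ N a * (G a * (A + q.eval (sz a) + B + D + 6)) := by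
        gcongr <;> omega
      have e2 : G a * (A + q.eval (sz a) + B + D + 6) =
        G a * A + G a * (q.eval (sz a) + B + D) + G a * D * 0 + G a * 6 := by ring
      have e3 : G a * D ≤ G a * (q.eval (sz a) + B + D) := by gcongr; omega
      rw [e]
      omega

end Comp

namespace PT

/-! ### Polynomial time operations on lists -/

variable {α β γ σ : Type} [Enc α] [Enc β] [Enc γ] [Enc σ]

theorem not {c : α → Bool} (hc : PT c) : PT (fun a => !c a) :=
  (Comp.ite hc (Comp.const false) (Comp.const true)).congr_enc fun a => by cases c a <;> rfl

theorem and {c d : α → Bool} (hc : PT c) (hd : PT d) : PT (fun a => c a && d a) :=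
  (Comp.ite hc hd (Comp.const false)).congr_enc fun a => by cases c a <;> rfl

theorem or {c d : α → Bool} (hc : PT c) (hd : PT d) : PT (fun a => c a || d a) :=
  (Comp.ite hc (Comp.const true) hd).congr_enc fun a => by cases c a <;> rfl

theorem tail {l : α → List β} (hl : PT l) : PT (fun a => (l a).tail) :=
  (Comp.listCase (f := fun _ => []) (h := fun _ _ t => t) hl (Comp.const [])
    Comp.id.snd.snd).congr_enc fun a => by cases l a <;> rfl

theorem headD {l : α → List β} {d : α → β} (hl : PT l) (hd : PT d) :
    PT (fun a => (l a).headD (d a)) :=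
  (Comp.listCase (f := d) (h := fun _ y _ => y) hl hd
    Comp.id.snd.fst).congr_enc fun a => by cases l a <;> rfl

theorem isEmpty {l : α → List β} (hl : PT l) : PT (fun a => (l a).isEmpty) :=
  (Comp.listCase (f := fun _ => true) (h := fun _ _ _ => false) hl (Comp.const true)
    (Comp.const false)).congr_enc fun a => by cases l a <;> rfl

/-- The results on all initial segments of the list have to be of polynomial size. -/
theorem foldl {l : α → List β} {f : α → σ → β → σ} {init : α → σ} (hl : PT l)
    (hi : PT init) (hf : PT fun x : α × σ × β => f x.1 x.2.1 x.2.2) (q : Polynomial ℕ)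
    (hq : ∀ a i, sz (((l a).take i).foldl (f a) (init a)) ≤ q.eval (sz a)) :
    PT (fun a => (l a).foldl (f a) (init a)) := by
  set step : α × List β × σ → α × List β × σ := fun x =>
    match x.2.1 with
    | [] => x
    | y :: t => (x.1, t, f x.1 x.2.2 y) with hstep
  have hs : PT step := Comp.listCase (f := fun x => x)
    (h := fun (x : α × List β × σ) y t => (x.1, t, f x.1 x.2.2 y)) Comp.id.snd.fst Comp.id
    (Comp.id.fst.fst.pair (Comp.id.snd.snd.pair
      (Comp.comp_pt (f := fun x : (α × List β × σ) × β × List β => (x.1.1, x.1.2.2, x.2.1)) hf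
        (Comp.id.fst.fst.pair (Comp.id.fst.snd.snd.pair Comp.id.snd.fst)))))
  have hit : ∀ a i, i ≤ (l a).length → step^[i] (a, l a, init a) =
      (a, (l a).drop i, ((l a).take i).foldl (f a) (init a)) := fun a i hi => by
    induction i with
    | zero => simp
    | succ i ih =>
      rw [Function.iterate_succ_apply', ih (by omega)]
      have : (l a).drop i = (l a)[i] :: (l a).drop (i + 1) := List.drop_eq_getElem_cons hi
      have h₂ : (l a).take (i + 1) = (l a).take i ++ [(l a)[i]] := by
        rw [List.take_add_one, List.getElem?_eq_getElem hi]; rfl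
      rw [h₂, List.foldl_append, hstep]
      simp only [this, List.foldl_cons, List.foldl_nil]
  obtain ⟨r, hr, -⟩ := id hl
  have key := Comp.whileLoop (N := fun a => (l a).length) (G := fun _ => 1) (gs := fun _ => 1)
    (init := fun a => (a, l a, init a)) (step := step) (cont := fun x => !x.2.1.isEmpty)
    (out := fun a => (a, [], (l a).foldl (f a) (init a))) (Comp.id.pair (hl.pair hi)) hs
    (not (isEmpty Comp.id.snd.fst)) (2 + Polynomial.X + r + q) (fun a => by
      refine ⟨_, le_rfl, ?_, ?_, fun i hi => ?_, fun i hi => ⟨le_rfl, ?_⟩⟩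
      · rw [hit a _ le_rfl]; simp
      · rw [hit a _ le_rfl]; simp
      · rw [hit a _ hi.le]; simp; omega
      · rw [hit a _ hi]
        have h₁ := hq a i
        have h₂ := sz_le_of_suffix (List.drop_suffix i (l a))
        have h₃ := hr a
        have h6 : Polynomial.eval (sz a) (2 : Polynomial ℕ) = 2 := by
          rw [show (2 : Polynomial ℕ) = Polynomial.C 2 from rfl, Polynomial.eval_C]
        simp only [sz_pair, Polynomial.eval_add, Polynomial.eval_X, h6]
        omega)
  refine (key.snd.snd).mono (1 + r) fun a => ?_
  have h₁ := length_lt_sz (l a)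
  have h₂ := hr a
  simp only [Polynomial.eval_add, Polynomial.eval_one]
  omega

theorem foldl_cons_map {β γ : Type} (f : β → γ) (l : List β) (m : List γ) :
    l.foldl (fun acc y => f y :: acc) m = (l.map f).reverse ++ m := by
  induction l generalizing m with
  | nil => simp
  | cons y l ih => simp [ih]

theorem sz_reverse (l : List β) : sz l.reverse = sz l := by
  induction l with
  | nil => rfl
  | cons a l ih =>
    have := sz_append l.reverse [a]
    simp only [List.reverse_cons, sz_cons, sz_nil] at *
    omega

theorem reverse {l : α → List β} (hl : PT l) : PT (fun a => (l a).reverse) := by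
  obtain ⟨r, hr, -⟩ := id hl
  have := foldl (f := fun _ (acc : List β) y => y :: acc) hl (Comp.const [])
    (Comp.cons Comp.id.snd.snd Comp.id.snd.fst) r (fun a i => by
      rw [foldl_cons_map (fun y => y)]
      have := sz_le_of_sublist (List.take_sublist i (l a))
      simp only [List.map_id', List.append_nil, sz_reverse]
      exact this.trans (hr a))
  refine this.congr_enc fun a => ?_
  rw [foldl_cons_map (fun y => y)]
  simp

theorem append {l m : α → List β} (hl : PT l) (hm : PT m) : PT (fun a => l a ++ m a) := by
  obtain ⟨r, hr, -⟩ := id hl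
  obtain ⟨p, hp, -⟩ := id hm
  have := foldl (f := fun _ (acc : List β) y => y :: acc) (reverse hl) hm
      (Comp.cons Comp.id.snd.snd Comp.id.snd.fst) (r + p) (fun a i => by
        rw [foldl_cons_map (fun y => y)]
        have h₁ := sz_le_of_sublist (List.take_sublist i (l a).reverse)
        have h₂ := sz_append ((l a).reverse.take i).reverse (m a)
        have := hr a
        have := hp a
        simp only [List.map_id', sz_reverse, Polynomial.eval_add] at *
        omega)
  refine this.congr_enc fun a => ?_
  rw [foldl_cons_map (fun y => y)]
  simp

/-- Sizes of the values of a polynomial time function on the elements of a list. -/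
theorem exists_bound {l : α → List β} {f : α → β → γ} (hl : PT l)
    (hf : PT fun x : α × β => f x.1 x.2) :
    ∃ q : Polynomial ℕ, ∀ a, (l a).length ≤ q.eval (sz a) ∧
      ∀ y ∈ l a, sz (f a y) ≤ q.eval (sz a) := by
  obtain ⟨r, hr, -⟩ := hl
  obtain ⟨p, hp, -⟩ := hf
  refine ⟨r + p.comp (1 + Polynomial.X + r), fun a => ⟨?_, fun y hy => ?_⟩⟩
  · have := length_lt_sz (l a)
    have := hr a
    simp only [Polynomial.eval_add]
    omega
  · have h₁ := hp (a, y)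
    have h₂ := sz_le_of_mem hy
    have h₃ := hr a
    have h₄ : p.eval (sz (a, y)) ≤ p.eval (1 + sz a + r.eval (sz a)) :=
      polyEval_mono p (by rw [sz_pair]; omega)
    simp only [Polynomial.eval_add, Polynomial.eval_comp, Polynomial.eval_one, Polynomial.eval_X]
    simp only at h₁
    omega

theorem map {l : α → List β} {f : α → β → γ} (hl : PT l)
    (hf : PT fun x : α × β => f x.1 x.2) : PT (fun a => (l a).map (f a)) := by
  obtain ⟨q, hq⟩ := exists_bound hl hf
  have := foldl (f := fun a acc y => f a y :: acc) hl (Comp.const [])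
    (Comp.cons (Comp.comp_pt (f := fun x : α × List γ × β => (x.1, x.2.2)) hf
      (Comp.id.fst.pair Comp.id.snd.snd)) Comp.id.snd.fst) (1 + q * (1 + q)) (fun a i => by
      rw [foldl_cons_map]
      have h₁ : sz (((l a).take i).map (f a)) ≤ 1 + (((l a).take i).map (f a)).length *
          (1 + q.eval (sz a)) := sz_le_of_forall fun z hz => by
        obtain ⟨y, hy, rfl⟩ := List.mem_map.1 hz
        exact (hq a).2 y (List.mem_of_mem_take hy)
      have h₂ : (((l a).take i).map (f a)).length ≤ q.eval (sz a) :=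
        le_trans (by simp) (hq a).1
      have h₃ := Nat.mul_le_mul_right (1 + q.eval (sz a)) h₂
      simp only [List.append_nil, sz_reverse, Polynomial.eval_add, Polynomial.eval_one,
        Polynomial.eval_mul]
      omega)
  refine (reverse this).congr_enc fun a => ?_
  rw [foldl_cons_map]
  simp

theorem filter {l : α → List β} {f : α → β → Bool} (hl : PT l)
    (hf : PT fun x : α × β => f x.1 x.2) : PT (fun a => (l a).filter (f a)) := by
  obtain ⟨r, hr, -⟩ := id hl
  have e : ∀ a (m : List β), m.foldl (fun acc y => if f a y then y :: acc else acc) [] =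
      (m.filter (f a)).reverse := fun a m => by
    suffices h : ∀ m', m.foldl (fun acc y => if f a y then y :: acc else acc) m' =
        (m.filter (f a)).reverse ++ m' by simpa using h []
    induction m with
    | nil => simp
    | cons y m ih => intro m'; by_cases hy : f a y <;> simp [ih, hy]
  have := foldl (f := fun a acc y => if f a y then y :: acc else acc) hl (Comp.const [])
    (Comp.ite (Comp.comp_pt (f := fun x : α × List β × β => (x.1, x.2.2)) hf
      (Comp.id.fst.pair Comp.id.snd.snd)) (Comp.cons Comp.id.snd.snd Comp.id.snd.fst)
      Comp.id.snd.fst) r (fun a i => by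
      rw [e, sz_reverse]
      exact (sz_le_of_sublist (List.filter_sublist.trans (List.take_sublist i (l a)))).trans
        (hr a))
  refine (reverse this).congr_enc fun a => ?_
  rw [e]
  simp

theorem any {l : α → List β} {f : α → β → Bool} (hl : PT l)
    (hf : PT fun x : α × β => f x.1 x.2) : PT (fun a => (l a).any (f a)) :=
  (not (isEmpty (filter hl hf))).congr_enc fun a => by
    congr 1
    rw [Bool.eq_iff_iff]
    simp

theorem all {l : α → List β} {f : α → β → Bool} (hl : PT l)
    (hf : PT fun x : α × β => f x.1 x.2) : PT (fun a => (l a).all (f a)) :=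
  (not (any (f := fun a y => !f a y) hl (not hf))).congr_enc fun a => by
    congr 1
    rw [Bool.eq_iff_iff]
    simp

/-! ### Unary arithmetic -/

/-- A number in unary is the same data as a list of units. -/
theorem units {n : α → ℕ} (hn : PT n) : PT (fun a => List.replicate (n a) ()) :=
  hn.congr_enc fun _ => rfl

theorem enc_length (l : List Unit) : enc l.length = enc l := by
  rw [enc_nat]
  congr 1
  exact (List.eq_replicate_of_mem (by simp)).symm

theorem length {l : α → List β} (hl : PT l) : PT (fun a => (l a).length) :=
  (map (f := fun _ _ => ()) hl (Comp.const ())).congr_enc fun a => by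
    rw [← enc_length]; simp

theorem succ {n : α → ℕ} (hn : PT n) : PT (fun a => n a + 1) :=
  (Comp.cons (Comp.const ()) (units hn)).congr_enc fun _ => rfl

theorem add {m n : α → ℕ} (hm : PT m) (hn : PT n) : PT (fun a => m a + n a) :=
  (append (units hm) (units hn)).congr_enc fun a => by rw [← enc_length]; simp

theorem drop {l : α → List β} {n : α → ℕ} (hl : PT l) (hn : PT n) :
    PT (fun a => (l a).drop (n a)) := by
  obtain ⟨r, hr, -⟩ := id hl
  have e : ∀ (m : List Unit) (l : List β), m.foldl (fun acc _ => acc.tail) l =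
      l.drop m.length := fun m => by
    induction m with
    | nil => simp
    | cons y m ih => intro l; simp [ih]
  have := foldl (f := fun _ (acc : List β) _ => acc.tail) (units hn) hl (tail Comp.id.snd.fst) r
    (fun a i => by
      rw [e]
      exact (sz_le_of_suffix (List.drop_suffix _ _)).trans (hr a))
  refine this.congr_enc fun a => ?_
  rw [e]
  simp

theorem sub {m n : α → ℕ} (hm : PT m) (hn : PT n) : PT (fun a => m a - n a) :=
  (drop (units hm) hn).congr_enc fun a => by rw [← enc_length]; simp

theorem le {m n : α → ℕ} (hm : PT m) (hn : PT n) : PT (fun a => decide (m a ≤ n a)) :=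
  (isEmpty (units (sub hm hn))).congr_enc fun a => by
    congr 1
    rw [Bool.eq_iff_iff]
    simp [Nat.sub_eq_zero_iff_le]

theorem lt {m n : α → ℕ} (hm : PT m) (hn : PT n) : PT (fun a => decide (m a < n a)) :=
  le (succ hm) hn

theorem eq {m n : α → ℕ} (hm : PT m) (hn : PT n) : PT (fun a => decide (m a = n a)) :=
  (and (le hm hn) (le hn hm)).congr_enc fun a => by
    congr 1
    rw [Bool.eq_iff_iff]
    simp [le_antisymm_iff]

theorem min {m n : α → ℕ} (hm : PT m) (hn : PT n) : PT (fun a => Min.min (m a) (n a)) :=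
  (sub hm (sub hm hn)).congr_enc fun a => by
    congr 1
    omega

theorem getD {l : α → List β} {i : α → ℕ} {d : α → β} (hl : PT l) (hi : PT i) (hd : PT d) :
    PT (fun a => (l a).getD (i a) (d a)) :=
  (headD (drop hl hi) hd).congr_enc fun a => by
    congr 1
    generalize l a = l
    generalize i a = i
    cases l <;> cases i <;> simp

theorem range {n : α → ℕ} (hn : PT n) : PT (fun a => List.range (n a)) := by
  obtain ⟨r, hr, -⟩ := id hn
  have e : ∀ m : ℕ, (List.replicate m ()).foldl (fun acc _ => acc.length :: acc) [] =
      (List.range m).reverse := fun m => by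
    induction m with
    | zero => rfl
    | succ m ih =>
      rw [List.replicate_succ', List.foldl_append, ih, List.range_succ]
      simp
  have := foldl (f := fun _ (acc : List ℕ) _ => acc.length :: acc) (units hn) (Comp.const [])
    (Comp.cons (length Comp.id.snd.fst) Comp.id.snd.fst) (1 + r * (1 + r)) (fun a i => by
      rw [List.take_replicate, e, sz_reverse]
      have h := hr a
      rw [sz_nat] at h
      have h₁ : sz (List.range (Min.min i (n a))) ≤ 1 + (List.range (Min.min i (n a))).length *
          (1 + r.eval (sz a)) := sz_le_of_forall fun z hz => by
        rw [List.mem_range] at hz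
        rw [sz_nat]
        omega
      have h₂ : (List.range (Min.min i (n a))).length ≤ r.eval (sz a) := by
        rw [List.length_range]; omega
      have h₃ := Nat.mul_le_mul_right (1 + r.eval (sz a)) h₂
      simp only [Polynomial.eval_add, Polynomial.eval_one, Polynomial.eval_mul]
      omega)
  refine (reverse this).congr_enc fun a => ?_
  rw [e]
  simp

theorem sum {l : α → List ℕ} (hl : PT l) : PT (fun a => (l a).sum) := by
  obtain ⟨r, hr, -⟩ := id hl
  have hs : ∀ l : List ℕ, sz l.sum ≤ sz l := fun l => by
    induction l with
    | nil => simp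
    | cons y l ih => simp only [sz_nat, List.sum_cons, sz_cons] at *; omega
  have := foldl (f := fun _ (acc : ℕ) y => acc + y) hl (Comp.const 0)
    (add Comp.id.snd.fst Comp.id.snd.snd) r (fun a i => by
      rw [← List.sum_eq_foldl]
      exact (hs _).trans ((sz_le_of_sublist (List.take_sublist i (l a))).trans (hr a)))
  refine this.congr_enc fun a => ?_
  rw [← List.sum_eq_foldl]

theorem flatMap {l : α → List β} {f : α → β → List γ} (hl : PT l)
    (hf : PT fun x : α × β => f x.1 x.2) : PT (fun a => (l a).flatMap (f a)) := by
  obtain ⟨q, hq⟩ := exists_bound hl hf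
  have e : ∀ a (m : List β), m.foldl (fun acc y => acc ++ f a y) [] = m.flatMap (f a) :=
    fun a m => by
    suffices h : ∀ m', m.foldl (fun acc y => acc ++ f a y) m' = m' ++ m.flatMap (f a) by
      simpa using h []
    induction m with
    | nil => simp
    | cons y m ih => intro m'; simp [ih]
  have hsz : ∀ a (m : List β), (∀ y ∈ m, sz (f a y) ≤ q.eval (sz a)) →
      sz (m.flatMap (f a)) ≤ 1 + m.length * q.eval (sz a) := fun a m hm => by
    induction m with
    | nil => simp
    | cons y m ih =>
      have h₁ := hm y (by simp)
      have h₂ := ih fun z hz => hm z (by simp [hz])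
      have h₃ := sz_append (f a y) (m.flatMap (f a))
      simp only [List.flatMap_cons, List.length_cons, Nat.succ_mul]
      omega
  have := foldl (f := fun a acc y => acc ++ f a y) hl (Comp.const [])
    (append Comp.id.snd.fst (Comp.comp_pt (f := fun x : α × List γ × β => (x.1, x.2.2)) hf
      (Comp.id.fst.pair Comp.id.snd.snd))) (1 + q * q) (fun a i => by
      rw [e]
      have h₁ := hsz a ((l a).take i) fun y hy => (hq a).2 y (List.mem_of_mem_take hy)
      have h₂ : ((l a).take i).length ≤ q.eval (sz a) := le_trans (by simp) (hq a).1
      have h₃ := Nat.mul_le_mul_right (q.eval (sz a)) h₂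
      simp only [Polynomial.eval_add, Polynomial.eval_one, Polynomial.eval_mul]
      omega)
  refine this.congr_enc fun a => ?_
  rw [e]

theorem iterate {n : α → ℕ} {f : α → σ → σ} {init : α → σ} (hn : PT n) (hi : PT init)
    (hf : PT fun x : α × σ => f x.1 x.2) (q : Polynomial ℕ)
    (hq : ∀ a i, sz ((f a)^[i] (init a)) ≤ q.eval (sz a)) :
    PT (fun a => (f a)^[n a] (init a)) := by
  have e : ∀ a (m : List Unit) s, m.foldl (fun acc _ => f a acc) s = (f a)^[m.length] s :=
    fun a m => by
    induction m with
    | nil => simp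
    | cons y m ih => intro s; simp [ih]
  have := foldl (f := fun a (acc : σ) _ => f a acc) (units hn) hi
    (Comp.comp_pt (f := fun x : α × σ × Unit => (x.1, x.2.1)) hf
      (Comp.id.fst.pair Comp.id.snd.fst)) q (fun a i => by rw [e]; exact hq a _)
  refine this.congr_enc fun a => ?_
  rw [e]
  simp

end PT

/-! ### Exhaustive search over words -/

section Words

variable {α β : Type} [Enc α] [Enc β]

/-- Increment of an odometer, least significant digit first, with the carry out of it. A digit is
represented by a nonempty suffix of the alphabet `al`; the letter it shows is the first one. -/
def nextWord (al : List β) : List (List β) → Bool × List (List β)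
  | [] => (true, [])
  | d :: ds => if d.tail.isEmpty then ((nextWord al ds).1, al :: (nextWord al ds).2)
      else (false, d.tail :: ds)

theorem PT.nextWord {al : α → List β} {ds : α → List (List β)} (hal : PT al) (hds : PT ds) :
    PT (fun a => nextWord (al a) (ds a)) := by
  set f : α → Bool × List (List β) → List β → Bool × List (List β) := fun a s d =>
    if s.1 then (if d.tail.isEmpty then (true, al a :: s.2) else (false, d.tail :: s.2))
    else (false, d :: s.2) with hf
  have e₁ : ∀ a (m : List (List β)) out,
      m.foldl (f a) (false, out) = (false, m.reverse ++ out) := fun a m => by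
    induction m with
    | nil => simp
    | cons d m ih => intro out; simp [hf] at ih ⊢; simp [ih]
  have e₂ : ∀ a (m : List (List β)) out, m.foldl (f a) (true, out) =
      ((GroupedDom.nextWord (al a) m).1, (GroupedDom.nextWord (al a) m).2.reverse ++ out) :=
    fun a m => by
    induction m with
    | nil => simp [GroupedDom.nextWord]
    | cons d m ih =>
      intro out
      have h₁ := e₁ a m
      by_cases hd : d.tail.isEmpty
      · rw [List.foldl_cons, show f a (true, out) d = (true, al a :: out) by
          simp only [hf]; rw [if_pos trivial, if_pos hd], ih, GroupedDom.nextWord, if_pos hd]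
        simp
      · rw [List.foldl_cons, show f a (true, out) d = (false, d.tail :: out) by
          simp only [hf]; rw [if_pos trivial, if_neg hd], h₁, GroupedDom.nextWord, if_neg hd]
        simp
  obtain ⟨p, hp, -⟩ := id hal
  obtain ⟨r, hr, -⟩ := id hds
  have hsz : ∀ a (m : List (List β)),
      sz (GroupedDom.nextWord (al a) m).2 ≤ sz m + m.length * sz (al a) :=
    fun a m => by
    induction m with
    | nil => simp [GroupedDom.nextWord]
    | cons d m ih =>
      have := sz_le_of_suffix (List.tail_suffix d)
      simp only [GroupedDom.nextWord, List.length_cons, Nat.succ_mul, sz_cons]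
      split <;> simp only [sz_cons] <;> omega
  have key := foldl (f := f) hds ((Comp.const true).pair (Comp.const []))
    (Comp.ite Comp.id.snd.fst.fst (Comp.ite (isEmpty (tail Comp.id.snd.snd))
        ((Comp.const true).pair (Comp.cons (hal.comp Comp.id.fst fun _ => le_rfl)
          Comp.id.snd.fst.snd))
        ((Comp.const false).pair (Comp.cons (tail Comp.id.snd.snd) Comp.id.snd.fst.snd)))
      ((Comp.const false).pair (Comp.cons Comp.id.snd.snd Comp.id.snd.fst.snd)))
    (4 + r + r * p) (fun a i => by
      rw [e₂, List.append_nil, sz_pair, sz_reverse]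
      have h₁ := sz_bool_le (GroupedDom.nextWord (al a) ((ds a).take i)).1
      have h₂ := hsz a ((ds a).take i)
      have h₃ := (sz_le_of_sublist (List.take_sublist i (ds a))).trans (hr a)
      have h₄ : ((ds a).take i).length * sz (al a) ≤ r.eval (sz a) * p.eval (sz a) :=
        Nat.mul_le_mul ((length_lt_sz _).le.trans h₃) (hp a)
      have h6 : Polynomial.eval (sz a) (4 : Polynomial ℕ) = 4 := by
        rw [show (4 : Polynomial ℕ) = Polynomial.C 4 from rfl, Polynomial.eval_C]
      simp only [Polynomial.eval_add, Polynomial.eval_mul, h6]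
      omega)
  refine (key.fst.pair (reverse key.snd)).congr_enc fun a => ?_
  rw [e₂]
  simp

end Words

section Odometer

variable {β : Type} (al : List β)

/-- The `i`-th reading of the odometer with `L` digits. -/
def reading (L i : ℕ) : List (List β) := (fun ds => (nextWord al ds).2)^[i] (List.replicate L al)

theorem reading_succ (L i : ℕ) : reading al L (i + 1) = (nextWord al (reading al L i)).2 :=
  Function.iterate_succ_apply' _ _ _

variable {al}

/-- The least significant digit counts modulo the size of the alphabet, the other digits count the
rounds. -/
theorem reading_succ_digit (hal : al ≠ []) (L i : ℕ) :
    reading al (L + 1) i = al.drop (i % al.length) :: reading al L (i / al.length) := by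
  have hB : 0 < al.length := List.length_pos_iff.2 hal
  induction i with
  | zero => simp [reading, List.replicate_succ]
  | succ i ih =>
    rw [reading_succ, ih, nextWord]
    have h₁ := Nat.div_add_mod i al.length
    have h₂ := Nat.mod_lt i hB
    set q := i / al.length
    set r := i % al.length
    by_cases h : r + 1 < al.length
    · have e : i + 1 = (r + 1) + al.length * q := by omega
      rw [if_neg, e, Nat.add_mul_mod_self_left, Nat.mod_eq_of_lt h, Nat.add_mul_div_left _ _ hB,
        Nat.div_eq_of_lt h]
      · simp
      · simp; omega
    · have e : i + 1 = 0 + al.length * (q + 1) := by rw [Nat.mul_succ]; omega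
      rw [if_pos, e, Nat.add_mul_mod_self_left, Nat.add_mul_div_left _ _ hB]
      · simp [reading_succ]
      · simp; omega

/-- The odometer overflows after exactly `al.length ^ L` steps. -/
theorem carry_iff (hal : al ≠ []) (L i : ℕ) (hi : i < al.length ^ L) :
    (nextWord al (reading al L i)).1 = true ↔ i + 1 = al.length ^ L := by
  have hB : 0 < al.length := List.length_pos_iff.2 hal
  induction L generalizing i with
  | zero =>
    have : i = 0 := by simpa using hi
    subst this
    simp [reading, nextWord]
  | succ L ih =>
    rw [reading_succ_digit hal, nextWord]
    have h₁ := Nat.div_add_mod i al.length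
    have h₂ := Nat.mod_lt i hB
    rw [pow_succ'] at hi ⊢
    have h₃ := ih (i / al.length) (Nat.div_lt_of_lt_mul hi)
    set q := i / al.length
    set r := i % al.length
    by_cases h : r + 1 < al.length
    · rw [if_neg (by simp; omega)]
      simp only [Bool.false_eq_true, false_iff]
      intro h₄
      have : (r + 1) % al.length = 0 := by
        rw [← Nat.add_mul_mod_self_left (r + 1) al.length q,
          show r + 1 + al.length * q = al.length * al.length ^ L by omega, Nat.mul_mod_right]
      rw [Nat.mod_eq_of_lt h] at this
      omega
    · rw [if_pos (by simp; omega)]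
      refine h₃.trans ?_
      have e : i + 1 = al.length * (q + 1) := by rw [Nat.mul_succ]; omega
      rw [e]
      exact (Nat.mul_right_inj hB.ne').symm

theorem reading_mem (hal : al ≠ []) (L i : ℕ) :
    (reading al L i).length = L ∧ ∀ d ∈ reading al L i, d <:+ al ∧ d ≠ [] := by
  have hB : 0 < al.length := List.length_pos_iff.2 hal
  induction L generalizing i with
  | zero =>
    have : reading al 0 i = [] := by
      induction i with
      | zero => rfl
      | succ i ih => rw [reading_succ, ih]; rfl
    simp [this]
  | succ L ih =>
    rw [reading_succ_digit hal]
    refine ⟨by simp [ih], fun d hd => ?_⟩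
    rcases List.mem_cons.1 hd with rfl | hd
    · exact ⟨List.drop_suffix _ _, by simpa using Nat.mod_lt i hB⟩
    · exact (ih _).2 d hd

theorem exists_reading (hal : al ≠ []) (d₀ : β) (w : List β) (hw : ∀ x ∈ w, x ∈ al) :
    ∃ i < al.length ^ w.length, (reading al w.length i).map (·.headD d₀) = w := by
  have hB : 0 < al.length := List.length_pos_iff.2 hal
  induction w with
  | nil => exact ⟨0, by simp, by simp [reading]⟩
  | cons x w ih =>
    obtain ⟨i, hi, h⟩ := ih fun y hy => hw y (by simp [hy])
    obtain ⟨j, hj, rfl⟩ := List.getElem_of_mem (hw x (by simp))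
    refine ⟨j + al.length * i, ?_, ?_⟩
    · rw [List.length_cons, pow_succ']
      calc j + al.length * i < al.length + al.length * i := by omega
        _ = al.length * (i + 1) := by ring
        _ ≤ _ := Nat.mul_le_mul_left _ hi
    · rw [List.length_cons, reading_succ_digit hal, Nat.add_mul_mod_self_left,
        Nat.mod_eq_of_lt hj, Nat.add_mul_div_left _ _ hB, Nat.div_eq_of_lt hj, zero_add,
        List.map_cons, h, List.drop_eq_getElem_cons hj]
      rfl

end Odometer

section Search

variable {α β : Type} [Enc α] [Enc β]

open scoped Classical in
/-- Some word of length `L` over the alphabet `al` passes the test. -/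
noncomputable def anyWord {β : Type} (al : List β) (L : ℕ) (test : List β → Bool) : Bool :=
  decide (∃ w : List β, w.length = L ∧ (∀ x ∈ w, x ∈ al) ∧ test w = true)

theorem anyWord_iff {β : Type} {al : List β} {L : ℕ} {test : List β → Bool} :
    anyWord al L test = true ↔ ∃ w : List β, w.length = L ∧ (∀ x ∈ w, x ∈ al) ∧ test w = true := by
  simp [anyWord]

/-- Exhaustive search over all words costs their number times the cost of the test. -/
theorem Comp.anyWord {al : α → List β} {L : α → ℕ} {test : α → List β → Bool}
    {gt : α × List β → ℕ} {G : α → ℕ} (hal : PT al) (hne : ∀ a, al a ≠ []) (hL : PT L) (d₀ : β)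
    (ht : Comp gt fun x : α × List β => test x.1 x.2)
    (hG : ∀ a w, w.length = L a → (∀ x ∈ w, x ∈ al a) → gt (a, w) ≤ G a) :
    Comp (fun a => (al a).length ^ L a * G a)
      (fun a => GroupedDom.anyWord (al a) (L a) (test a)) := by
  classical
  set letters : List (List β) → List β := fun ds => ds.map (·.headD d₀) with hletters
  have hlet : ∀ a i, (letters (reading (al a) (L a) i)).length = L a ∧
      ∀ x ∈ letters (reading (al a) (L a) i), x ∈ al a := fun a i => by
    obtain ⟨h₁, h₂⟩ := reading_mem (hne a) (L a) i
    refine ⟨by simp [hletters, h₁], fun x hx => ?_⟩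
    obtain ⟨d, hd, rfl⟩ := List.mem_map.1 hx
    obtain ⟨h₃, h₄⟩ := h₂ d hd
    obtain ⟨y, d, rfl⟩ := List.exists_cons_of_ne_nil h₄
    exact h₃.subset (by simp)
  -- the state: the argument, the odometer, whether a test has succeeded, and whether to go on
  set step : α × List (List β) × Bool × Bool → α × List (List β) × Bool × Bool := fun x =>
    (x.1, (nextWord (al x.1) x.2.1).2, test x.1 (letters x.2.1) || x.2.2.1,
      !(nextWord (al x.1) x.2.1).1) with hstep
  set gs : α × List (List β) × Bool × Bool → ℕ := fun x => gt (x.1, letters x.2.1)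
  have halS : PT fun x : α × List (List β) × Bool × Bool => al x.1 :=
    hal.comp Comp.id.fst fun _ => le_rfl
  have hletS : PT fun x : α × List (List β) × Bool × Bool => (x.1, letters x.2.1) :=
    Comp.id.fst.pair (PT.map (f := fun _ (d : List β) => d.headD d₀) Comp.id.snd.fst
      (PT.headD Comp.id.snd (Comp.const d₀)))
  have hgs : ∀ x, 1 ≤ gs x := fun x => ht.one_le _
  have hnext := (PT.nextWord halS Comp.id.snd.fst).of_pt hgs
  have hs : Comp gs step := ((Comp.id.of_pt hgs).fst).pair (hnext.snd.pair (Comp.pair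
    (Comp.congr_enc (Comp.ite (ht.comp (hletS.of_pt hgs) fun _ => le_rfl)
      (Comp.const true |>.of_pt hgs) (Comp.id.of_pt hgs).snd.snd.fst)
      (f' := fun x => test x.1 (letters x.2.1) || x.2.2.1)
      fun x => by cases test x.1 (letters x.2.1) <;> rfl)
    (Comp.comp_pt (PT.not Comp.id) hnext.fst)))
  have hit : ∀ a i, step^[i] (a, List.replicate (L a) (al a), false, true) =
      (a, reading (al a) (L a) i,
        decide (∃ j < i, test a (letters (reading (al a) (L a) j)) = true),
        i == 0 || !(nextWord (al a) (reading (al a) (L a) (i - 1))).1) := fun a i => by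
    induction i with
    | zero => simp [reading]
    | succ i ih =>
      rw [Function.iterate_succ_apply', ih, hstep, reading_succ]
      simp only [Prod.mk.injEq, true_and]
      refine ⟨?_, by simp⟩
      rw [Bool.eq_iff_iff]
      simp only [Bool.or_eq_true, decide_eq_true_eq]
      constructor
      · rintro (h | ⟨j, hj, h⟩)
        exacts [⟨i, by omega, h⟩, ⟨j, by omega, h⟩]
      · rintro ⟨j, hj, h⟩
        rcases Nat.lt_succ_iff_lt_or_eq.1 hj with hj | rfl
        exacts [Or.inr ⟨j, hj, h⟩, Or.inl h]
  obtain ⟨p, hp, -⟩ := _root_.id hal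
  obtain ⟨r, hr, -⟩ := _root_.id hL
  have hpos : ∀ a, 0 < (al a).length ^ L a := fun a =>
    pow_pos (List.length_pos_iff.2 (hne a)) _
  have hG1 : ∀ a, 1 ≤ G a := fun a =>
    (ht.one_le _).trans (hG a _ (hlet a 0).1 (hlet a 0).2)
  have hinit : PT fun a => (a, List.replicate (L a) (al a), false, true) :=
    Comp.id.pair (((PT.map (f := fun a _ => al a) (PT.units hL)
      (hal.comp Comp.id.fst fun _ => le_rfl)).congr_enc fun a => by simp).pair
        ((Comp.const false).pair (Comp.const true)))
  have key := Comp.whileLoop (N := fun a => (al a).length ^ L a) (G := G) (gs := gs)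
    (init := fun a => (a, List.replicate (L a) (al a), false, true)) (step := step)
    (cont := fun x => x.2.2.2)
    (out := fun a => step^[(al a).length ^ L a] (a, List.replicate (L a) (al a), false, true))
    (hinit.of_pt hG1) hs (Comp.id.of_pt hgs).snd.snd.snd
    (Polynomial.C 10 + Polynomial.X + r * (1 + p)) (fun a => by
      refine ⟨_, le_rfl, rfl, ?_, fun i hi => ?_, fun i hi => ⟨?_, ?_⟩⟩
      · rw [hit]
        have := hpos a
        have h := (carry_iff (hne a) (L a) ((al a).length ^ L a - 1) (by omega)).2 (by omega)
        simp only [h]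
        simp [hne a]
      · rw [hit]
        rcases Nat.eq_zero_or_pos i with rfl | hi0
        · simp
        · have h := (carry_iff (hne a) (L a) (i - 1) (by omega)).not.2 (by omega)
          simp only [Bool.not_eq_true] at h
          simp [h]
      · rw [hit]
        exact hG a _ (hlet a i).1 (hlet a i).2
      · rw [hit]
        obtain ⟨h₁, h₂⟩ := reading_mem (hne a) (L a) i
        have h₃ : sz (reading (al a) (L a) i) ≤ 1 + L a * (1 + sz (al a)) := by
          have := sz_le_of_forall (l := reading (al a) (L a) i) (B := sz (al a))
            fun d hd => sz_le_of_suffix (h₂ d hd).1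
          rwa [h₁] at this
        have h₄ := hp a
        have h₅ := hr a
        rw [sz_nat] at h₅
        have h₆ : L a * (1 + sz (al a)) ≤ r.eval (sz a) * (1 + p.eval (sz a)) :=
          Nat.mul_le_mul (by omega) (by omega)
        simp only [sz_pair, Polynomial.eval_add, Polynomial.eval_mul, Polynomial.eval_C,
          Polynomial.eval_X, Polynomial.eval_one]
        have h₇ := sz_bool_le (decide (∃ j < i, test a (letters (reading (al a) (L a) j)) = true))
        have h₈ := sz_bool_le (i == 0 || !(nextWord (al a) (reading (al a) (L a) (i - 1))).1)
        omega)
  refine (key.snd.snd.fst.mono (Polynomial.C 2) fun a => ?_).congr_enc fun a => ?_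
  · rw [Polynomial.eval_C]
    have := hpos a
    calc _ ≤ ((al a).length ^ L a * 2) * G a := Nat.mul_le_mul_right _ (by omega)
      _ = _ := by ring
  · rw [hit]
    congr 1
    rw [Bool.eq_iff_iff, anyWord_iff]
    simp only [decide_eq_true_eq]
    constructor
    · rintro ⟨w, hw, hwa, h⟩
      obtain ⟨i, hi, h'⟩ := exists_reading (hne a) d₀ w hwa
      rw [hw] at hi h'
      exact ⟨i, hi, by
        rw [show letters (reading (al a) (L a) i) = w from h']; exact h⟩
    · rintro ⟨i, -, h⟩
      exact ⟨_, (hlet a i).1, (hlet a i).2, h⟩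

end Search

/-! ### The tests of the algorithm -/

/-- Adjacency read off the matrix `M`. -/
def adjB (M : List (List Bool)) (u v : ℕ) : Bool := (M.getD u []).getD v false

/-- Membership in a list. -/
def memB (l : List ℕ) (v : ℕ) : Bool := l.any fun x => decide (x = v)

/-- Membership of `w` in the closed neighbourhood of `u`. -/
def nbB (M : List (List Bool)) (u w : ℕ) : Bool := decide (w = u) || adjB M u w

/-- `u` and `v` are twins. -/
def twinB (M : List (List Bool)) (u v : ℕ) : Bool := (List.range M.length).all fun w =>
  (nbB M u w && nbB M v w) || (!nbB M u w && !nbB M v w)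

/-- `uv` is an edge that violates the definition of a twin cover. -/
def badB (M : List (List Bool)) (K : List ℕ) (u v : ℕ) : Bool :=
  adjB M u v && !twinB M u v && !memB K u && !memB K v

/-- The vertices on edges that violate the definition of a twin cover. -/
def badRow (M : List (List Bool)) (K : List ℕ) : List ℕ :=
  (List.range M.length).filter fun u => (List.range M.length).any fun v => badB M K u v

/-- `K` is a twin cover. -/
def coverB (M : List (List Bool)) (K : List ℕ) : Bool := (badRow M K).isEmpty

/-- Add an end of the first violating edge; the bit says which one. -/
def branchStep (M : List (List Bool)) (K : List ℕ) (b : Bool) : List ℕ :=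
  if (badRow M K).isEmpty then K else
    (if b then (badRow M K).headD 0 else
      ((List.range M.length).filter fun v => badB M K ((badRow M K).headD 0) v).headD 0) :: K

/-- The result of the branchings that are described by `w`. -/
def branch (M : List (List Bool)) (w : List Bool) : List ℕ := w.foldl (branchStep M) []

/-- The value of a tabulated function at `v`, with default value `d`. -/
def lookup {β : Type} (d : β) (T : List (ℕ × β)) (v : ℕ) : β :=
  ((T.filter fun e => decide (e.1 = v)).headD (v, d)).2

/-- The table of the function on `K` whose values are listed in `w`. -/
def table {β : Type} (d : β) (K : List ℕ) (w : List β) : List (ℕ × β) :=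
  (List.range K.length).map fun i => (K.getD i 0, w.getD i d)

/-- The values of a guess at one vertex: `inX`, `own`, `shr` and `ptr`. -/
abbrev Letter : Type := (Bool × Bool × Bool) × ℕ

/-- The value of a guess outside the cover. -/
abbrev noLetter : Letter := ((false, false, false), 0)

/-- The data on which a guess is tested: the adjacency matrix, the twin cover, the table of the
guess, `r` and `k`. -/
abbrev Ctx : Type := List (List Bool) × List ℕ × List (ℕ × Letter) × ℕ × ℕ

section Tests

variable (c : Ctx)

-- These are the notions and conditions of `Guess` and `Guess.Valid`, read off the table.

def inXB (v : ℕ) : Bool := (lookup noLetter c.2.2.1 v).1.1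
def ownB (v : ℕ) : Bool := (lookup noLetter c.2.2.1 v).1.2.1
def shrB (v : ℕ) : Bool := (lookup noLetter c.2.2.1 v).1.2.2
def ptrB (v : ℕ) : ℕ := (lookup noLetter c.2.2.1 v).2
def parB (v : ℕ) : ℕ := if shrB c v then ptrB c (ptrB c v) else ptrB c v
def rootB (v : ℕ) : ℕ := (fun u => parB c u)^[c.1.length] v
def isRootB (v : ℕ) : Bool := inXB c v && decide (ptrB c v = v) && !ownB c v && !shrB c v
def touchedB (y : ℕ) : Bool := (List.range c.1.length).any fun x => inXB c x && adjB c.1 y x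
def forcedB (y : ℕ) : Bool := !memB c.2.1 y && !touchedB c y
def allowedB (w y : ℕ) : Bool :=
  !memB c.2.1 y && touchedB c y && adjB c.1 y w && adjB c.1 y (ptrB c w) &&
    (List.range c.1.length).all fun v => !(shrB c v && decide (ptrB c v = w)) || adjB c.1 y v
def fillB (ρ y : ℕ) : Bool :=
  !memB c.2.1 y && (List.range c.1.length).any fun x =>
    inXB c x && decide (rootB c x = ρ) && adjB c.1 y x
def partCard (ρ : ℕ) : ℕ :=
  ((List.range c.1.length).filter fun v => inXB c v && decide (rootB c v = ρ)).length
def ownCard (ρ : ℕ) : ℕ := ((List.range c.1.length).filter fun w =>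
  ownB c w && inXB c (ptrB c w) && decide (rootB c (ptrB c w) = ρ)).length
def demandB (ρ : ℕ) : ℕ := c.2.2.2.1 - partCard c ρ - ownCard c ρ

def treeB : Bool := (List.range c.1.length).all fun v => !inXB c v ||
  (inXB c (parB c v) && isRootB c (rootB c v) &&
    (ownB c v || shrB c v || isRootB c v || adjB c.1 v (ptrB c v)))
def ownPtrB : Bool := (List.range c.1.length).all fun w => !ownB c w || inXB c (ptrB c w) ||
  (decide (c.2.2.2.1 = 1) && decide (ptrB c w = w))
def shrPtrB : Bool := (List.range c.1.length).all fun v => !shrB c v || ownB c (ptrB c v)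
def dominatedB : Bool := (List.range c.1.length).all fun v => !memB c.2.1 v || inXB c v ||
  ownB c v || shrB c v || touchedB c v ||
  (List.range c.1.length).any fun y => forcedB c y && adjB c.1 v y
def cliqueB : Bool := (List.range c.1.length).all fun y => !forcedB c y ||
  decide (c.2.2.2.1 ≤ ((List.range c.1.length).filter fun u =>
    !memB c.2.1 u && (decide (u = y) || adjB c.1 y u)).length)
def partLeB : Bool := (List.range c.1.length).all fun ρ => !isRootB c ρ ||
  decide (partCard c ρ + ownCard c ρ ≤ c.2.2.2.1)
def countB : Bool := decide (
  ((List.range c.1.length).filter fun v => isRootB c v).length +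
  ((List.range c.1.length).filter fun y => forcedB c y && (List.range c.1.length).all fun u =>
    !decide (u < y) || !(!memB c.2.1 u && adjB c.1 y u)).length +
  ((List.range c.1.length).filter fun w => ownB c w && !inXB c (ptrB c w)).length ≤ c.2.2.2.2)

/-- All conditions on a guess but the last one. -/
def localB : Bool :=
  treeB c && ownPtrB c && shrPtrB c && dominatedB c && cliqueB c && partLeB c && countB c

/-- Hall's condition for the two sets of vertices whose indicator functions are tabulated in `S`. -/
def hallB (S : List (ℕ × Bool × Bool)) : Bool := decide (
  ((List.range c.1.length).filter fun w => (lookup (false, false) S w).1 && ownB c w).length +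
  (((List.range c.1.length).filter fun ρ =>
    (lookup (false, false) S ρ).2 && isRootB c ρ).map fun ρ => demandB c ρ).sum ≤
  ((List.range c.1.length).filter fun y =>
    ((List.range c.1.length).any fun w =>
      (lookup (false, false) S w).1 && ownB c w && allowedB c w y) ||
    ((List.range c.1.length).any fun ρ =>
      (lookup (false, false) S ρ).2 && isRootB c ρ && fillB c ρ y)).length)

end Tests

-- Unification must not unfold the tests when the lemmas of the next section are applied.
attribute [irreducible] adjB memB nbB twinB badB badRow coverB branchStep branch lookup table inXB
  ownB shrB ptrB parB rootB isRootB touchedB forcedB allowedB fillB partCard ownCard demandB treeB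
  ownPtrB shrPtrB dominatedB cliqueB partLeB countB localB hallB

namespace PT

variable {α β : Type} [Enc α] [Enc β]

theorem adjB {M : α → List (List Bool)} {u v : α → ℕ} (hM : PT M) (hu : PT u) (hv : PT v) :
    PT fun a => adjB (M a) (u a) (v a) := by
  unfold GroupedDom.adjB
  exact getD (getD hM hu (Comp.const [])) hv (Comp.const false)

theorem memB {l : α → List ℕ} {v : α → ℕ} (hl : PT l) (hv : PT v) :
    PT fun a => memB (l a) (v a) := by
  unfold GroupedDom.memB
  exact any hl (eq Comp.id.snd (hv.comp Comp.id.fst fun _ => le_rfl))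

theorem nbB {M : α → List (List Bool)} {u v : α → ℕ} (hM : PT M) (hu : PT u) (hv : PT v) :
    PT fun a => nbB (M a) (u a) (v a) := by
  unfold GroupedDom.nbB
  exact or (eq hv hu) (adjB hM hu hv)

theorem twinB {M : α → List (List Bool)} {u v : α → ℕ} (hM : PT M) (hu : PT u) (hv : PT v) :
    PT fun a => twinB (M a) (u a) (v a) := by
  have : PT fun x : List (List Bool) × ℕ × ℕ => GroupedDom.twinB x.1 x.2.1 x.2.2 := by
    unfold GroupedDom.twinB
    repeat' with_reducible first
      | exact Comp.id | apply Comp.fst | apply Comp.snd | apply all | apply range | apply length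
      | apply or | apply and | apply not | apply nbB
  exact this.comp (hM.pair (hu.pair hv)) fun _ => le_rfl

theorem badB {M : α → List (List Bool)} {K : α → List ℕ} {u v : α → ℕ} (hM : PT M) (hK : PT K)
    (hu : PT u) (hv : PT v) : PT fun a => badB (M a) (K a) (u a) (v a) := by
  unfold GroupedDom.badB
  exact and (and (and (adjB hM hu hv) (not (twinB hM hu hv))) (not (memB hK hu))) (not (memB hK hv))

theorem badRow {M : α → List (List Bool)} {K : α → List ℕ} (hM : PT M) (hK : PT K) :
    PT fun a => badRow (M a) (K a) := by
  have : PT fun x : List (List Bool) × List ℕ => GroupedDom.badRow x.1 x.2 := by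
    unfold GroupedDom.badRow
    repeat' with_reducible first
      | exact Comp.id | apply Comp.fst | apply Comp.snd | apply any | apply filter | apply range
      | apply length | apply badB
  exact this.comp (hM.pair hK) fun _ => le_rfl

theorem coverB {M : α → List (List Bool)} {K : α → List ℕ} (hM : PT M) (hK : PT K) :
    PT fun a => coverB (M a) (K a) := by
  unfold GroupedDom.coverB
  exact isEmpty (badRow hM hK)

theorem branchStep {M : α → List (List Bool)} {K : α → List ℕ} {b : α → Bool} (hM : PT M)
    (hK : PT K) (hb : PT b) : PT fun a => branchStep (M a) (K a) (b a) := by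
  have : PT fun x : List (List Bool) × List ℕ × Bool =>
      GroupedDom.branchStep x.1 x.2.1 x.2.2 := by
    unfold GroupedDom.branchStep
    repeat' with_reducible first
      | exact Comp.id | apply Comp.fst | apply Comp.snd | apply Comp.ite | apply Comp.cons
      | apply filter | apply isEmpty | apply headD | apply range | apply length | apply badB
      | apply badRow | apply Comp.const
  exact this.comp (hM.pair (hK.pair hb)) fun _ => le_rfl

theorem _root_.GroupedDom.headD_range_filter_le (n : ℕ) (f : ℕ → Bool) :
    ((List.range n).filter f).headD 0 ≤ n := by
  rcases h : (List.range n).filter f with _ | ⟨y, l⟩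
  · simp
  · have : y ∈ (List.range n).filter f := by simp [h]
    simpa using (List.mem_range.1 (List.mem_filter.1 this).1).le

/-- These bounds hold for any `M`, also if it is not an adjacency matrix; they serve to estimate
sizes and costs. -/
theorem _root_.GroupedDom.branch_bounds (M : List (List Bool)) (w : List Bool) :
    (GroupedDom.branch M w).length ≤ w.length ∧ ∀ v ∈ GroupedDom.branch M w, v ≤ M.length := by
  induction w using List.reverseRecOn with
  | nil => simp [GroupedDom.branch]
  | append_singleton w b ih =>
    have e : GroupedDom.branch M (w ++ [b]) =
        GroupedDom.branchStep M (GroupedDom.branch M w) b := by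
      simp [GroupedDom.branch]
    rw [e, GroupedDom.branchStep]
    split
    · exact ⟨ih.1.trans (by simp), ih.2⟩
    · refine ⟨by simpa using ih.1, fun v hv => ?_⟩
      rcases List.mem_cons.1 hv with rfl | hv
      · split
        · unfold GroupedDom.badRow; exact headD_range_filter_le _ _
        · exact headD_range_filter_le _ _
      · exact ih.2 v hv

theorem branch {M : α → List (List Bool)} {w : α → List Bool} (hM : PT M) (hw : PT w) :
    PT fun a => branch (M a) (w a) := by
  have : PT fun x : List (List Bool) × List Bool => GroupedDom.branch x.1 x.2 := by
    unfold GroupedDom.branch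
    refine foldl (f := fun (x : List (List Bool) × List Bool) K b =>
        GroupedDom.branchStep x.1 K b) Comp.id.snd (Comp.const [])
      (branchStep Comp.id.fst.fst Comp.id.snd.fst Comp.id.snd.snd)
      (Polynomial.C 1 + Polynomial.X * (Polynomial.C 2 + Polynomial.C 2 * Polynomial.X))
      fun x i => ?_
    obtain ⟨h₁, h₂⟩ := branch_bounds x.1 (x.2.take i)
    rw [show List.foldl _ _ _ = GroupedDom.branch x.1 (x.2.take i) by unfold GroupedDom.branch; rfl]
    have h₃ : sz (GroupedDom.branch x.1 (x.2.take i)) ≤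
        1 + (GroupedDom.branch x.1 (x.2.take i)).length * (1 + (2 * x.1.length + 1)) :=
      sz_le_of_forall fun v hv => by
        rw [sz_nat]
        have := h₂ v hv
        omega
    have h₄ : (x.2.take i).length ≤ x.2.length := by simp
    have h₅ := length_lt_sz x.1
    have h₆ := length_lt_sz x.2
    have h₇ : sz x = 1 + sz x.1 + sz x.2 := rfl
    simp only [Polynomial.eval_add, Polynomial.eval_mul, Polynomial.eval_C, Polynomial.eval_X]
    refine h₃.trans (Nat.add_le_add_left (Nat.mul_le_mul ?_ ?_) 1) <;> omega
  exact this.comp (hM.pair hw) fun _ => le_rfl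

theorem lookup {T : α → List (ℕ × β)} {v : α → ℕ} (d : β) (hT : PT T) (hv : PT v) :
    PT fun a => lookup d (T a) (v a) := by
  have : PT fun x : List (ℕ × β) × ℕ => GroupedDom.lookup d x.1 x.2 := by
    unfold GroupedDom.lookup
    exact (headD (filter Comp.id.fst (eq Comp.id.snd.fst Comp.id.fst.snd))
      (Comp.id.snd.pair (Comp.const d))).snd
  exact this.comp (hT.pair hv) fun _ => le_rfl

theorem table {K : α → List ℕ} {w : α → List β} (d : β) (hK : PT K) (hw : PT w) :
    PT fun a => table d (K a) (w a) := by
  have : PT fun x : List ℕ × List β => GroupedDom.table d x.1 x.2 := by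
    unfold GroupedDom.table
    exact map (range (length Comp.id.fst)) ((getD Comp.id.fst.fst Comp.id.snd (Comp.const 0)).pair
      (getD Comp.id.fst.snd Comp.id.snd (Comp.const d)))
  exact this.comp (hK.pair hw) fun _ => le_rfl

variable {c : α → Ctx} {v : α → ℕ}

theorem inXB (hc : PT c) (hv : PT v) : PT fun a => inXB (c a) (v a) := by
  unfold GroupedDom.inXB
  exact (lookup _ hc.snd.snd.fst hv).fst.fst

theorem ownB (hc : PT c) (hv : PT v) : PT fun a => ownB (c a) (v a) := by
  unfold GroupedDom.ownB
  exact (lookup _ hc.snd.snd.fst hv).fst.snd.fst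

theorem shrB (hc : PT c) (hv : PT v) : PT fun a => shrB (c a) (v a) := by
  unfold GroupedDom.shrB
  exact (lookup _ hc.snd.snd.fst hv).fst.snd.snd

theorem ptrB (hc : PT c) (hv : PT v) : PT fun a => ptrB (c a) (v a) := by
  unfold GroupedDom.ptrB
  exact (lookup _ hc.snd.snd.fst hv).snd

theorem parB (hc : PT c) (hv : PT v) : PT fun a => parB (c a) (v a) := by
  unfold GroupedDom.parB
  exact Comp.ite (shrB hc hv) (ptrB hc (ptrB hc hv)) (ptrB hc hv)

theorem rootB (hc : PT c) (hv : PT v) : PT fun a => rootB (c a) (v a) := by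
  have hptr : ∀ (c : Ctx) (v : ℕ), sz (GroupedDom.ptrB c v) ≤ sz c := fun c v => by
    have h₁ : sz c.2.2.1 ≤ sz c := by
      obtain ⟨M, K, T, r, k⟩ := c
      simp only [sz_pair]
      omega
    rw [GroupedDom.ptrB, GroupedDom.lookup]
    rcases h : c.2.2.1.filter fun e => decide (e.1 = v) with _ | ⟨e, l⟩
    · rw [h, List.headD_nil]; exact one_le_sz c
    · have : e ∈ c.2.2.1.filter fun e => decide (e.1 = v) := by simp [h]
      have h₂ := sz_le_of_mem (List.mem_filter.1 this).1
      have h₃ : sz e = 1 + sz e.1 + (1 + sz e.2.1 + sz e.2.2) := rfl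
      rw [h, List.headD_cons]
      omega
  have : PT fun x : Ctx × ℕ => GroupedDom.rootB x.1 x.2 := by
    unfold GroupedDom.rootB
    refine iterate (f := fun x : Ctx × ℕ => fun u => GroupedDom.parB x.1 u)
      (length Comp.id.fst.fst) Comp.id.snd (parB Comp.id.fst.fst Comp.id.snd) Polynomial.X
      fun x i => ?_
    have h₇ : sz x = 1 + sz x.1 + sz x.2 := rfl
    rw [Polynomial.eval_X]
    cases i with
    | zero => simp only [Function.iterate_zero, _root_.id]; omega
    | succ i =>
      rw [Function.iterate_succ_apply', GroupedDom.parB]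
      split
      · have := hptr x.1 (GroupedDom.ptrB x.1 ((fun u => GroupedDom.parB x.1 u)^[i] x.2)); omega
      · have := hptr x.1 ((fun u => GroupedDom.parB x.1 u)^[i] x.2); omega
  exact this.comp (hc.pair hv) fun _ => le_rfl

theorem isRootB (hc : PT c) (hv : PT v) : PT fun a => isRootB (c a) (v a) := by
  unfold GroupedDom.isRootB
  exact and (and (and (inXB hc hv) (eq (ptrB hc hv) hv)) (not (ownB hc hv))) (not (shrB hc hv))

theorem touchedB (hc : PT c) (hv : PT v) : PT fun a => touchedB (c a) (v a) := by
  have : PT fun x : Ctx × ℕ => GroupedDom.touchedB x.1 x.2 := by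
    unfold GroupedDom.touchedB
    repeat' with_reducible first
      | exact Comp.id | apply Comp.fst | apply Comp.snd | apply any | apply range | apply length
      | apply and | apply inXB | apply adjB
  exact this.comp (hc.pair hv) fun _ => le_rfl

theorem forcedB (hc : PT c) (hv : PT v) : PT fun a => forcedB (c a) (v a) := by
  unfold GroupedDom.forcedB
  exact and (not (memB hc.snd.fst hv)) (not (touchedB hc hv))

theorem allowedB {y : α → ℕ} (hc : PT c) (hv : PT v) (hy : PT y) :
    PT fun a => allowedB (c a) (v a) (y a) := by
  have : PT fun x : Ctx × ℕ × ℕ => GroupedDom.allowedB x.1 x.2.1 x.2.2 := by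
    unfold GroupedDom.allowedB
    repeat' with_reducible first
      | exact Comp.id | apply Comp.fst | apply Comp.snd | apply all | apply range | apply length
      | apply and | apply or | apply not | apply eq | apply memB | apply touchedB | apply ptrB
      | apply shrB | apply adjB
  exact this.comp (hc.pair (hv.pair hy)) fun _ => le_rfl

theorem fillB {y : α → ℕ} (hc : PT c) (hv : PT v) (hy : PT y) :
    PT fun a => fillB (c a) (v a) (y a) := by
  have : PT fun x : Ctx × ℕ × ℕ => GroupedDom.fillB x.1 x.2.1 x.2.2 := by
    unfold GroupedDom.fillB
    repeat' with_reducible first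
      | exact Comp.id | apply Comp.fst | apply Comp.snd | apply any | apply range | apply length
      | apply and | apply not | apply eq | apply memB | apply inXB | apply rootB | apply adjB
  exact this.comp (hc.pair (hv.pair hy)) fun _ => le_rfl

theorem partCard (hc : PT c) (hv : PT v) : PT fun a => partCard (c a) (v a) := by
  have : PT fun x : Ctx × ℕ => GroupedDom.partCard x.1 x.2 := by
    unfold GroupedDom.partCard
    repeat' with_reducible first
      | exact Comp.id | apply Comp.fst | apply Comp.snd | apply length | apply filter
      | apply range | apply and | apply eq | apply inXB | apply rootB
  exact this.comp (hc.pair hv) fun _ => le_rfl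

theorem ownCard (hc : PT c) (hv : PT v) : PT fun a => ownCard (c a) (v a) := by
  have : PT fun x : Ctx × ℕ => GroupedDom.ownCard x.1 x.2 := by
    unfold GroupedDom.ownCard
    repeat' with_reducible first
      | exact Comp.id | apply Comp.fst | apply Comp.snd | apply length | apply filter
      | apply range | apply and | apply eq | apply ownB | apply ptrB | apply inXB | apply rootB
  exact this.comp (hc.pair hv) fun _ => le_rfl

theorem demandB (hc : PT c) (hv : PT v) : PT fun a => demandB (c a) (v a) := by
  unfold GroupedDom.demandB
  exact sub (sub hc.snd.snd.snd.fst (partCard hc hv)) (ownCard hc hv)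

theorem localB (hc : PT c) : PT fun a => localB (c a) := by
  have : PT fun x : Ctx => GroupedDom.localB x := by
    unfold GroupedDom.localB treeB ownPtrB shrPtrB dominatedB cliqueB partLeB countB
    repeat' with_reducible first
      | exact Comp.id | apply Comp.fst | apply Comp.snd | apply length | apply filter | apply any
      | apply all | apply range | apply and | apply or | apply not | apply eq | apply le
      | apply lt | apply add | apply memB | apply ownB | apply shrB | apply ptrB | apply inXB
      | apply parB | apply rootB | apply isRootB | apply touchedB | apply forcedB | apply partCard
      | apply ownCard | apply adjB | apply Comp.const
  exact this.comp hc fun _ => le_rfl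

theorem hallB {S : α → List (ℕ × Bool × Bool)} (hc : PT c) (hS : PT S) :
    PT fun a => hallB (c a) (S a) := by
  have : PT fun x : Ctx × List (ℕ × Bool × Bool) => GroupedDom.hallB x.1 x.2 := by
    unfold GroupedDom.hallB
    repeat' with_reducible first
      | exact Comp.id | apply Comp.fst | apply Comp.snd | apply length | apply filter | apply any
      | apply range | apply and | apply or | apply sum | apply map | apply le | apply add
      | apply ownB | apply isRootB | apply allowedB | apply fillB | apply demandB | apply lookup
     
  exact this.comp (hc.pair hS) fun _ => le_rfl

end PT

/-! ### The cost of the algorithm -/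

/-- The first `m` with `c a m`, by linear search. -/
theorem Comp.findLeast {α : Type} [Enc α] {c : α → ℕ → Bool} {gc : α × ℕ → ℕ} {G m : α → ℕ}
    (hc : Comp gc fun x : α × ℕ => c x.1 x.2) (q : Polynomial ℕ) (hm : ∀ a, m a ≤ q.eval (sz a))
    (h₁ : ∀ a, c a (m a) = true) (h₂ : ∀ a, ∀ i < m a, c a i = false)
    (hG : ∀ a, ∀ i ≤ m a, gc (a, i) ≤ G a) : Comp G m := by
  have hG1 : ∀ a, 1 ≤ G a := fun a => (hc.one_le (a, 0)).trans (hG a 0 (Nat.zero_le _))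
  have hit : ∀ a i, (fun x : α × ℕ => (x.1, x.2 + 1))^[i] (a, 0) = (a, i) := fun a i => by
    induction i with
    | zero => rfl
    | succ i ih => rw [Function.iterate_succ_apply', ih]
  have key := Comp.whileLoop (N := m) (G := G) (gs := gc) (init := fun a => (a, 0))
    (step := fun x : α × ℕ => (x.1, x.2 + 1)) (cont := fun x => !c x.1 x.2)
    (out := fun a => (a, m a)) ((Comp.id.pair (Comp.const 0)).of_pt hG1)
    ((Comp.id.fst.pair (PT.succ Comp.id.snd)).of_pt hc.one_le) (Comp.comp_pt (PT.not Comp.id) hc)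
    (Polynomial.C 2 + Polynomial.X + Polynomial.C 2 * q) (fun a => by
      refine ⟨m a, le_rfl, (hit a _).symm, ?_, fun i hi => ?_, fun i hi => ⟨?_, ?_⟩⟩
      · rw [hit]; simp [h₁]
      · rw [hit]; simp [h₂ a i hi]
      · rw [hit]; exact hG a i hi
      · rw [hit, sz_pair, sz_nat]
        have := hm a
        simp only [Polynomial.eval_add, Polynomial.eval_mul, Polynomial.eval_C, Polynomial.eval_X]
        omega)
  refine key.snd.mono (1 + q) fun a => ?_
  have := hm a
  simp only [Polynomial.eval_add, Polynomial.eval_one]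
  rw [mul_comm]
  exact Nat.mul_le_mul_left _ (by omega)

/-- The letters of a guess whose pointers lie in `K`. The pointer `0` is always allowed, so that
there is a letter even if `K` is empty. -/
def letters (K : List ℕ) : List Letter :=
  [(false, false, false), (false, false, true), (false, true, false), (false, true, true),
    (true, false, false), (true, false, true), (true, true, false), (true, true, true)].flatMap
    fun b => (0 :: K).map fun p => (b, p)

theorem length_letters (K : List ℕ) : (letters K).length = 8 * (K.length + 1) := by
  simp [letters]; ring

theorem mem_letters {K : List ℕ} {x : Letter} : x ∈ letters K ↔ x.2 = 0 ∨ x.2 ∈ K := by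
  obtain ⟨⟨a, b, c⟩, p⟩ := x
  cases a <;> cases b <;> cases c <;> simp [letters, eq_comm]

/-- The alphabet for the indicator functions of two sets. -/
def bitPairs : List (Bool × Bool) := [(false, false), (false, true), (true, false), (true, true)]

theorem mem_bitPairs (x : Bool × Bool) : x ∈ bitPairs := by
  obtain ⟨a, b⟩ := x
  cases a <;> cases b <;> simp [bitPairs]

/-- The instance as the algorithm works with it: matrix, `r` and `k`, the latter in unary. -/
abbrev Input : Type := List (List Bool) × ℕ × ℕ

/-- The guess `w` passes all tests. -/
noncomputable def acceptB (I : Input) (K : List ℕ) (w : List Letter) : Bool :=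
  localB (I.1, K, table noLetter K w, I.2) && !anyWord bitPairs K.length fun S =>
    !hallB (I.1, K, table noLetter K w, I.2) (table (false, false) K S)

/-- `K` is a twin cover, and some guess passes all tests. -/
noncomputable def solveWith (I : Input) (K : List ℕ) : Bool :=
  coverB I.1 K && anyWord (letters K) K.length fun w => acceptB I K w

/-- Some twin cover found by `t` branchings leads to a solution. -/
noncomputable def solveAt (I : Input) (t : ℕ) : Bool :=
  anyWord [false, true] t fun w => solveWith I (branch I.1 w)

/-- Some twin cover is found by `t` branchings. -/
noncomputable def coverAt (M : List (List Bool)) (t : ℕ) : Bool :=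
  anyWord [false, true] t fun w => coverB M (branch M w)

theorem comp_acceptB : Comp (fun x : (Input × List ℕ) × List Letter => 4 ^ x.1.2.length)
    fun x => acceptB x.1.1 x.1.2 x.2 := by
  unfold acceptB
  have hctx : PT fun x : (Input × List ℕ) × List Letter =>
      ((x.1.1.1, x.1.2, table noLetter x.1.2 x.2, x.1.1.2) : Ctx) :=
    Comp.id.fst.fst.fst.pair (Comp.id.fst.snd.pair
      ((PT.table _ Comp.id.fst.snd Comp.id.snd).pair Comp.id.fst.fst.snd))
  have h1 : ∀ x : (Input × List ℕ) × List Letter, 1 ≤ 4 ^ x.1.2.length := fun x =>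
    Nat.one_le_pow _ _ (by norm_num)
  have h := Comp.anyWord (al := fun _ : (Input × List ℕ) × List Letter => bitPairs)
    (L := fun x => x.1.2.length) (G := fun _ => 1) (gt := fun _ => 1)
    (test := fun x S => !hallB (x.1.1.1, x.1.2, table noLetter x.1.2 x.2, x.1.1.2)
      (table (false, false) x.1.2 S)) (Comp.const _) (fun _ => by simp [bitPairs])
    (PT.length Comp.id.fst.snd) (false, false)
    (PT.not (PT.hallB (hctx.comp Comp.id.fst fun _ => le_rfl)
      (PT.table _ Comp.id.fst.fst.snd Comp.id.snd))) (fun _ _ _ _ => le_rfl)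
  have h' := h.mono' (g' := fun x => 4 ^ x.1.2.length) fun x => by simp [bitPairs]
  exact (Comp.ite ((PT.localB hctx).of_pt h1) (Comp.comp_pt (PT.not Comp.id) h')
    ((Comp.const false).of_pt h1)).congr_enc fun x => by
      congr 1
      cases localB (x.1.1.1, x.1.2, table noLetter x.1.2 x.2, x.1.1.2) <;> simp

theorem comp_solveWith : Comp
    (fun x : Input × List ℕ => (8 * (x.2.length + 1)) ^ x.2.length * 4 ^ x.2.length)
    fun x => solveWith x.1 x.2 := by
  unfold solveWith
  have h1 : ∀ x : Input × List ℕ, 1 ≤ (8 * (x.2.length + 1)) ^ x.2.length * 4 ^ x.2.length :=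
    fun x => Nat.mul_pos (Nat.pow_pos (by omega)) (Nat.pow_pos (by omega))
  have hlet : PT fun x : Input × List ℕ => letters x.2 := by
    unfold letters
    exact PT.flatMap (Comp.const _) (PT.map (Comp.cons (Comp.const 0) Comp.id.fst.snd)
      (Comp.id.fst.snd.pair Comp.id.snd))
  have h := Comp.anyWord (al := fun x : Input × List ℕ => letters x.2)
    (L := fun x => x.2.length) (G := fun x => 4 ^ x.2.length)
    (test := fun x w => acceptB x.1 x.2 w) hlet
    (fun x => List.ne_nil_of_length_pos (by rw [length_letters]; omega))
    (PT.length Comp.id.snd) noLetter comp_acceptB (fun _ _ _ _ => le_rfl)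
  simp only [length_letters] at h
  exact (Comp.ite ((PT.coverB Comp.id.fst.fst Comp.id.snd).of_pt h1) h
    ((Comp.const false).of_pt h1)).congr_enc fun x => by
      congr 1
      cases coverB x.1.1 x.2 <;> simp

theorem comp_solveAt : Comp (fun x : Input × ℕ => (64 * (x.2 + 1)) ^ x.2)
    fun x => solveAt x.1 x.2 := by
  unfold solveAt
  have hb : PT fun y : (Input × ℕ) × List Bool => (y.1.1, branch y.1.1.1 y.2) :=
    Comp.id.fst.fst.pair (PT.branch Comp.id.fst.fst.fst Comp.id.snd)
  have h1 : ∀ x : Input × List ℕ, 1 ≤ (8 * (x.2.length + 1)) ^ x.2.length * 4 ^ x.2.length :=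
    fun x => Nat.mul_pos (Nat.pow_pos (by omega)) (Nat.pow_pos (by omega))
  have h := Comp.anyWord (al := fun _ : Input × ℕ => [false, true])
    (L := fun x => x.2) (G := fun x => (8 * (x.2 + 1)) ^ x.2 * 4 ^ x.2)
    (test := fun x w => solveWith x.1 (branch x.1.1 w)) (Comp.const _) (fun _ => by simp)
    Comp.id.snd false (comp_solveWith.comp (hb.of_pt fun y => h1 (y.1.1, branch y.1.1.1 y.2))
      fun _ => le_rfl)
    (fun x w hw _ => by
      have hl := (branch_bounds x.1.1 w).1
      rw [hw] at hl
      refine Nat.mul_le_mul ?_ (Nat.pow_le_pow_right (by norm_num) hl)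
      exact (Nat.pow_le_pow_left (by dsimp only; omega) _).trans
        (Nat.pow_le_pow_right (by omega) hl))
  refine h.mono' fun x => ?_
  rw [← mul_pow, ← mul_pow]
  exact (Nat.pow_le_pow_left (by simp; omega) _)

theorem comp_coverAt : Comp (fun x : List (List Bool) × ℕ => 2 ^ x.2)
    fun x => coverAt x.1 x.2 := by
  unfold coverAt
  have h := Comp.anyWord (al := fun _ : List (List Bool) × ℕ => [false, true])
    (L := fun x => x.2) (G := fun _ => 1) (gt := fun _ => 1)
    (test := fun x w => coverB x.1 (branch x.1 w)) (Comp.const _) (fun _ => by simp)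
    Comp.id.snd false (PT.coverB Comp.id.fst.fst (PT.branch Comp.id.fst.fst Comp.id.snd))
    (fun _ _ _ _ => le_rfl)
  exact h.mono' fun x => by simp

/-! ### Families of units -/

section Families

variable {V : Type*} {G : SimpleGraph V}

/-- `𝒟` is the set of units of an `r`-grouped dominating set. -/
structure IsUnitFamily (G : SimpleGraph V) (r : ℕ) (𝒟 : Finset (Finset V)) : Prop where
  disjoint : ∀ D ∈ 𝒟, ∀ E ∈ 𝒟, D ≠ E → Disjoint D E
  card_eq : ∀ D ∈ 𝒟, D.card = r
  connected : ∀ D ∈ 𝒟, (G.induce (D : Set V)).Connected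
  dominating : ∀ v, ∃ D ∈ 𝒟, ∃ u ∈ D, v = u ∨ G.Adj u v

theorem IsUnitFamily.hasGroupedDominatingSet {r k : ℕ} {𝒟 : Finset (Finset V)}
    (h : IsUnitFamily G r 𝒟) (hk : 𝒟.card ≤ k) : HasGroupedDominatingSet G r k := by
  refine ⟨𝒟.card, hk, fun i => (𝒟.equivFin.symm i : Finset V), ?_, fun i => h.card_eq _ (by simp),
    fun i => h.connected _ (by simp), fun v _ => ?_⟩
  · intro i j hij
    refine h.disjoint _ (by simp) _ (by simp) fun e => hij ?_
    exact 𝒟.equivFin.symm.injective (Subtype.ext e)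
  · obtain ⟨D, hD, u, hu, huv⟩ := h.dominating v
    have hu' : u ∈ ⋃ i, ((𝒟.equivFin.symm i : Finset V) : Set V) :=
      Set.mem_iUnion.2 ⟨𝒟.equivFin ⟨D, hD⟩, by simpa using hu⟩
    rcases huv with rfl | huv
    exacts [Or.inl hu', Or.inr ⟨u, hu', huv⟩]

theorem HasGroupedDominatingSet.exists_unitFamily {r k : ℕ}
    (h : HasGroupedDominatingSet G r k) :
    ∃ 𝒟 : Finset (Finset V), IsUnitFamily G r 𝒟 ∧ 𝒟.card ≤ k := by
  classical
  obtain ⟨m, hm, D, hD⟩ := h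
  refine ⟨Finset.univ.image D, ⟨?_, ?_, ?_, fun v => ?_⟩, Finset.card_image_le.trans (by simpa)⟩
  · simp only [Finset.mem_image, Finset.mem_univ, true_and, forall_exists_index,
      forall_apply_eq_imp_iff]
    exact fun i j hij => hD.disjoint i j fun e => hij (e ▸ rfl)
  · simpa using hD.card_eq
  · simp only [Finset.mem_image, Finset.mem_univ, true_and, forall_exists_index,
      forall_apply_eq_imp_iff]
    exact hD.connected
  · have : ∃ i, v ∈ D i ∨ ∃ u ∈ D i, G.Adj u v := by
      rcases hD.dominating v trivial with h | ⟨u, hu, huv⟩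
      · obtain ⟨i, hi⟩ := Set.mem_iUnion.1 h
        exact ⟨i, Or.inl hi⟩
      · obtain ⟨i, hi⟩ := Set.mem_iUnion.1 hu
        exact ⟨i, Or.inr ⟨u, hi, huv⟩⟩
    obtain ⟨i, h⟩ := this
    refine ⟨D i, Finset.mem_image_of_mem _ (Finset.mem_univ i), ?_⟩
    rcases h with h | ⟨u, hu, huv⟩
    exacts [⟨v, h, Or.inl rfl⟩, ⟨u, hu, Or.inr huv⟩]

theorem IsTwinCover.adj_iff {K : Finset V} (hK : IsTwinCover G K) {u v : V} (hu : u ∉ K)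
    (hv : v ∉ K) (huv : u = v ∨ G.Adj u v) (w : V) : w = u ∨ G.Adj u w ↔ w = v ∨ G.Adj v w := by
  rcases huv with rfl | huv
  · rfl
  · rcases hK u v huv with h | h | h
    · exact Set.ext_iff.1 h w
    exacts [absurd h hu, absurd h hv]

/-- Adjacent vertices outside a twin cover have the same neighbours in the cover. -/
theorem IsTwinCover.adj_iff_of_mem {K : Finset V} (hK : IsTwinCover G K) {u v w : V} (hu : u ∉ K)
    (hv : v ∉ K) (huv : u = v ∨ G.Adj u v) (hw : w ∈ K) : G.Adj u w ↔ G.Adj v w := by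
  have h := hK.adj_iff hu hv huv w
  have h₁ : w ≠ u := fun e => hu (e ▸ hw)
  have h₂ : w ≠ v := fun e => hv (e ▸ hw)
  simpa [h₁, h₂] using h

/-- Being equal or adjacent is transitive outside a twin cover. -/
theorem IsTwinCover.adj_trans {K : Finset V} (hK : IsTwinCover G K) {u v w : V} (hu : u ∉ K)
    (hv : v ∉ K) (huv : u = v ∨ G.Adj u v) (hvw : v = w ∨ G.Adj v w) : u = w ∨ G.Adj u w := by
  have := (hK.adj_iff hu hv huv w).2 (hvw.imp Eq.symm id)
  exact this.imp Eq.symm id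

theorem connected_induce_of_reachable {S : Set V} {v : V} (hv : v ∈ S)
    (h : ∀ w (hw : w ∈ S), (G.induce S).Reachable ⟨w, hw⟩ ⟨v, hv⟩) : (G.induce S).Connected :=
  (SimpleGraph.connected_iff_exists_forall_reachable _).2
    ⟨⟨v, hv⟩, fun w => (h w.1 w.2).symm⟩

theorem reachable_induce_of_adj {S : Set V} {u v : V} (hu : u ∈ S) (hv : v ∈ S)
    (h : G.Adj u v) : (G.induce S).Reachable ⟨u, hu⟩ ⟨v, hv⟩ :=
  SimpleGraph.Adj.reachable (by simpa using h)

end Families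

/-! ### Certificates -/

/-- What is guessed about a solution, for each vertex of a twin cover: whether it lies in the
solution, and how it is attached to a unit of the solution. A vertex `w` with `own w` is the name of
a *connector*, a vertex of the solution outside the cover that is adjacent to `w` and to `ptr w`; a
vertex `v` with `shr v` is adjacent to the connector named `ptr v`; any other vertex of the solution
is adjacent to `ptr v`, or is a root and equal to `ptr v`. If the units are single vertices, then a
connector can also be a unit of its own; in this case its name `w` is equal to `ptr w`. -/
structure Guess (V : Type*) where
  inX : V → Bool
  own : V → Bool
  shr : V → Bool
  ptr : V → V

namespace Guess

variable {V : Type*} (φ : Guess V) (G : SimpleGraph V) (K : Finset V)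

/-- The next vertex of the cover on the way to the root of the unit. -/
def par (v : V) : V := if φ.shr v then φ.ptr (φ.ptr v) else φ.ptr v

/-- A vertex of the solution that represents its unit. -/
def IsRoot (v : V) : Prop := φ.inX v ∧ φ.ptr v = v ∧ ¬ φ.own v ∧ ¬ φ.shr v

/-- Adjacent to the part of the solution in the cover. -/
def Touched (y : V) : Prop := ∃ x, φ.inX x ∧ G.Adj y x

/-- A vertex that can only be dominated from its own clique outside the cover. -/
def Forced (y : V) : Prop := y ∉ K ∧ ¬ φ.Touched G y

/-- `y` can be the connector named `w`. -/
def Allowed (w y : V) : Prop :=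
  y ∉ K ∧ φ.Touched G y ∧ G.Adj y w ∧ G.Adj y (φ.ptr w) ∧ ∀ v, φ.shr v → φ.ptr v = w → G.Adj y v

variable [Fintype V]

/-- The root of the unit of `v`. -/
def root (v : V) : V := φ.par^[Fintype.card V] v

/-- `y` can be added to the unit with root `ρ`. -/
def Fill (ρ y : V) : Prop := y ∉ K ∧ ∃ x, φ.inX x ∧ φ.root x = ρ ∧ G.Adj y x

open scoped Classical in
/-- The vertices of the cover in the unit with root `ρ`. -/
noncomputable def part (ρ : V) : Finset V :=
  Finset.univ.filter fun v => φ.inX v ∧ φ.root v = ρ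

open scoped Classical in
/-- The names of the connectors in the unit with root `ρ`. -/
noncomputable def ownOf (ρ : V) : Finset V :=
  Finset.univ.filter fun w => φ.own w ∧ φ.inX (φ.ptr w) ∧ φ.root (φ.ptr w) = ρ

/-- The number of vertices that are still missing in the unit with root `ρ`. -/
noncomputable def demand (r : ℕ) (ρ : V) : ℕ := r - (φ.part ρ).card - (φ.ownOf ρ).card

open scoped Classical in
/-- The conditions on a guess under which it extends to a solution. Apart from the last one they
are local; `hall` is Hall's condition for choosing the connectors and the remaining vertices of the
units, in which only unions of groups of equal demands have to be tested. -/
structure Valid [LinearOrder V] (r k : ℕ) : Prop where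
  supp : ∀ v, φ.inX v ∨ φ.own v ∨ φ.shr v → v ∈ K
  tree : ∀ v, φ.inX v → φ.inX (φ.par v) ∧ φ.IsRoot (φ.root v) ∧
    (φ.own v ∨ φ.shr v ∨ φ.IsRoot v ∨ G.Adj v (φ.ptr v))
  own_ptr : ∀ w, φ.own w → φ.inX (φ.ptr w) ∨ (r = 1 ∧ φ.ptr w = w)
  shr_ptr : ∀ v, φ.shr v → φ.own (φ.ptr v)
  cover : ∀ v ∈ K, φ.inX v ∨ φ.own v ∨ φ.shr v ∨ φ.Touched G v ∨ ∃ y, φ.Forced G K y ∧ G.Adj v y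
  clique : ∀ y, φ.Forced G K y →
    r ≤ (Finset.univ.filter fun u => u ∉ K ∧ (u = y ∨ G.Adj y u)).card
  part_le : ∀ ρ, φ.IsRoot ρ → (φ.part ρ).card + (φ.ownOf ρ).card ≤ r
  count : (Finset.univ.filter fun v => φ.IsRoot v).card +
    (Finset.univ.filter fun y => φ.Forced G K y ∧ ∀ u < y, ¬ (u ∉ K ∧ G.Adj y u)).card +
    (Finset.univ.filter fun w => φ.own w ∧ ¬ φ.inX (φ.ptr w)).card ≤ k
  hall : ∀ A B : Finset V, (Finset.univ.filter fun w => w ∈ A ∧ φ.own w).card +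
    ∑ ρ ∈ Finset.univ.filter (fun ρ => ρ ∈ B ∧ φ.IsRoot ρ), φ.demand r ρ ≤
    (Finset.univ.filter fun y => (∃ w, w ∈ A ∧ φ.own w ∧ φ.Allowed G K w y) ∨
      ∃ ρ, ρ ∈ B ∧ φ.IsRoot ρ ∧ φ.Fill G K ρ y).card

open scoped Classical in
/-- The unit with root `ρ`, for connectors `z w` and sets `F ρ` of further vertices. -/
noncomputable def unit (z : V → V) (F : V → Finset V) (ρ : V) : Finset V :=
  φ.part ρ ∪ (φ.ownOf ρ).image z ∪ F ρ

variable {φ}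

theorem mem_part {ρ v : V} : v ∈ φ.part ρ ↔ φ.inX v ∧ φ.root v = ρ := by simp [part]

theorem mem_ownOf {ρ w : V} :
    w ∈ φ.ownOf ρ ↔ φ.own w ∧ φ.inX (φ.ptr w) ∧ φ.root (φ.ptr w) = ρ := by simp [ownOf]

theorem mem_unit {z : V → V} {F : V → Finset V} {ρ y : V} : y ∈ φ.unit z F ρ ↔
    (φ.inX y ∧ φ.root y = ρ) ∨
    (∃ w, φ.own w ∧ φ.inX (φ.ptr w) ∧ φ.root (φ.ptr w) = ρ ∧ z w = y) ∨ y ∈ F ρ := by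
  simp only [unit, Finset.mem_union, Finset.mem_image, mem_part, mem_ownOf, and_assoc, or_assoc]

theorem _root_.GroupedDom.IsTwinCover.touched_iff {V : Type*} {φ : Guess V} {G : SimpleGraph V}
    {K : Finset V} (hK : IsTwinCover G K) (hsupp : ∀ v, φ.inX v → v ∈ K) {u v : V} (hu : u ∉ K)
    (hv : v ∉ K) (huv : u = v ∨ G.Adj u v) : φ.Touched G u ↔ φ.Touched G v :=
  exists_congr fun x => and_congr_right fun hx => hK.adj_iff_of_mem hu hv huv (hsupp x hx)

end Guess

namespace Guess.Valid

variable {V : Type*} {φ : Guess V} {G : SimpleGraph V} {K : Finset V} [Fintype V] [LinearOrder V]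
  {r k : ℕ}

/-! ### A valid guess extends to a solution -/

/-- Hall's theorem supplies connectors `z w` and sets `F ρ` that complete the units. -/
theorem exists_slots (h : φ.Valid G K r k) : ∃ (z : V → V) (F : V → Finset V),
    (∀ w, φ.own w → φ.Allowed G K w (z w)) ∧
    (∀ w w', φ.own w → φ.own w' → z w = z w' → w = w') ∧
    (∀ ρ, φ.IsRoot ρ → (F ρ).card = φ.demand r ρ ∧ ∀ y ∈ F ρ, φ.Fill G K ρ y) ∧
    (∀ ρ ρ', φ.IsRoot ρ → φ.IsRoot ρ' → ρ ≠ ρ' → Disjoint (F ρ) (F ρ')) ∧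
    (∀ w ρ, φ.own w → φ.IsRoot ρ → z w ∉ F ρ) := by
  classical
  set ι := {w : V // φ.own w} ⊕ (Σ ρ : {ρ : V // φ.IsRoot ρ}, Fin (φ.demand r ρ.1)) with hι
  set t : ι → Finset V := fun i => match i with
    | Sum.inl w => Finset.univ.filter fun y => φ.Allowed G K w.1 y
    | Sum.inr ρ => Finset.univ.filter fun y => φ.Fill G K ρ.1.1 y with ht
  have hall : ∀ s : Finset ι, s.card ≤ (s.biUnion t).card := fun s => by
    have key := h.hall (s.toLeft.image Subtype.val)
      (s.toRight.image fun q => q.1.1)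
    have h₁ : s.toLeft.card ≤
        (Finset.univ.filter fun w => w ∈ s.toLeft.image Subtype.val ∧ φ.own w).card := by
      rw [← Finset.card_image_of_injective s.toLeft Subtype.val_injective]
      refine Finset.card_le_card fun w hw => ?_
      obtain ⟨w', hw', rfl⟩ := Finset.mem_image.1 hw
      simp only [Finset.mem_filter, Finset.mem_univ, true_and]
      exact ⟨hw, w'.2⟩
    have h₂ : s.toRight.card ≤ ∑ ρ ∈ Finset.univ.filter (fun ρ =>
        ρ ∈ s.toRight.image (fun q => q.1.1) ∧ φ.IsRoot ρ), φ.demand r ρ := by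
      rw [Finset.card_eq_sum_card_fiberwise (f := fun q => q.1.1) (t := Finset.univ.filter (fun ρ =>
        ρ ∈ s.toRight.image (fun q => q.1.1) ∧ φ.IsRoot ρ))]
      · refine Finset.sum_le_sum fun ρ hρ => ?_
        have hρ' : φ.IsRoot ρ := (Finset.mem_filter.1 hρ).2.2
        calc _ ≤ ((Finset.univ : Finset (Fin (φ.demand r ρ))).image
              fun j =>
                (⟨⟨ρ, hρ'⟩, j⟩ : Σ ρ : {ρ : V // φ.IsRoot ρ}, Fin (φ.demand r ρ.1))).card := by
              refine Finset.card_le_card fun q hq => ?_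
              obtain ⟨⟨ρ', hρ''⟩, j⟩ := q
              obtain rfl : ρ' = ρ := (Finset.mem_filter.1 hq).2
              exact Finset.mem_image_of_mem _ (Finset.mem_univ j)
          _ ≤ _ := Finset.card_image_le.trans (by simp)
      · intro q hq
        simp only [Finset.coe_filter, Finset.mem_univ, true_and, Set.mem_ofPred_eq]
        exact ⟨Finset.mem_image_of_mem _ hq, q.1.2⟩
    rw [← Finset.card_toLeft_add_card_toRight]
    refine (Nat.add_le_add h₁ h₂).trans (key.trans (Finset.card_le_card fun y hy => ?_))
    simp only [Finset.mem_filter, Finset.mem_univ, true_and] at hy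
    rw [Finset.mem_biUnion]
    rcases hy with ⟨w, hw, -, hy⟩ | ⟨ρ, hρ, -, hy⟩
    · obtain ⟨w, hw', rfl⟩ := Finset.mem_image.1 hw
      exact ⟨Sum.inl w, Finset.mem_toLeft.1 hw', by simp [ht, hy]⟩
    · obtain ⟨q, hq, rfl⟩ := Finset.mem_image.1 hρ
      exact ⟨Sum.inr q, Finset.mem_toRight.1 hq, by simp [ht, hy]⟩
  obtain ⟨f, hf, hft⟩ := (Finset.all_card_le_biUnion_card_iff_exists_injective t).1 hall
  refine ⟨fun w => if hw : φ.own w then f (Sum.inl ⟨w, hw⟩) else w,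
    fun ρ => if hρ : φ.IsRoot ρ then Finset.univ.image fun j => f (Sum.inr ⟨⟨ρ, hρ⟩, j⟩) else ∅,
    fun w hw => ?_, fun w w' hw hw' e => ?_, fun ρ hρ => ⟨?_, fun y hy => ?_⟩,
    fun ρ ρ' hρ hρ' hne => ?_, fun w ρ hw hρ hmem => ?_⟩
  · have := hft (Sum.inl ⟨w, hw⟩)
    simpa [ht, hw] using this
  · simp only [hw, hw', dite_true] at e
    exact congrArg Subtype.val (Sum.inl_injective (hf e))
  · simp only [hρ, dite_true]
    rw [Finset.card_image_of_injective]
    · simp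
    · intro j j' e
      have := Sum.inr_injective (hf e)
      simpa using this
  · simp only [hρ, dite_true, Finset.mem_image, Finset.mem_univ, true_and] at hy
    obtain ⟨j, rfl⟩ := hy
    have := hft (Sum.inr ⟨⟨ρ, hρ⟩, j⟩)
    simpa [ht] using this
  · simp only [hρ, hρ', dite_true]
    rw [Finset.disjoint_left]
    intro y hy hy'
    obtain ⟨j, -, rfl⟩ := Finset.mem_image.1 hy
    obtain ⟨j', -, e⟩ := Finset.mem_image.1 hy'
    have := Sum.inr_injective (hf e)
    exact hne (congrArg (fun q => q.1.1) this).symm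
  · simp only [hρ, hw, dite_true, Finset.mem_image, Finset.mem_univ, true_and] at hmem
    obtain ⟨j, e⟩ := hmem
    cases hf e

theorem root_par (h : φ.Valid G K r k) {v : V} (hv : φ.inX v) : φ.root (φ.par v) = φ.root v := by
  have h₁ : φ.par (φ.root v) = φ.root v := by
    obtain ⟨-, h₂, -, h₃⟩ := (h.tree v hv).2.1
    rw [par, if_neg h₃, h₂]
  rw [root, ← Function.iterate_succ_apply, Function.iterate_succ_apply']
  exact h₁

theorem _root_.GroupedDom.Guess.IsRoot.root_eq {V : Type*} [Fintype V] {φ : Guess V} {ρ : V}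
    (hρ : φ.IsRoot ρ) : φ.root ρ = ρ := by
  have h₁ : φ.par ρ = ρ := by
    obtain ⟨-, h₂, -, h₃⟩ := hρ
    rw [par, if_neg h₃, h₂]
  exact Function.iterate_fixed h₁ _

theorem connected_unit (h : φ.Valid G K r k) {z : V → V} {F : V → Finset V}
    (hz : ∀ w, φ.own w → φ.Allowed G K w (z w))
    (hF : ∀ ρ, φ.IsRoot ρ → ∀ y ∈ F ρ, φ.Fill G K ρ y) {ρ : V} (hρ : φ.IsRoot ρ) :
    (G.induce (φ.unit z F ρ : Set V)).Connected := by
  have hmem : ∀ v, φ.inX v → φ.root v = ρ → v ∈ (φ.unit z F ρ : Set V) := fun v h₁ h₂ =>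
    Finset.mem_coe.2 (mem_unit.2 (Or.inl ⟨h₁, h₂⟩))
  have hzmem : ∀ w, φ.own w → φ.inX (φ.ptr w) → φ.root (φ.ptr w) = ρ →
      z w ∈ (φ.unit z F ρ : Set V) := fun w h₁ h₂ h₃ =>
    Finset.mem_coe.2 (mem_unit.2 (Or.inr (Or.inl ⟨w, h₁, h₂, h₃, rfl⟩)))
  have hρm := hmem ρ hρ.1 (hρ.root_eq)
  -- each vertex of the cover in the unit is joined to the next one on the way to the root
  have step : ∀ v (h₁ : φ.inX v) (h₂ : φ.root v = ρ), (G.induce (φ.unit z F ρ : Set V)).Reachable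
      ⟨v, hmem v h₁ h₂⟩ ⟨φ.par v, hmem _ (h.tree v h₁).1 ((h.root_par h₁).trans h₂)⟩ :=
    fun v h₁ h₂ => by
    have h₃ := (h.tree v h₁).1
    have h₄ := (h.root_par h₁).trans h₂
    by_cases hs : φ.shr v
    · have e : φ.par v = φ.ptr (φ.ptr v) := by rw [par, if_pos hs]
      have ho := h.shr_ptr v hs
      obtain ⟨-, -, -, h₅, h₆⟩ := hz _ ho
      simp only [e] at h₃ h₄ ⊢
      exact (reachable_induce_of_adj _ (hzmem _ ho h₃ h₄) (h₆ v hs rfl).symm).trans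
        (reachable_induce_of_adj _ _ h₅)
    · have e : φ.par v = φ.ptr v := by rw [par, if_neg hs]
      simp only [e] at h₃ h₄ ⊢
      by_cases ho : φ.own v
      · obtain ⟨-, -, h₆, h₅, -⟩ := hz _ ho
        exact (reachable_induce_of_adj _ (hzmem _ ho h₃ h₄) h₆.symm).trans
          (reachable_induce_of_adj _ _ h₅)
      · rcases (h.tree v h₁).2.2 with h₅ | h₅ | h₅ | h₅
        · exact absurd h₅ ho
        · exact absurd h₅ hs
        · simp only [h₅.2.1]
          exact SimpleGraph.Reachable.refl _
        · exact reachable_induce_of_adj _ _ h₅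
  have iter : ∀ i v (h₁ : φ.inX v) (h₂ : φ.root v = ρ), φ.par^[i] v = ρ →
      (G.induce (φ.unit z F ρ : Set V)).Reachable ⟨v, hmem v h₁ h₂⟩ ⟨ρ, hρm⟩ := fun i => by
    induction i with
    | zero =>
      intro v h₁ h₂ e
      simp only [Function.iterate_zero, id] at e
      subst e
      exact SimpleGraph.Reachable.refl _
    | succ i ih =>
      intro v h₁ h₂ e
      exact (step v h₁ h₂).trans (ih _ (h.tree v h₁).1 ((h.root_par h₁).trans h₂) e)
  refine connected_induce_of_reachable hρm fun y hy => ?_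
  rcases mem_unit.1 (Finset.mem_coe.1 hy) with ⟨h₁, h₂⟩ | ⟨w, h₁, h₂, h₃, rfl⟩ | hy'
  · exact iter _ y h₁ h₂ h₂
  · exact (reachable_induce_of_adj hy (hmem _ h₂ h₃) (hz w h₁).2.2.2.1).trans (iter _ _ h₂ h₃ h₃)
  · obtain ⟨-, x, h₁, h₂, h₃⟩ := hF ρ hρ y hy'
    exact (reachable_induce_of_adj hy (hmem _ h₁ h₂) h₃).trans (iter _ _ h₁ h₂ h₂)

/-- The solution consists of the units of the roots, a unit inside the clique of each forced vertex,
and, if `r = 1`, the connectors whose names do not point to a vertex of the solution. -/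
theorem hasGroupedDominatingSet (hK : IsTwinCover G K) (hr : 0 < r) (h : φ.Valid G K r k) :
    HasGroupedDominatingSet G r k := by
  classical
  obtain ⟨z, F, hz, hzi, hF, hFd, hzF⟩ := h.exists_slots
  have hX : ∀ v, φ.inX v → v ∈ K := fun v hv => h.supp v (Or.inl hv)
  -- the clique of a vertex outside the cover
  set clq : V → Finset V := fun y => Finset.univ.filter fun u => u ∉ K ∧ (u = y ∨ G.Adj y u)
    with hclq
  have hmemclq : ∀ y u, u ∈ clq y ↔ u ∉ K ∧ (u = y ∨ G.Adj y u) := fun y u => by simp [hclq]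
  have hcl : ∀ y, ∃ C : Finset V, φ.Forced G K y → C ⊆ clq y ∧ C.card = r := fun y => by
    by_cases hy : φ.Forced G K y
    · obtain ⟨C, hC⟩ := Finset.exists_subset_card_eq (h.clique y hy)
      exact ⟨C, fun _ => hC⟩
    · exact ⟨∅, fun h => absurd h hy⟩
  choose C hC using hcl
  -- the roots, one vertex of each forced clique, and the names of the connectors that are units
  set R := Finset.univ.filter fun v => φ.IsRoot v with hR
  set Q := Finset.univ.filter fun y => φ.Forced G K y ∧ ∀ u < y, ¬ (u ∉ K ∧ G.Adj y u) with hQ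
  set I := Finset.univ.filter fun w => φ.own w ∧ ¬ φ.inX (φ.ptr w) with hI
  have hmR : ∀ v, v ∈ R ↔ φ.IsRoot v := fun v => by simp [hR]
  have hmQ : ∀ y, y ∈ Q ↔ φ.Forced G K y ∧ ∀ u < y, ¬ (u ∉ K ∧ G.Adj y u) := fun v => by
    simp [hQ]
  have hmI : ∀ w, w ∈ I ↔ φ.own w ∧ ¬ φ.inX (φ.ptr w) := fun w => by simp [hI]
  -- membership in the units
  have hunit : ∀ ρ, φ.IsRoot ρ → ∀ y ∈ φ.unit z F ρ, φ.inX y ∨ (y ∉ K ∧ φ.Touched G y) :=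
    fun ρ hρ y hy => by
    rcases mem_unit.1 hy with ⟨h₁, -⟩ | ⟨w, h₁, h₂, h₃, rfl⟩ | hy'
    · exact Or.inl h₁
    · exact Or.inr ⟨(hz w h₁).1, (hz w h₁).2.1⟩
    · obtain ⟨h₁, x, h₂, h₃, h₄⟩ := (hF ρ hρ).2 y hy'
      exact Or.inr ⟨h₁, x, h₂, h₄⟩
  have hCf : ∀ y, φ.Forced G K y → ∀ u ∈ C y, u ∉ K ∧ ¬ φ.Touched G u := fun y hy u hu => by
    obtain ⟨h₁, h₂⟩ := (hmemclq y u).1 ((hC y hy).1 hu)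
    exact ⟨h₁, fun h₃ => hy.2 ((hK.touched_iff hX h₁ hy.1
      (h₂.imp id SimpleGraph.Adj.symm)).1 h₃)⟩
  have hdRR : ∀ ρ ρ', φ.IsRoot ρ → φ.IsRoot ρ' → ρ ≠ ρ' →
      Disjoint (φ.unit z F ρ) (φ.unit z F ρ') := fun ρ ρ' hρ hρ' hne => by
    rw [Finset.disjoint_left]
    intro y hy hy'
    rcases mem_unit.1 hy with ⟨h₁, h₂⟩ | ⟨w, h₁, h₂, h₃, rfl⟩ | hy₁ <;>
    rcases mem_unit.1 hy' with ⟨k₁, k₂⟩ | ⟨w', k₁, k₂, k₃, k₄⟩ | hy₂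
    · exact hne (h₂.symm.trans k₂)
    · exact (hz w' k₁).1 (k₄ ▸ hX y h₁)
    · exact ((hF ρ' hρ').2 y hy₂).1 (hX y h₁)
    · exact (hz w h₁).1 (hX _ k₁)
    · obtain rfl := hzi _ _ k₁ h₁ k₄
      exact hne (h₃.symm.trans k₃)
    · exact hzF w ρ' h₁ hρ' hy₂
    · exact ((hF ρ hρ).2 y hy₁).1 (hX _ k₁)
    · exact hzF w' ρ k₁ hρ (k₄ ▸ hy₁)
    · exact Finset.disjoint_left.1 (hFd ρ ρ' hρ hρ' hne) hy₁ hy₂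
  have hdRI : ∀ ρ w, φ.IsRoot ρ → φ.own w → ¬ φ.inX (φ.ptr w) → z w ∉ φ.unit z F ρ :=
    fun ρ w hρ h₁ h₂ hy => by
    rcases mem_unit.1 hy with ⟨k₁, k₂⟩ | ⟨w', k₁, k₂, k₃, k₄⟩ | hy₂
    · exact (hz w h₁).1 (hX _ k₁)
    · obtain rfl := hzi _ _ k₁ h₁ k₄
      exact h₂ k₂
    · exact hzF w ρ h₁ hρ hy₂
  have hdRQ : ∀ ρ y, φ.IsRoot ρ → φ.Forced G K y → Disjoint (φ.unit z F ρ) (C y) :=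
    fun ρ y hρ hy => by
    rw [Finset.disjoint_left]
    intro u hu hu'
    obtain ⟨h₁, h₂⟩ := hCf y hy u hu'
    rcases hunit ρ hρ u hu with h₃ | h₃
    exacts [h₁ (hX u h₃), h₂ h₃.2]
  have hdQI : ∀ y w, φ.Forced G K y → φ.own w → z w ∉ C y := fun y w hy hw hmem =>
    (hCf y hy _ hmem).2 (hz w hw).2.1
  have hdQQ : ∀ y y', y ∈ Q → y' ∈ Q → y ≠ y' → Disjoint (C y) (C y') := fun y y' hy hy' hne => by
    rw [Finset.disjoint_left]
    intro u hu hu'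
    obtain ⟨hy, hmin⟩ := (hmQ y).1 hy
    obtain ⟨hy', hmin'⟩ := (hmQ y').1 hy'
    obtain ⟨h₁, h₂⟩ := (hmemclq y u).1 ((hC y hy).1 hu)
    obtain ⟨-, h₃⟩ := (hmemclq y' u).1 ((hC y' hy').1 hu')
    have hadj : G.Adj y y' := (hK.adj_trans hy.1 h₁ (h₂.imp Eq.symm id)
      (h₃.imp id SimpleGraph.Adj.symm)).resolve_left hne
    rcases lt_or_gt_of_ne hne with hlt | hlt
    · exact hmin' y hlt ⟨hy.1, hadj.symm⟩
    · exact hmin y' hlt ⟨hy'.1, hadj⟩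
  refine IsUnitFamily.hasGroupedDominatingSet
    (𝒟 := R.image (φ.unit z F) ∪ Q.image C ∪ I.image fun w => {z w}) ⟨?_, ?_, ?_, ?_⟩ ?_
  · intro D hD E hE hne
    simp only [Finset.mem_union, Finset.mem_image, hmR, hmI] at hD hE
    rcases hD with (⟨ρ, hρ, rfl⟩ | ⟨y, hy, rfl⟩) | ⟨w, ⟨hw, hw'⟩, rfl⟩ <;>
    rcases hE with (⟨ρ', hρ', rfl⟩ | ⟨y', hy', rfl⟩) | ⟨w', ⟨hv, hv'⟩, rfl⟩
    · exact hdRR ρ ρ' hρ hρ' fun e => hne (e ▸ rfl)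
    · exact hdRQ ρ y' hρ ((hmQ y').1 hy').1
    · exact Finset.disjoint_singleton_right.2 (hdRI ρ w' hρ hv hv')
    · exact (hdRQ ρ' y hρ' ((hmQ y).1 hy).1).symm
    · exact hdQQ y y' hy hy' fun e => hne (e ▸ rfl)
    · exact Finset.disjoint_singleton_right.2 (hdQI y w' ((hmQ y).1 hy).1 hv)
    · exact Finset.disjoint_singleton_left.2 (hdRI ρ' w hρ' hw hw')
    · exact Finset.disjoint_singleton_left.2 (hdQI y' w ((hmQ y').1 hy').1 hw)
    · rw [Finset.disjoint_singleton]
      exact fun e => hne (by rw [e])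
  · intro D hD
    simp only [Finset.mem_union, Finset.mem_image, hmR, hmI] at hD
    rcases hD with (⟨ρ, hρ, rfl⟩ | ⟨y, hy, rfl⟩) | ⟨w, ⟨hw, hw'⟩, rfl⟩
    · have h₁ : ((φ.ownOf ρ).image z).card = (φ.ownOf ρ).card :=
        Finset.card_image_of_injOn fun w hw w' hw' e =>
          hzi w w' (mem_ownOf.1 hw).1 (mem_ownOf.1 hw').1 e
      have h₂ : Disjoint (φ.part ρ) ((φ.ownOf ρ).image z) := by
        rw [Finset.disjoint_left]
        intro y hy hy'
        obtain ⟨w, hw, rfl⟩ := Finset.mem_image.1 hy'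
        exact (hz w (mem_ownOf.1 hw).1).1 (hX _ (mem_part.1 hy).1)
      have h₃ : Disjoint (φ.part ρ ∪ (φ.ownOf ρ).image z) (F ρ) := by
        rw [Finset.disjoint_left]
        intro y hy hy'
        rcases Finset.mem_union.1 hy with hy | hy
        · exact ((hF ρ hρ).2 y hy').1 (hX _ (mem_part.1 hy).1)
        · obtain ⟨w, hw, rfl⟩ := Finset.mem_image.1 hy
          exact hzF w ρ (mem_ownOf.1 hw).1 hρ hy'
      have h₄ := h.part_le ρ hρ
      have e : φ.unit z F ρ = φ.part ρ ∪ (φ.ownOf ρ).image z ∪ F ρ := by unfold unit; congr!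
      rw [e, Finset.card_union_of_disjoint h₃, Finset.card_union_of_disjoint h₂, h₁,
        (hF ρ hρ).1, demand]
      omega
    · exact (hC y ((hmQ y).1 hy).1).2
    · rcases h.own_ptr w hw with h₁ | h₁
      · exact absurd h₁ hw'
      · rw [Finset.card_singleton, h₁.1]
  · intro D hD
    simp only [Finset.mem_union, Finset.mem_image, hmR, hmI] at hD
    rcases hD with (⟨ρ, hρ, rfl⟩ | ⟨y, hy, rfl⟩) | ⟨w, ⟨hw, hw'⟩, rfl⟩
    · exact h.connected_unit hz (fun ρ hρ => (hF ρ hρ).2) hρ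
    · have hy' := ((hmQ y).1 hy).1
      obtain ⟨u, hu⟩ := Finset.card_pos.1 ((hC y hy').2.symm ▸ hr : 0 < (C y).card)
      refine connected_induce_of_reachable (Finset.mem_coe.2 hu) fun v hv => ?_
      obtain ⟨h₁, h₂⟩ := (hmemclq y u).1 ((hC y hy').1 hu)
      obtain ⟨h₃, h₄⟩ := (hmemclq y v).1 ((hC y hy').1 (Finset.mem_coe.1 hv))
      rcases hK.adj_trans h₃ hy'.1 (h₄.imp id SimpleGraph.Adj.symm) (h₂.imp Eq.symm id) with h₅ | h₅
      · subst h₅; exact SimpleGraph.Reachable.refl _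
      · exact reachable_induce_of_adj hv _ h₅
    · refine connected_induce_of_reachable (v := z w) (by simp) fun v hv => ?_
      obtain rfl : v = z w := by simpa using hv
      exact SimpleGraph.Reachable.refl _
  · -- every forced vertex is dominated from within its own clique
    have hdomF : ∀ y, φ.Forced G K y → ∃ D ∈ Q.image C, ∃ u ∈ D, y = u ∨ G.Adj u y :=
      fun y hy => by
      have hne : (clq y).Nonempty := ⟨y, (hmemclq y y).2 ⟨hy.1, Or.inl rfl⟩⟩
      obtain ⟨h₁, h₂⟩ := (hmemclq y _).1 ((clq y).min'_mem hne)
      set m := (clq y).min' hne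
      have hm : φ.Forced G K m := ⟨h₁, fun h₃ => hy.2 ((hK.touched_iff hX h₁ hy.1
        (h₂.imp id SimpleGraph.Adj.symm)).1 h₃)⟩
      have hmQ' : m ∈ Q := (hmQ m).2 ⟨hm, fun u hu ⟨h₃, h₄⟩ => by
        have h₅ : u ∈ clq y := (hmemclq y u).2 ⟨h₃, ((hK.adj_trans hy.1 h₁ (h₂.imp Eq.symm id)
          (Or.inr h₄)).imp Eq.symm id)⟩
        exact absurd ((clq y).min'_le u h₅) (not_le.2 hu)⟩
      obtain ⟨u, hu⟩ := Finset.card_pos.1 ((hC m hm).2.symm ▸ hr : 0 < (C m).card)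
      obtain ⟨h₃, h₄⟩ := (hmemclq m u).1 ((hC m hm).1 hu)
      exact ⟨C m, Finset.mem_image_of_mem _ hmQ', u, hu,
        (hK.adj_trans h₃ h₁ (h₄.imp id SimpleGraph.Adj.symm)
          (h₂.imp id SimpleGraph.Adj.symm)).imp Eq.symm id⟩
    have hX' : ∀ x, φ.inX x → ∃ D ∈ R.image (φ.unit z F), x ∈ D := fun x hx =>
      ⟨_, Finset.mem_image_of_mem _ ((hmR _).2 (h.tree x hx).2.1),
        mem_unit.2 (Or.inl ⟨hx, rfl⟩)⟩
    have hz' : ∀ w, φ.own w → ∃ D ∈ R.image (φ.unit z F) ∪ I.image (fun w => {z w}), z w ∈ D :=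
      fun w hw => by
      by_cases hp : φ.inX (φ.ptr w)
      · exact ⟨_, Finset.mem_union_left _
          (Finset.mem_image_of_mem _ ((hmR _).2 (h.tree _ hp).2.1)),
          mem_unit.2 (Or.inr (Or.inl ⟨w, hw, hp, rfl, rfl⟩))⟩
      · exact ⟨_, Finset.mem_union_right _ (Finset.mem_image_of_mem _ ((hmI w).2 ⟨hw, hp⟩)),
          Finset.mem_singleton_self _⟩
    have hdomT : ∀ v, φ.Touched G v → ∃ D ∈ R.image (φ.unit z F), ∃ u ∈ D, v = u ∨ G.Adj u v :=
      fun v ⟨x, hx, hvx⟩ => by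
      obtain ⟨D, hD, hxD⟩ := hX' x hx
      exact ⟨D, hD, x, hxD, Or.inr hvx.symm⟩
    have hdomz : ∀ w v, φ.own w → G.Adj (z w) v →
        ∃ D ∈ R.image (φ.unit z F) ∪ Q.image C ∪ I.image (fun w => {z w}),
        ∃ u ∈ D, v = u ∨ G.Adj u v := fun w v hw hv => by
      obtain ⟨D, hD, hzD⟩ := hz' w hw
      refine ⟨D, ?_, z w, hzD, Or.inr hv⟩
      simp only [Finset.mem_union] at hD ⊢
      tauto
    have sub₁ : R.image (φ.unit z F) ⊆
        R.image (φ.unit z F) ∪ Q.image C ∪ I.image (fun w => {z w}) :=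
      fun D hD => Finset.mem_union_left _ (Finset.mem_union_left _ hD)
    have sub₂ : Q.image C ⊆ R.image (φ.unit z F) ∪ Q.image C ∪ I.image (fun w => {z w}) :=
      fun D hD => Finset.mem_union_left _ (Finset.mem_union_right _ hD)
    intro v
    by_cases ht : φ.Touched G v
    · obtain ⟨D, hD, hu⟩ := hdomT v ht
      exact ⟨D, sub₁ hD, hu⟩
    by_cases hv : v ∈ K
    · rcases h.cover v hv with h₁ | h₁ | h₁ | h₁ | ⟨y, hy, hvy⟩
      · obtain ⟨D, hD, hxD⟩ := hX' v h₁
        exact ⟨D, sub₁ hD, v, hxD, Or.inl rfl⟩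
      · exact hdomz v v h₁ (hz v h₁).2.2.1
      · exact hdomz _ v (h.shr_ptr v h₁) ((hz _ (h.shr_ptr v h₁)).2.2.2.2 v h₁ rfl)
      · exact absurd h₁ ht
      · obtain ⟨D, hD, u, hu, huy⟩ := hdomF y hy
        refine ⟨D, sub₂ hD, u, hu, Or.inr ?_⟩
        obtain ⟨y', hy', rfl⟩ := Finset.mem_image.1 hD
        exact (hK.adj_iff_of_mem (hCf y' ((hmQ y').1 hy').1 u hu).1 hy.1
          (huy.imp Eq.symm id) hv).2 hvy.symm
    · obtain ⟨D, hD, hu⟩ := hdomF v ⟨hv, ht⟩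
      exact ⟨D, sub₂ hD, hu⟩
  · refine le_trans ?_ h.count
    exact (Finset.card_union_le _ _).trans (Nat.add_le_add ((Finset.card_union_le _ _).trans
      (Nat.add_le_add Finset.card_image_le Finset.card_image_le)) Finset.card_image_le)

end Guess.Valid

/-! ### A solution yields a valid guess -/

section Completeness

variable {V : Type*} {G : SimpleGraph V} {K : Finset V}

theorem reachable_induction {S : Set V} {P : V → Prop} {a b : V} (ha : a ∈ S) (hb : b ∈ S)
    (h : (G.induce S).Reachable ⟨a, ha⟩ ⟨b, hb⟩) (h₀ : P a)
    (hs : ∀ u ∈ S, ∀ v ∈ S, G.Adj u v → P u → P v) : P b := by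
  obtain ⟨p⟩ := h
  suffices key : ∀ x y : S, (G.induce S).Walk x y → P x.1 → P y.1 from key _ _ p h₀
  intro x y p
  induction p with
  | nil => exact id
  | cons hadj _ ih =>
    exact fun hx => ih (hs _ (Subtype.coe_prop _) _ (Subtype.coe_prop _) (by simpa using hadj) hx)

/-- A connected set that avoids a twin cover is a clique. -/
theorem IsTwinCover.clique_of_connected (hK : IsTwinCover G K) {D : Finset V}
    (hD : (G.induce (D : Set V)).Connected) (hDK : Disjoint D K) {a b : V} (ha : a ∈ D)
    (hb : b ∈ D) : a = b ∨ G.Adj a b := by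
  have hn : ∀ v ∈ D, v ∉ K := fun v hv => Finset.disjoint_left.1 hDK hv
  refine reachable_induction (P := fun v => a = v ∨ G.Adj a v) (Finset.mem_coe.2 ha)
    (Finset.mem_coe.2 hb) (hD.preconnected _ _) (Or.inl rfl) fun u hu v hv huv h => ?_
  exact hK.adj_trans (hn a ha) (hn u hu) h (Or.inr huv)

/-- In a solution that meets the cover as much as possible, a unit that avoids the cover is not
adjacent to an unused vertex `u` of the cover: otherwise `u` could replace a vertex of the unit, as
the other vertices of the unit are twins of that vertex. This needs units of size at least two. -/
theorem IsUnitFamily.exists_maximal [Fintype V] (hK : IsTwinCover G K) {r : ℕ}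
    {𝒟 : Finset (Finset V)} (h : IsUnitFamily G r 𝒟) :
    ∃ ℰ : Finset (Finset V), IsUnitFamily G r ℰ ∧ ℰ.card ≤ 𝒟.card ∧
      ∀ D ∈ ℰ, Disjoint D K → 2 ≤ r → ∀ z ∈ D, ∀ u ∈ K, G.Adj z u → ∃ E ∈ ℰ, u ∈ E := by
  classical
  obtain ⟨ℰ, hℰ, hmax⟩ := (Finset.univ.filter fun ℰ : Finset (Finset V) =>
    IsUnitFamily G r ℰ ∧ ℰ.card ≤ 𝒟.card).exists_max_image
    (fun ℰ => (K.filter fun v => ∃ E ∈ ℰ, v ∈ E).card) ⟨𝒟, by simp [h]⟩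
  simp only [Finset.mem_filter, Finset.mem_univ, true_and] at hℰ hmax
  refine ⟨ℰ, hℰ.1, hℰ.2, fun D hD hDK hr z hz u hu hzu => ?_⟩
  by_contra! hcon
  have hn : ∀ v ∈ D, v ∉ K := fun v hv => Finset.disjoint_left.1 hDK hv
  have huD : u ∉ D := fun h => hn u h hu
  obtain ⟨z', hz', hne⟩ := Finset.exists_mem_ne (by rw [hℰ.1.card_eq D hD]; omega : 1 < D.card) z
  have hcl : ∀ a ∈ D, ∀ b ∈ D, a = b ∨ G.Adj a b := fun a ha b hb =>
    hK.clique_of_connected (hℰ.1.connected D hD) hDK ha hb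
  have hz'u : G.Adj z' u := (hK.adj_iff_of_mem (hn z hz) (hn z' hz') (hcl z hz z' hz') hu).1 hzu
  set D' := insert u (D.erase z) with hD'
  have hz'D' : z' ∈ D' := Finset.mem_insert_of_mem (Finset.mem_erase.2 ⟨hne, hz'⟩)
  have hdis : ∀ E ∈ ℰ, E ≠ D → Disjoint D' E := fun E hE hED => by
    rw [hD', Finset.disjoint_insert_left]
    exact ⟨hcon E hE, (hℰ.1.disjoint D hD E hE (Ne.symm hED)).mono_left (Finset.erase_subset _ _)⟩
  have hfam : IsUnitFamily G r (insert D' (ℰ.erase D)) := by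
    refine ⟨fun A hA B hB hAB => ?_, fun A hA => ?_, fun A hA => ?_, fun v => ?_⟩
    · rcases Finset.mem_insert.1 hA with rfl | hA <;> rcases Finset.mem_insert.1 hB with rfl | hB
      · exact absurd rfl hAB
      · exact hdis B (Finset.mem_of_mem_erase hB) (Finset.ne_of_mem_erase hB)
      · exact (hdis A (Finset.mem_of_mem_erase hA) (Finset.ne_of_mem_erase hA)).symm
      · exact hℰ.1.disjoint A (Finset.mem_of_mem_erase hA) B (Finset.mem_of_mem_erase hB) hAB
    · rcases Finset.mem_insert.1 hA with rfl | hA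
      · rw [hD', Finset.card_insert_of_notMem (fun h => huD (Finset.mem_of_mem_erase h)),
          Finset.card_erase_of_mem hz, hℰ.1.card_eq D hD]
        omega
      · exact hℰ.1.card_eq A (Finset.mem_of_mem_erase hA)
    · rcases Finset.mem_insert.1 hA with rfl | hA
      · refine connected_induce_of_reachable (Finset.mem_coe.2 hz'D') fun w hw => ?_
        rcases Finset.mem_insert.1 (Finset.mem_coe.1 hw) with rfl | hw'
        · exact reachable_induce_of_adj _ _ hz'u.symm
        · rcases hcl w (Finset.mem_of_mem_erase hw') z' hz' with e | e
          · subst e; exact SimpleGraph.Reachable.refl _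
          · exact reachable_induce_of_adj _ _ e
      · exact hℰ.1.connected A (Finset.mem_of_mem_erase hA)
    · obtain ⟨E, hE, w, hw, hv⟩ := hℰ.1.dominating v
      by_cases hED : E = D
      · subst hED
        refine ⟨D', Finset.mem_insert_self _ _, ?_⟩
        by_cases hwz : w = z
        · subst hwz
          exact ⟨z', hz'D', (hK.adj_iff (hn w hw) (hn z' hz') (hcl w hw z' hz') v).1 hv⟩
        · exact ⟨w, Finset.mem_insert_of_mem (Finset.mem_erase.2 ⟨hwz, hw⟩), hv⟩
      · exact ⟨E, Finset.mem_insert_of_mem (Finset.mem_erase.2 ⟨hED, hE⟩), w, hw, hv⟩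
  have hle := hmax _ ⟨hfam, by
    refine (Finset.card_insert_le _ _).trans ?_
    rw [Finset.card_erase_add_one hD]
    exact hℰ.2⟩
  refine absurd hle (not_le.2 (Finset.card_lt_card ?_))
  rw [Finset.ssubset_iff_of_subset]
  · refine ⟨u, Finset.mem_filter.2 ⟨hu, D', Finset.mem_insert_self _ _,
      Finset.mem_insert_self _ _⟩, fun h => ?_⟩
    obtain ⟨-, E, hE, huE⟩ := Finset.mem_filter.1 h
    exact hcon E hE huE
  · intro v hv
    obtain ⟨hvK, E, hE, hvE⟩ := Finset.mem_filter.1 hv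
    have : E ≠ D := fun e => hn v (e ▸ hvE) hvK
    exact Finset.mem_filter.2
      ⟨hvK, E, Finset.mem_insert_of_mem (Finset.mem_erase.2 ⟨this, hE⟩), hvE⟩

/-- Distance to `ρ` inside a connected set. -/
theorem exists_rank [Fintype V] {D : Finset V} (hD : (G.induce (D : Set V)).Connected) {ρ : V}
    (hρ : ρ ∈ D) : ∃ d : V → ℕ, (∀ v, d v < Fintype.card V) ∧
      ∀ v ∈ D, v ≠ ρ → ∃ w ∈ D, G.Adj v w ∧ d w < d v := by
  classical
  have hcard : 0 < Fintype.card V := Fintype.card_pos_iff.2 ⟨ρ⟩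
  obtain ⟨ρ', hρ'⟩ : ∃ x : (D : Set V), x.1 = ρ := ⟨⟨ρ, hρ⟩, rfl⟩
  refine ⟨fun v => if hv : v ∈ (D : Set V) then (G.induce (D : Set V)).dist ⟨v, hv⟩ ρ' else 0,
    fun v => ?_, fun v hv hne => ?_⟩
  · by_cases hv : v ∈ (D : Set V)
    · simp only [hv, dite_true]
      obtain ⟨p, hp, hl⟩ := hD.exists_path_of_dist ⟨v, hv⟩ ρ'
      rw [← hl]
      exact hp.length_lt.trans_le (Fintype.card_le_of_injective _ Subtype.val_injective)
    · simpa only [hv, dite_false] using hcard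
  · have hv' : v ∈ (D : Set V) := hv
    obtain ⟨p, hl⟩ := hD.exists_walk_length_eq_dist ⟨v, hv'⟩ ρ'
    cases p with
    | nil => exact absurd hρ' hne
    | @cons _ w _ hadj q =>
      refine ⟨w.1, w.2, by simpa using hadj, ?_⟩
      have hw : w.1 ∈ (D : Set V) := w.2
      simp only [hv', hw, dite_true]
      rw [← hl, SimpleGraph.Walk.length_cons]
      exact Nat.lt_succ_of_le (SimpleGraph.dist_le q)

/-- How a connected set `D` that meets the cover is held together by its part in the cover: ranks
`d` decrease along edges, or along paths of length two through a vertex outside the cover, until the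
root `ρ` is reached. -/
theorem IsTwinCover.exists_ranked_tree [Fintype V] (hK : IsTwinCover G K) {D : Finset V}
    (hD : (G.induce (D : Set V)).Connected) (hDK : ¬ Disjoint D K) :
    ∃ (ρ : V) (d : V → ℕ), ρ ∈ D ∧ ρ ∈ K ∧ (∀ v, d v < Fintype.card V) ∧
      (∀ v ∈ D, v ≠ ρ → (∃ x ∈ D, x ∈ K ∧ G.Adj v x ∧ d x < d v) ∨
        ∃ y ∈ D, y ∉ K ∧ G.Adj v y ∧ ∃ x ∈ D, x ∈ K ∧ G.Adj y x ∧ d x < d v) ∧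
      ∀ y ∈ D, y ∉ K → ∃ x ∈ D, x ∈ K ∧ G.Adj y x := by
  classical
  obtain ⟨ρ, hρ, hρK⟩ := Finset.not_disjoint_iff.1 hDK
  obtain ⟨d, hd, hs⟩ := exists_rank hD hρ
  refine ⟨ρ, d, hρ, hρK, hd, fun v hv hne => ?_, fun y hy hyK => ?_⟩
  · obtain ⟨w, hw, hmin⟩ := (D.filter fun w => G.Adj v w ∧ d w < d v).exists_min_image d (by
      obtain ⟨w, hw, h⟩ := hs v hv hne
      exact ⟨w, Finset.mem_filter.2 ⟨hw, h⟩⟩)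
    obtain ⟨hwD, hvw, hdw⟩ := Finset.mem_filter.1 hw
    by_cases hwK : w ∈ K
    · exact Or.inl ⟨w, hwD, hwK, hvw, hdw⟩
    · obtain ⟨x, hx, hwx, hdx⟩ := hs w hwD fun e => hwK (e ▸ hρK)
      by_cases hxK : x ∈ K
      · exact Or.inr ⟨w, hwD, hwK, hvw, x, hx, hxK, hwx, hdx.trans hdw⟩
      · -- `w` and `x` are twins, so `x` is a neighbour of `v` of smaller rank
        have : G.Adj v x ∨ v = x := by
          have h := (hK.adj_iff hwK hxK (Or.inr hwx) v).1 (Or.inr hvw.symm)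
          exact h.symm.imp SimpleGraph.Adj.symm id
        rcases this with h | rfl
        · exact absurd (hmin x (Finset.mem_filter.2 ⟨hx, h, hdx.trans hdw⟩)) (not_le.2 hdx)
        · exact absurd hdw hdx.asymm
  · -- the vertex of least rank in the clique of `y` has a neighbour in the cover
    obtain ⟨w, hw, hmin⟩ := (D.filter fun w => w ∉ K ∧ (y = w ∨ G.Adj y w)).exists_min_image d
      ⟨y, Finset.mem_filter.2 ⟨hy, hyK, Or.inl rfl⟩⟩
    obtain ⟨hwD, hwK, hyw⟩ := Finset.mem_filter.1 hw
    obtain ⟨x, hx, hwx, hdx⟩ := hs w hwD fun e => hwK (e ▸ hρK)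
    by_cases hxK : x ∈ K
    · exact ⟨x, hx, hxK, (hK.adj_iff_of_mem hyK hwK hyw hxK).2 hwx⟩
    · exact absurd (hmin x (Finset.mem_filter.2 ⟨hx, hxK, hK.adj_trans hyK hwK hyw (Or.inr hwx)⟩))
        (not_le.2 hdx)

/-- The guess is read off a solution that meets the cover as much as possible. A vertex of the cover
picks a connector if it lies in the solution, is not a root and has no neighbour of smaller rank in
the cover and its unit, or if it lies outside the solution and is dominated neither from within the
cover nor from a forced clique. One of the vertices with the same connector gives it its name, and
the pointer of the name leads to the neighbour of least rank of the connector, so that ranks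
decrease towards the root. The pointers outside the cover do not matter; they are fixed as `d₀`
because the table of a guess is only kept on the cover. -/
theorem HasGroupedDominatingSet.exists_valid [Fintype V] [LinearOrder V] (hK : IsTwinCover G K)
    {r k : ℕ} (hr : 0 < r) (h : HasGroupedDominatingSet G r k) (d₀ : V) :
    ∃ φ : Guess V, φ.Valid G K r k ∧ (∀ v ∈ K, φ.ptr v ∈ K) ∧ ∀ v ∉ K, φ.ptr v = d₀ := by
  obtain ⟨𝒟₀, h₀, hk₀⟩ := h.exists_unitFamily
  obtain ⟨𝒟, h𝒟, hk, hmax⟩ := h₀.exists_maximal hK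
  replace hk := hk.trans hk₀
  -- the unit of a vertex
  have hU : ∀ v, ∃ D, (∃ E ∈ 𝒟, v ∈ E) → D ∈ 𝒟 ∧ v ∈ D := fun v => by
    by_cases hv : ∃ E ∈ 𝒟, v ∈ E
    · obtain ⟨E, hE⟩ := hv
      exact ⟨E, fun _ => hE⟩
    · exact ⟨∅, fun h => absurd h hv⟩
  choose U hU using hU
  have hUe : ∀ D ∈ 𝒟, ∀ v ∈ D, U v = D := fun D hD v hv => by
    by_contra hne
    obtain ⟨h₁, h₂⟩ := hU v ⟨D, hD, hv⟩
    exact Finset.disjoint_left.1 (h𝒟.disjoint _ h₁ _ hD hne) h₂ hv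
  -- roots and ranks of the units that meet the cover
  have hT : ∀ D, ∃ (ρ : V) (d : V → ℕ), D ∈ 𝒟 → ¬ Disjoint D K →
      ρ ∈ D ∧ ρ ∈ K ∧ (∀ v, d v < Fintype.card V) ∧
      (∀ v ∈ D, v ≠ ρ → (∃ x ∈ D, x ∈ K ∧ G.Adj v x ∧ d x < d v) ∨
        ∃ y ∈ D, y ∉ K ∧ G.Adj v y ∧ ∃ x ∈ D, x ∈ K ∧ G.Adj y x ∧ d x < d v) ∧
      ∀ y ∈ D, y ∉ K → ∃ x ∈ D, x ∈ K ∧ G.Adj y x := fun D => by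
    by_cases hD : D ∈ 𝒟 ∧ ¬ Disjoint D K
    · obtain ⟨ρ, d, h⟩ := hK.exists_ranked_tree (h𝒟.connected D hD.1) hD.2
      exact ⟨ρ, d, fun _ _ => h⟩
    · exact ⟨d₀, fun _ => 0, fun h₁ h₂ => absurd ⟨h₁, h₂⟩ hD⟩
  choose rt dd hT using hT
  -- the neighbour of least rank, for a vertex outside the cover
  have ht : ∀ y, ∃ x, (∃ E ∈ 𝒟, y ∈ E) → y ∉ K → ¬ Disjoint (U y) K → x ∈ U y ∧ x ∈ K ∧ G.Adj y x ∧
      ∀ x' ∈ U y, x' ∈ K → G.Adj y x' → dd (U y) x ≤ dd (U y) x' := fun y => by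
    classical
    by_cases hy : (∃ E ∈ 𝒟, y ∈ E) ∧ y ∉ K ∧ ¬ Disjoint (U y) K
    · obtain ⟨x, hx, hmin⟩ := ((U y).filter fun x => x ∈ K ∧ G.Adj y x).exists_min_image
        (dd (U y)) (by
          obtain ⟨x, h₁, h₂⟩ := (hT (U y) (hU y hy.1).1 hy.2.2).2.2.2.2 y (hU y hy.1).2 hy.2.1
          exact ⟨x, Finset.mem_filter.2 ⟨h₁, h₂⟩⟩)
      obtain ⟨h₁, h₂, h₃⟩ := Finset.mem_filter.1 hx
      exact ⟨x, fun _ _ _ => ⟨h₁, h₂, h₃, fun x' h₄ h₅ h₆ =>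
        hmin x' (Finset.mem_filter.2 ⟨h₄, h₅, h₆⟩)⟩⟩
    · exact ⟨d₀, fun h₁ h₂ h₃ => absurd ⟨h₁, h₂, h₃⟩ hy⟩
  choose t ht using ht
  -- the part of the solution in the cover, and the vertices adjacent to it
  obtain ⟨X, hXd⟩ : ∃ X : V → Prop, ∀ v, X v ↔ v ∈ K ∧ ∃ E ∈ 𝒟, v ∈ E := ⟨_, fun _ => Iff.rfl⟩
  obtain ⟨T, hTd⟩ : ∃ T : V → Prop, ∀ y, T y ↔ ∃ x, X x ∧ G.Adj y x := ⟨_, fun _ => Iff.rfl⟩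
  have hXU : ∀ v, X v → U v ∈ 𝒟 ∧ v ∈ U v ∧ ¬ Disjoint (U v) K := fun v hv => by
    obtain ⟨h₁, h₂⟩ := (hXd v).1 hv
    obtain ⟨h₃, h₄⟩ := hU v h₂
    exact ⟨h₃, h₄, Finset.not_disjoint_iff.2 ⟨v, h₄, h₁⟩⟩
  have hXm : ∀ D ∈ 𝒟, ∀ v ∈ D, v ∈ K → X v := fun D hD v hv hvK => (hXd v).2 ⟨hvK, D, hD, hv⟩
  -- `Easy v`: no connector is needed at `v`; `Good v y`: `y` can serve as a connector at `v`
  obtain ⟨Easy, hEasy⟩ : ∃ E : V → Prop, ∀ v, E v ↔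
      ((X v ∧ (v = rt (U v) ∨ ∃ x ∈ U v, x ∈ K ∧ G.Adj v x ∧ dd (U v) x < dd (U v) v)) ∨
      (¬ X v ∧ (T v ∨ ∃ y, (y ∉ K ∧ ¬ T y) ∧ G.Adj v y))) := ⟨_, fun _ => Iff.rfl⟩
  obtain ⟨Good, hGood⟩ : ∃ P : V → V → Prop, ∀ v y, P v y ↔
      (y ∉ K ∧ G.Adj v y ∧ (∃ E ∈ 𝒟, y ∈ E) ∧ T y ∧ (X v → y ∈ U v ∧
        ∃ x ∈ U v, x ∈ K ∧ G.Adj y x ∧ dd (U v) x < dd (U v) v)) := ⟨_, fun _ _ => Iff.rfl⟩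
  have hclaim : ∀ v ∈ K, ¬ Easy v → ∃ y, Good v y := fun v hv he => by
    rw [hEasy] at he
    push Not at he
    by_cases hXv : X v
    · obtain ⟨h₁, h₂, h₃⟩ := hXU v hXv
      obtain ⟨h₄, h₅⟩ := he.1 hXv
      rcases (hT _ h₁ h₃).2.2.2.1 v h₂ h₄ with ⟨x, hx, hxK, hvx, hd⟩ |
        ⟨y, hy, hyK, hvy, x, hx, hxK, hyx, hd⟩
      · exact absurd hd (not_lt.2 (h₅ x hx hxK hvx))
      · exact ⟨y, (hGood v y).2 ⟨hyK, hvy, ⟨_, h₁, hy⟩, (hTd y).2 ⟨x, hXm _ h₁ x hx hxK, hyx⟩,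
          fun _ => ⟨hy, x, hx, hxK, hyx, hd⟩⟩⟩
    · obtain ⟨h₁, h₂⟩ := he.2 hXv
      obtain ⟨D, hD, u, hu, huv⟩ := h𝒟.dominating v
      have huv : G.Adj u v := huv.resolve_left fun e => hXv (hXm D hD v (e ▸ hu) hv)
      have huK : u ∉ K := fun huK => h₁ ((hTd v).2 ⟨u, hXm D hD u hu huK, huv.symm⟩)
      have hTu : T u := by
        by_contra hTu
        exact h₂ u ⟨huK, hTu⟩ huv.symm
      exact ⟨u, (hGood v u).2 ⟨huK, huv.symm, ⟨D, hD, hu⟩, hTu, fun h => absurd h hXv⟩⟩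
  -- the vertices that need a connector, their connectors `c`, and the names `rep` of the latter
  obtain ⟨N, hN⟩ : ∃ N : V → Prop, ∀ v, N v ↔ v ∈ K ∧ ¬ Easy v := ⟨_, fun _ => Iff.rfl⟩
  have hc : ∀ v, ∃ y, N v → Good v y := fun v => by
    by_cases hv : N v
    · obtain ⟨y, hy⟩ := hclaim v ((hN v).1 hv).1 ((hN v).1 hv).2
      exact ⟨y, fun _ => hy⟩
    · exact ⟨v, fun h => absurd h hv⟩
  choose c hc using hc
  simp only [hGood] at hc
  -- the next vertex on the way to the root, where no connector is needed
  have hdir : ∀ v, ∃ x, X v → ¬ N v → v ≠ rt (U v) → x ∈ U v ∧ x ∈ K ∧ G.Adj v x ∧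
      dd (U v) x < dd (U v) v := fun v => by
    by_cases hv : X v ∧ ¬ N v ∧ v ≠ rt (U v)
    · have h₁ := hv.2.1
      rw [hN, not_and, not_not, hEasy] at h₁
      obtain ⟨x, hx⟩ := (((h₁ ((hXd v).1 hv.1).1).resolve_right fun h => h.1 hv.1).2).resolve_left
        hv.2.2
      exact ⟨x, fun _ _ _ => hx⟩
    · exact ⟨v, fun h₁ h₂ h₃ => absurd ⟨h₁, h₂, h₃⟩ hv⟩
  choose dir hdir using hdir
  have hrep : ∀ y, ∃ w, (∃ v, N v ∧ c v = y) → N w ∧ c w = y := fun y => by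
    by_cases hy : ∃ v, N v ∧ c v = y
    · obtain ⟨v, hv⟩ := hy
      exact ⟨v, fun _ => hv⟩
    · exact ⟨y, fun h => absurd h hy⟩
  choose rep hrep using hrep
  have hrepN : ∀ v, N v → N (rep (c v)) ∧ c (rep (c v)) = c v := fun v hv => hrep _ ⟨v, hv, rfl⟩
  classical
  obtain ⟨φ, hφX, hφo, hφs, hφp⟩ : ∃ φ : Guess V, (∀ v, φ.inX v = true ↔ X v) ∧
      (∀ v, φ.own v = true ↔ N v ∧ rep (c v) = v) ∧ (∀ v, φ.shr v = true ↔ N v ∧ rep (c v) ≠ v) ∧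
      ∀ v, φ.ptr v = if v ∈ K then (if N v then (if rep (c v) = v then
        (if ¬ Disjoint (U (c v)) K then t (c v) else v) else rep (c v)) else
        if X v ∧ v ≠ rt (U v) then dir v else v) else d₀ :=
    ⟨⟨fun v => decide (X v), fun v => decide (N v ∧ rep (c v) = v),
      fun v => decide (N v ∧ rep (c v) ≠ v), _⟩, by simp, by simp, by simp, fun _ => rfl⟩
  have hNK : ∀ v, N v → v ∈ K := fun v hv => ((hN v).1 hv).1
  -- the connector of a vertex in the solution lies in the same unit
  have hcU : ∀ v, N v → X v → U (c v) = U v := fun v h₁ h₂ =>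
    hUe _ (hXU v h₂).1 _ ((hc v h₁).2.2.2.2 h₂).1
  have htc : ∀ v, N v → ¬ Disjoint (U (c v)) K → X (t (c v)) ∧ U (t (c v)) = U (c v) ∧
      G.Adj (c v) (t (c v)) ∧ ∀ x' ∈ U (c v), x' ∈ K → G.Adj (c v) x' →
        dd (U (c v)) (t (c v)) ≤ dd (U (c v)) x' := fun v h₁ h₂ => by
    obtain ⟨h₃, -, h₄, -, -⟩ := hc v h₁
    obtain ⟨k₁, k₂, k₃, k₄⟩ := ht (c v) h₄ h₃ h₂
    have k₅ := (hU _ h₄).1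
    exact ⟨hXm _ k₅ _ k₁ k₂, hUe _ k₅ _ k₁, k₃, k₄⟩
  have hpown : ∀ v, N v → rep (c v) = v → ¬ Disjoint (U (c v)) K → φ.ptr v = t (c v) :=
    fun v h₁ h₂ h₃ => by rw [hφp, if_pos (hNK v h₁), if_pos h₁, if_pos h₂, if_pos h₃]
  have hpins : ∀ v, N v → rep (c v) = v → Disjoint (U (c v)) K → φ.ptr v = v ∧ ¬ X v :=
    fun v h₁ h₂ h₃ => by
    rw [hφp, if_pos (hNK v h₁), if_pos h₁, if_pos h₂, if_neg (not_not.2 h₃)]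
    exact ⟨rfl, fun hX => (hXU v hX).2.2 (hcU v h₁ hX ▸ h₃)⟩
  have hpshr : ∀ v, N v → rep (c v) ≠ v → φ.ptr v = rep (c v) := fun v h₁ h₂ => by
    rw [hφp, if_pos (hNK v h₁), if_pos h₁, if_neg h₂]
  have hownrep : ∀ v, N v → φ.own (rep (c v)) = true := fun v h₁ => by
    obtain ⟨h₂, h₃⟩ := hrepN v h₁
    exact (hφo _).2 ⟨h₂, by rw [h₃]⟩
  have hrtE : ∀ v, X v → v = rt (U v) → ¬ N v := fun v h₁ h₂ h₃ =>
    ((hN v).1 h₃).2 ((hEasy v).2 (Or.inl ⟨h₁, Or.inl h₂⟩))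
  have hpN : ∀ v, v ∈ K → ¬ N v → φ.ptr v = if X v ∧ v ≠ rt (U v) then dir v else v :=
    fun v h₁ h₂ => by rw [hφp, if_pos h₁, if_neg h₂]
  have hroot_iff : ∀ v, φ.IsRoot v ↔ X v ∧ v = rt (U v) := fun v => by
    constructor
    · rintro ⟨h₁, h₂, h₃, h₄⟩
      rw [hφX] at h₁
      rw [hφo] at h₃
      rw [hφs] at h₄
      refine ⟨h₁, by_contra fun hne => ?_⟩
      have hNv : ¬ N v := fun hNv => by
        by_cases he : rep (c v) = v
        exacts [h₃ ⟨hNv, he⟩, h₄ ⟨hNv, he⟩]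
      rw [hpN v ((hXd v).1 h₁).1 hNv, if_pos ⟨h₁, hne⟩] at h₂
      have h₅ := (hdir v h₁ hNv hne).2.2.1
      rw [h₂] at h₅
      exact G.loopless.irrefl v h₅
    · rintro ⟨h₁, h₂⟩
      have hNv := hrtE v h₁ h₂
      refine ⟨(hφX v).2 h₁, ?_, fun h => hNv ((hφo v).1 h).1, fun h => hNv ((hφs v).1 h).1⟩
      rw [hpN v ((hXd v).1 h₁).1 hNv, if_neg fun h => h.2 h₂]
  have hpar : ∀ v, X v → v ≠ rt (U v) → X (φ.par v) ∧ U (φ.par v) = U v ∧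
      dd (U v) (φ.par v) < dd (U v) v := fun v hv hne => by
    obtain ⟨h₁, h₂, h₃⟩ := hXU v hv
    by_cases hNv : N v
    · have e := hcU v hNv hv
      have hm : ¬ Disjoint (U (c v)) K := e ▸ h₃
      obtain ⟨k₁, k₂, k₃, k₄⟩ := htc v hNv hm
      obtain ⟨-, x, hx, hxK, hcx, hd⟩ := (hc v hNv).2.2.2.2 hv
      have hpe : φ.par v = t (c v) := by
        by_cases hre : rep (c v) = v
        · rw [Guess.par, if_neg (by rw [hφs]; exact fun h => h.2 hre), hpown v hNv hre hm]
        · obtain ⟨k₅, k₆⟩ := hrepN v hNv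
          rw [Guess.par, if_pos ((hφs v).2 ⟨hNv, hre⟩), hpshr v hNv hre,
            hpown _ k₅ (by rw [k₆]) (by rw [k₆]; exact hm), k₆]
      rw [hpe]
      refine ⟨k₁, k₂.trans e, ?_⟩
      have := k₄ x (e ▸ hx) hxK hcx
      rw [e] at this
      omega
    · have hpe : φ.par v = dir v := by
        rw [Guess.par, if_neg (by rw [hφs]; exact fun h => hNv h.1),
          hpN v ((hXd v).1 hv).1 hNv, if_pos ⟨hv, hne⟩]
      obtain ⟨k₁, k₂, k₃, k₄⟩ := hdir v hv hNv hne
      rw [hpe]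
      exact ⟨hXm _ h₁ _ k₁ k₂, hUe _ h₁ _ k₁, k₄⟩
  have hparrt : ∀ v, X v → v = rt (U v) → φ.par v = v := fun v h₁ h₂ => by
    obtain ⟨-, h₃, -, h₄⟩ := (hroot_iff v).2 ⟨h₁, h₂⟩
    rw [Guess.par, if_neg h₄, h₃]
  have hrtX : ∀ v, X v → X (rt (U v)) ∧ U (rt (U v)) = U v := fun v hv => by
    obtain ⟨h₁, h₂, h₃⟩ := hXU v hv
    obtain ⟨h₄, h₅, -⟩ := hT _ h₁ h₃
    exact ⟨hXm _ h₁ _ h₄ h₅, hUe _ h₁ _ h₄⟩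
  -- ranks are less than the number of vertices, so the iteration reaches the root
  have hroot : ∀ v, X v → φ.root v = rt (U v) := fun v hv => by
    have key : ∀ i, X (φ.par^[i] v) ∧ U (φ.par^[i] v) = U v ∧
        (φ.par^[i] v = rt (U v) ∨ dd (U v) (φ.par^[i] v) + i ≤ dd (U v) v) := fun i => by
      induction i with
      | zero => exact ⟨hv, rfl, Or.inr le_rfl⟩
      | succ i ih =>
        obtain ⟨h₁, h₂, h₃⟩ := ih
        rw [Function.iterate_succ_apply']
        by_cases he : φ.par^[i] v = rt (U v)
        · rw [hparrt _ h₁ (by rw [h₂, he])]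
          exact ⟨h₁, h₂, Or.inl he⟩
        · obtain ⟨k₁, k₂, k₃⟩ := hpar _ h₁ (by rw [h₂]; exact he)
          refine ⟨k₁, k₂.trans h₂, Or.inr ?_⟩
          rw [h₂] at k₃
          have := h₃.resolve_left he
          omega
    refine (key (Fintype.card V)).2.2.resolve_right fun h => ?_
    obtain ⟨h₁, h₂, h₃⟩ := hXU v hv
    have := (hT _ h₁ h₃).2.2.1 v
    omega
  have hTouch : ∀ y, φ.Touched G y ↔ T y := fun y => by
    rw [hTd]
    exact exists_congr fun x => by rw [hφX]
  have hForced : ∀ y, φ.Forced G K y ↔ y ∉ K ∧ ¬ T y := fun y => by rw [Guess.Forced, hTouch]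
  have hpart : ∀ ρ, φ.IsRoot ρ → ∀ v, v ∈ φ.part ρ ↔ v ∈ U ρ ∧ v ∈ K := fun ρ hρ v => by
    obtain ⟨h₁, h₂⟩ := (hroot_iff ρ).1 hρ
    rw [Guess.mem_part, hφX]
    constructor
    · rintro ⟨h₃, h₄⟩
      rw [hroot v h₃] at h₄
      have h₅ := (hrtX v h₃).2
      rw [h₄] at h₅
      exact ⟨h₅ ▸ (hXU v h₃).2.1, ((hXd v).1 h₃).1⟩
    · rintro ⟨h₃, h₄⟩
      have h₅ := (hXU ρ h₁).1
      have h₆ := hXm _ h₅ v h₃ h₄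
      exact ⟨h₆, by rw [hroot v h₆, hUe _ h₅ v h₃]; exact h₂.symm⟩
  have hownOf : ∀ ρ, φ.IsRoot ρ → ∀ w, w ∈ φ.ownOf ρ ↔ φ.own w = true ∧ c w ∈ U ρ :=
    fun ρ hρ w => by
    obtain ⟨h₁, h₂⟩ := (hroot_iff ρ).1 hρ
    rw [Guess.mem_ownOf, hφX]
    refine and_congr_right fun ho => ?_
    obtain ⟨hNw, hre⟩ := (hφo w).1 ho
    have hcm := hU _ (hc w hNw).2.2.1
    constructor
    · rintro ⟨h₃, h₄⟩
      have hm : ¬ Disjoint (U (c w)) K := fun hm => by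
        obtain ⟨h₅, h₆⟩ := hpins w hNw hre hm
        exact h₆ (h₅ ▸ h₃)
      obtain ⟨k₁, k₂, -, -⟩ := htc w hNw hm
      rw [hpown w hNw hre hm, hroot _ k₁, k₂] at h₄
      have h₅ := (hrtX _ k₁).2
      rw [k₂, h₄] at h₅
      exact h₅ ▸ hcm.2
    · intro h₃
      have e := hUe _ (hXU ρ h₁).1 _ h₃
      have hm : ¬ Disjoint (U (c w)) K := e ▸ (hXU ρ h₁).2.2
      obtain ⟨k₁, k₂, -, -⟩ := htc w hNw hm
      rw [hpown w hNw hre hm, hroot _ k₁, k₂, e]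
      exact ⟨k₁, h₂.symm⟩
  have hcinj : ∀ w w', φ.own w = true → φ.own w' = true → c w = c w' → w = w' :=
    fun w w' h₁ h₂ e => by
    rw [← ((hφo w).1 h₁).2, ← ((hφo w').1 h₂).2, e]
  -- the vertices of a unit outside the cover: connectors and others
  obtain ⟨F, hFd⟩ : ∃ F : V → Finset V, ∀ ρ y, y ∈ F ρ ↔
      (y ∈ U ρ ∧ y ∉ K) ∧ ∀ w, φ.own w = true → c w ≠ y :=
    ⟨fun ρ => (U ρ).filter fun y => y ∉ K ∧ ∀ w, φ.own w = true → c w ≠ y,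
      fun ρ y => by simp [and_assoc]⟩
  have hcard : ∀ ρ, φ.IsRoot ρ → (φ.part ρ).card + (φ.ownOf ρ).card + (F ρ).card = r :=
    fun ρ hρ => by
    obtain ⟨h₁, h₂⟩ := (hroot_iff ρ).1 hρ
    have h₃ : ((φ.ownOf ρ).image c).card = (φ.ownOf ρ).card :=
      Finset.card_image_of_injOn fun w hw w' hw' e => hcinj w w'
        ((hownOf ρ hρ w).1 hw).1 ((hownOf ρ hρ w').1 hw').1 e
    have hcK : ∀ w, φ.own w = true → c w ∉ K := fun w hw => (hc w ((hφo w).1 hw).1).1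
    have h₄ : Disjoint (φ.part ρ) ((φ.ownOf ρ).image c) := by
      rw [Finset.disjoint_left]
      intro y hy hy'
      obtain ⟨w, hw, rfl⟩ := Finset.mem_image.1 hy'
      exact hcK w ((hownOf ρ hρ w).1 hw).1 ((hpart ρ hρ _).1 hy).2
    have h₅ : Disjoint (φ.part ρ ∪ (φ.ownOf ρ).image c) (F ρ) := by
      rw [Finset.disjoint_left]
      intro y hy hy'
      obtain ⟨⟨-, k₁⟩, k₂⟩ := (hFd ρ y).1 hy'
      rcases Finset.mem_union.1 hy with hy | hy
      · exact k₁ ((hpart ρ hρ _).1 hy).2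
      · obtain ⟨w, hw, rfl⟩ := Finset.mem_image.1 hy
        exact k₂ w ((hownOf ρ hρ w).1 hw).1 rfl
    have h₆ : φ.part ρ ∪ (φ.ownOf ρ).image c ∪ F ρ = U ρ := by
      ext y
      simp only [Finset.mem_union, hpart ρ hρ, Finset.mem_image, hownOf ρ hρ, hFd]
      constructor
      · rintro ((h | ⟨w, h, rfl⟩) | h)
        exacts [h.1, h.2, h.1.1]
      · intro hy
        by_cases hyK : y ∈ K
        · exact Or.inl (Or.inl ⟨hy, hyK⟩)
        · by_cases hw : ∃ w, φ.own w = true ∧ c w = y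
          · obtain ⟨w, hw, rfl⟩ := hw
            exact Or.inl (Or.inr ⟨w, ⟨hw, hy⟩, rfl⟩)
          · push Not at hw
            exact Or.inr ⟨⟨hy, hyK⟩, hw⟩
    rw [← h𝒟.card_eq _ (hXU ρ h₁).1, ← h₆, Finset.card_union_of_disjoint h₅,
      Finset.card_union_of_disjoint h₄, h₃]
  -- the unit that dominates a forced vertex lies inside the clique of that vertex
  have hforce : ∀ y, ∃ D, y ∉ K → ¬ T y → D ∈ 𝒟 ∧ Disjoint D K ∧
      ∀ u ∈ D, u ∉ K ∧ ¬ T u ∧ (u = y ∨ G.Adj y u) := fun y => by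
    by_cases hy : y ∉ K ∧ ¬ T y
    · obtain ⟨D, hD, u, hu, huy⟩ := h𝒟.dominating y
      have huK : u ∉ K := fun huK => hy.2 ((hTd y).2 ⟨u, hXm D hD u hu huK,
        (huy.resolve_left fun e => hy.1 (e ▸ huK)).symm⟩)
      have hDK : Disjoint D K := by
        by_contra hDK
        obtain ⟨x, hx, hxK, hux⟩ := (hT D hD hDK).2.2.2.2 u hu huK
        exact hy.2 ((hTd y).2 ⟨x, hXm D hD x hx hxK,
          (hK.adj_iff_of_mem huK hy.1 (huy.imp Eq.symm id) hxK).1 hux⟩)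
      refine ⟨D, fun _ _ => ⟨hD, hDK, fun v hv => ?_⟩⟩
      have hvK : v ∉ K := Finset.disjoint_left.1 hDK hv
      have hyv : y = v ∨ G.Adj y v := hK.adj_trans hy.1 huK (huy.imp id SimpleGraph.Adj.symm)
        (hK.clique_of_connected (h𝒟.connected D hD) hDK hu hv)
      refine ⟨hvK, fun hTv => hy.2 ?_, hyv.imp Eq.symm id⟩
      obtain ⟨x, hx, hvx⟩ := (hTd v).1 hTv
      exact (hTd y).2 ⟨x, hx, (hK.adj_iff_of_mem hy.1 hvK hyv ((hXd x).1 hx).1).2 hvx⟩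
    · exact ⟨∅, fun h₁ h₂ => absurd ⟨h₁, h₂⟩ hy⟩
  choose W hW using hforce
  refine ⟨φ, ⟨?_, ?_, ?_, ?_, ?_, ?_, ?_, ?_, ?_⟩, ?_, fun v hv => by rw [hφp, if_neg hv]⟩
  · rintro v (hv | hv | hv)
    · exact ((hXd v).1 ((hφX v).1 hv)).1
    · exact hNK v ((hφo v).1 hv).1
    · exact hNK v ((hφs v).1 hv).1
  · intro v hv
    have hXv := (hφX v).1 hv
    refine ⟨?_, ?_, ?_⟩
    · by_cases he : v = rt (U v)
      · rw [hparrt v hXv he]; exact hv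
      · exact (hφX _).2 (hpar v hXv he).1
    · rw [hroot v hXv, hroot_iff]
      obtain ⟨h₁, h₂⟩ := hrtX v hXv
      exact ⟨h₁, by rw [h₂]⟩
    · by_cases hNv : N v
      · by_cases hre : rep (c v) = v
        exacts [Or.inl ((hφo v).2 ⟨hNv, hre⟩), Or.inr (Or.inl ((hφs v).2 ⟨hNv, hre⟩))]
      · by_cases he : v = rt (U v)
        · exact Or.inr (Or.inr (Or.inl ((hroot_iff v).2 ⟨hXv, he⟩)))
        · rw [hpN v ((hXd v).1 hXv).1 hNv, if_pos ⟨hXv, he⟩]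
          exact Or.inr (Or.inr (Or.inr (hdir v hXv hNv he).2.2.1))
  · intro w hw
    obtain ⟨hNw, hre⟩ := (hφo w).1 hw
    by_cases hm : Disjoint (U (c w)) K
    · obtain ⟨h₁, h₂⟩ := hpins w hNw hre hm
      refine Or.inr ⟨?_, h₁⟩
      obtain ⟨-, h₃, h₄, -⟩ := hc w hNw
      obtain ⟨h₅, h₆⟩ := hU _ h₄
      by_contra hr1
      exact h₂ ((hXd w).2 ⟨hNK w hNw, hmax _ h₅ hm (by omega) _ h₆ w (hNK w hNw) h₃.symm⟩)
    · rw [hpown w hNw hre hm]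
      exact Or.inl ((hφX _).2 (htc w hNw hm).1)
  · intro v hv
    obtain ⟨hNv, hre⟩ := (hφs v).1 hv
    rw [hpshr v hNv hre]
    exact hownrep v hNv
  · intro v hv
    by_cases hNv : N v
    · by_cases hre : rep (c v) = v
      exacts [Or.inr (Or.inl ((hφo v).2 ⟨hNv, hre⟩)),
        Or.inr (Or.inr (Or.inl ((hφs v).2 ⟨hNv, hre⟩)))]
    · rw [hN, not_and, not_not, hEasy] at hNv
      rcases hNv hv with h | ⟨-, h | ⟨y, h₁, h₂⟩⟩
      · exact Or.inl ((hφX v).2 h.1)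
      · exact Or.inr (Or.inr (Or.inr (Or.inl ((hTouch v).2 h))))
      · exact Or.inr (Or.inr (Or.inr (Or.inr ⟨y, (hForced y).2 h₁, h₂⟩)))
  · intro y hy
    obtain ⟨h₁, h₂⟩ := (hForced y).1 hy
    obtain ⟨h₃, h₄, h₅⟩ := hW y h₁ h₂
    rw [← h𝒟.card_eq _ h₃]
    refine Finset.card_le_card fun u hu => ?_
    simp only [Finset.mem_filter, Finset.mem_univ, true_and]
    exact ⟨(h₅ u hu).1, (h₅ u hu).2.2⟩
  · intro ρ hρ
    have := hcard ρ hρ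
    omega
  · -- roots, forced cliques and single vertices are charged to different units
    set R := Finset.univ.filter fun v => φ.IsRoot v with hR
    set Q := Finset.univ.filter fun y => φ.Forced G K y ∧ ∀ u < y, ¬ (u ∉ K ∧ G.Adj y u) with hQ
    set I := Finset.univ.filter fun w => φ.own w ∧ ¬ φ.inX (φ.ptr w) with hI
    have hmR : ∀ v, v ∈ R → X v ∧ v = rt (U v) := fun v hv =>
      (hroot_iff v).1 (Finset.mem_filter.1 hv).2
    have hmQ : ∀ y, y ∈ Q → (y ∉ K ∧ ¬ T y) ∧ ∀ u < y, ¬ (u ∉ K ∧ G.Adj y u) := fun y hy => by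
      have := (Finset.mem_filter.1 hy).2
      rwa [hForced] at this
    have hmI : ∀ w, w ∈ I → N w ∧ φ.own w = true ∧ Disjoint (U (c w)) K := fun w hw => by
      obtain ⟨h₁, h₂⟩ := (Finset.mem_filter.1 hw).2
      obtain ⟨h₃, h₄⟩ := (hφo w).1 h₁
      refine ⟨h₃, h₁, ?_⟩
      by_contra hm
      rw [hpown w h₃ h₄ hm] at h₂
      exact h₂ ((hφX _).2 (htc w h₃ hm).1)
    have hRc : (R.image U).card = R.card := Finset.card_image_of_injOn fun v hv w hw e => by
      rw [(hmR v hv).2, (hmR w hw).2]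
      exact congrArg rt e
    have hQc : (Q.image W).card = Q.card := Finset.card_image_of_injOn fun y hy y' hy' e => by
      obtain ⟨⟨h₁, h₂⟩, h₃⟩ := hmQ y hy
      obtain ⟨⟨k₁, k₂⟩, k₃⟩ := hmQ y' hy'
      obtain ⟨m₁, -, m₂⟩ := hW y h₁ h₂
      obtain ⟨-, -, l₂⟩ := hW y' k₁ k₂
      obtain ⟨u, hu⟩ := Finset.card_pos.1 ((h𝒟.card_eq _ m₁).symm ▸ hr : 0 < (W y).card)
      obtain ⟨n₁, -, n₂⟩ := m₂ u hu
      have hu' : u ∈ W y' := by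
        have e' : W y = W y' := e
        exact e' ▸ hu
      obtain ⟨-, -, n₃⟩ := l₂ u hu'
      by_contra hne
      have hadj : G.Adj y y' := (hK.adj_trans h₁ n₁ (n₂.imp Eq.symm id)
        (n₃.imp id SimpleGraph.Adj.symm)).resolve_left hne
      rcases lt_or_gt_of_ne hne with hlt | hlt
      · exact k₃ y hlt ⟨h₁, hadj.symm⟩
      · exact h₃ y' hlt ⟨k₁, hadj⟩
    have hIc : (I.image fun w => U (c w)).card = I.card :=
      Finset.card_image_of_injOn fun w hw w' hw' e => by
      obtain ⟨h₁, h₂, h₃⟩ := hmI w hw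
      obtain ⟨k₁, k₂, k₃⟩ := hmI w' hw'
      obtain ⟨a₁, a₂⟩ := hU _ (hc w h₁).2.2.1
      have a₃ := (hU _ (hc w' k₁).2.2.1).2
      have e' : U (c w) = U (c w') := e
      rw [← e'] at a₃
      obtain ⟨hp, hX⟩ := hpins w h₁ ((hφo w).1 h₂).2 h₃
      have hr1 : r = 1 := by
        obtain ⟨-, b₃, b₄, -⟩ := hc w h₁
        by_contra hr1
        exact hX ((hXd w).2 ⟨hNK w h₁, hmax _ a₁ h₃ (by omega) _ a₂ w (hNK w h₁) b₃.symm⟩)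
      have h1 := h𝒟.card_eq _ a₁
      rw [hr1] at h1
      exact hcinj w w' h₂ k₂ (Finset.card_le_one.1 h1.le _ a₂ _ a₃)
    have hd₁ : Disjoint (R.image U) (Q.image W) := by
      rw [Finset.disjoint_left]
      intro D h₁ h₂
      obtain ⟨v, hv, rfl⟩ := Finset.mem_image.1 h₁
      obtain ⟨y, hy, e⟩ := Finset.mem_image.1 h₂
      obtain ⟨⟨k₁, k₂⟩, -⟩ := hmQ y hy
      exact (hXU v (hmR v hv).1).2.2 (e ▸ (hW y k₁ k₂).2.1)
    have hd₂ : Disjoint (R.image U ∪ Q.image W) (I.image fun w => U (c w)) := by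
      rw [Finset.disjoint_left]
      intro D h₁ h₂
      obtain ⟨w, hw, rfl⟩ := Finset.mem_image.1 h₂
      obtain ⟨m₁, m₂, m₃⟩ := hmI w hw
      rcases Finset.mem_union.1 h₁ with h₁ | h₁
      · obtain ⟨v, hv, e⟩ := Finset.mem_image.1 h₁
        exact (hXU v (hmR v hv).1).2.2 (e ▸ m₃)
      · obtain ⟨y, hy, e⟩ := Finset.mem_image.1 h₁
        obtain ⟨⟨k₁, k₂⟩, -⟩ := hmQ y hy
        exact ((hW y k₁ k₂).2.2 (c w) (e ▸ (hU _ (hc w m₁).2.2.1).2)).2.1 (hc w m₁).2.2.2.1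
    rw [← hRc, ← hQc, ← hIc, ← Finset.card_union_of_disjoint hd₁,
      ← Finset.card_union_of_disjoint hd₂]
    refine (Finset.card_le_card fun D hD => ?_).trans hk
    rcases Finset.mem_union.1 hD with hD | hD
    · rcases Finset.mem_union.1 hD with hD | hD
      · obtain ⟨v, hv, rfl⟩ := Finset.mem_image.1 hD
        exact (hXU v (hmR v hv).1).1
      · obtain ⟨y, hy, rfl⟩ := Finset.mem_image.1 hD
        obtain ⟨⟨k₁, k₂⟩, -⟩ := hmQ y hy
        exact (hW y k₁ k₂).1
    · obtain ⟨w, hw, rfl⟩ := Finset.mem_image.1 hD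
      exact (hU _ (hc w (hmI w hw).1).2.2.1).1
  · -- the connectors and the remaining vertices of the units in the solution are distinct
    intro A B
    set A' := Finset.univ.filter fun w => w ∈ A ∧ φ.own w with hA'
    set B' := Finset.univ.filter fun ρ => ρ ∈ B ∧ φ.IsRoot ρ with hB'
    have hmA : ∀ w, w ∈ A' ↔ w ∈ A ∧ φ.own w := fun w => by simp [hA']
    have hmB : ∀ w, w ∈ B' ↔ w ∈ B ∧ φ.IsRoot w := fun w => by simp [hB']
    have h₁ : (A'.image c).card = A'.card := Finset.card_image_of_injOn fun w hw w' hw' e =>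
      hcinj w w' ((hmA w).1 hw).2 ((hmA w').1 hw').2 e
    have h₂ : (B'.biUnion F).card = ∑ ρ ∈ B', φ.demand r ρ := by
      rw [Finset.card_biUnion]
      · refine Finset.sum_congr rfl fun ρ hρ => ?_
        have := hcard ρ ((hmB ρ).1 hρ).2
        rw [Guess.demand]
        omega
      · intro ρ hρ ρ' hρ' hne
        rw [Function.onFun, Finset.disjoint_left]
        intro y hy hy'
        obtain ⟨k₁, k₂⟩ := (hroot_iff ρ).1 ((hmB ρ).1 hρ).2
        obtain ⟨l₁, l₂⟩ := (hroot_iff ρ').1 ((hmB ρ').1 hρ').2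
        have e₁ := hUe _ (hXU ρ k₁).1 y ((hFd ρ y).1 hy).1.1
        have e₂ := hUe _ (hXU ρ' l₁).1 y ((hFd ρ' y).1 hy').1.1
        exact hne (by rw [k₂, l₂, ← e₁, ← e₂])
    have h₃ : Disjoint (A'.image c) (B'.biUnion F) := by
      rw [Finset.disjoint_left]
      intro y hy hy'
      obtain ⟨w, hw, rfl⟩ := Finset.mem_image.1 hy
      obtain ⟨ρ, hρ, hF⟩ := Finset.mem_biUnion.1 hy'
      exact ((hFd ρ _).1 hF).2 w ((hmA w).1 hw).2 rfl
    rw [← h₁, ← h₂, ← Finset.card_union_of_disjoint h₃]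
    refine Finset.card_le_card fun y hy => ?_
    simp only [Finset.mem_filter, Finset.mem_univ, true_and]
    rcases Finset.mem_union.1 hy with hy | hy
    · obtain ⟨w, hw, rfl⟩ := Finset.mem_image.1 hy
      obtain ⟨hwA, ho⟩ := (hmA w).1 hw
      obtain ⟨hNw, hre⟩ := (hφo w).1 ho
      obtain ⟨k₁, k₂, k₃, k₄, -⟩ := hc w hNw
      refine Or.inl ⟨w, hwA, ho, k₁, (hTouch _).2 k₄, k₂.symm, ?_, fun v hv hpv => ?_⟩
      · by_cases hm : Disjoint (U (c w)) K
        · rw [(hpins w hNw hre hm).1]; exact k₂.symm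
        · rw [hpown w hNw hre hm]; exact (htc w hNw hm).2.2.1
      · obtain ⟨hNv, hne⟩ := (hφs v).1 hv
        rw [hpshr v hNv hne] at hpv
        have e := (hrepN v hNv).2
        rw [hpv] at e
        rw [e]
        exact (hc v hNv).2.1.symm
    · obtain ⟨ρ, hρ, hF⟩ := Finset.mem_biUnion.1 hy
      obtain ⟨hρB, hρR⟩ := (hmB ρ).1 hρ
      obtain ⟨⟨k₁, k₂⟩, -⟩ := (hFd ρ y).1 hF
      obtain ⟨l₁, l₂⟩ := (hroot_iff ρ).1 hρR
      obtain ⟨m₁, m₂, m₃⟩ := hXU ρ l₁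
      obtain ⟨x, hx, hxK, hyx⟩ := (hT _ m₁ m₃).2.2.2.2 y k₁ k₂
      obtain ⟨n₁, n₂⟩ := Guess.mem_part.1 ((hpart ρ hρR x).2 ⟨hx, hxK⟩)
      exact Or.inr ⟨ρ, hρB, hρR, k₂, x, n₁, n₂, hyx⟩
  · intro v hv
    by_cases hNv : N v
    · by_cases hre : rep (c v) = v
      · by_cases hm : Disjoint (U (c v)) K
        · rw [(hpins v hNv hre hm).1]; exact hv
        · rw [hpown v hNv hre hm]; exact ((hXd _).1 (htc v hNv hm).1).1
      · rw [hpshr v hNv hre]; exact hNK _ (hrepN v hNv).1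
    · rw [hpN v hv hNv]
      split
      · rename_i h
        exact (hdir v h.1 hNv h.2).2.1
      · exact hv

end Completeness

/-! ### Correctness of the tests -/

section Ranges

variable {n : ℕ}

theorem any_range_iff {f : ℕ → Bool} : (List.range n).any f = true ↔ ∃ v : Fin n, f v = true := by
  simp only [List.any_eq_true, List.mem_range]
  exact ⟨fun ⟨v, hv, h⟩ => ⟨⟨v, hv⟩, h⟩, fun ⟨v, h⟩ => ⟨v, v.2, h⟩⟩

theorem all_range_iff {f : ℕ → Bool} : (List.range n).all f = true ↔ ∀ v : Fin n, f v = true := by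
  simp only [List.all_eq_true, List.mem_range]
  exact ⟨fun h v => h v v.2, fun h v hv => h ⟨v, hv⟩⟩

theorem sum_range_filter (f : ℕ → Bool) (g : ℕ → ℕ) :
    (((List.range n).filter f).map g).sum =
      ∑ v ∈ Finset.univ.filter (fun v : Fin n => f v = true), g v := by
  rw [Finset.sum_filter, Fin.sum_univ_eq_sum_range (fun v => if f v = true then g v else 0)]
  induction n with
  | zero => rfl
  | succ n ih =>
    rw [List.range_succ, List.filter_append, List.map_append, List.sum_append, ih,
      Finset.sum_range_succ]
    by_cases h : f n = true <;> simp [h]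

theorem length_range_filter (f : ℕ → Bool) :
    ((List.range n).filter f).length = (Finset.univ.filter fun v : Fin n => f v = true).card := by
  have := sum_range_filter (n := n) f fun _ => 1
  simpa using this

theorem length_range_filter_iff {f : ℕ → Bool} {P : Fin n → Prop} [DecidablePred P]
    (h : ∀ v : Fin n, f v = true ↔ P v) :
    ((List.range n).filter f).length = (Finset.univ.filter P).card := by
  rw [length_range_filter]
  congr 1
  exact Finset.filter_congr fun v _ => h v

end Ranges

open scoped Classical in
/-- The adjacency matrix as a list of lists. -/
noncomputable def matrix {n : ℕ} (G : SimpleGraph (Fin n)) : List (List Bool) :=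
  List.ofFn fun u : Fin n => List.ofFn fun v : Fin n => decide (G.Adj u v)

theorem enc_matrix {n : ℕ} (G : SimpleGraph (Fin n)) :
    enc (matrix G) = Instance.encodeGraph G := by
  change Data.ofList (List.map _ (matrix G)) = _
  rw [matrix, Instance.encodeGraph, List.map_ofFn]
  congr 2
  funext u
  change Data.ofList (List.map _ _) = _
  rw [List.map_ofFn]
  rfl

section Bridge

variable {n : ℕ} (G : SimpleGraph (Fin n))

@[simp] theorem length_matrix : (matrix G).length = n := by simp [matrix]

theorem adjB_matrix (u v : Fin n) : adjB (matrix G) u v = true ↔ G.Adj u v := by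
  simp [adjB, matrix, List.getD_eq_getElem?_getD]

/-- The vertices that are listed in `K`. -/
def toSet (n : ℕ) (K : List ℕ) : Finset (Fin n) := Finset.univ.filter fun v => v.1 ∈ K

@[simp] theorem mem_toSet {K : List ℕ} {v : Fin n} : v ∈ toSet n K ↔ v.1 ∈ K := by simp [toSet]

theorem memB_iff {K : List ℕ} {v : ℕ} : memB K v = true ↔ v ∈ K := by
  simp [memB]

theorem twinB_matrix (u v : Fin n) : twinB (matrix G) u v = true ↔ AreTwins G u v := by
  unfold twinB
  rw [length_matrix, all_range_iff, AreTwins, Set.ext_iff]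
  refine forall_congr' fun w => ?_
  have h : ∀ u : Fin n, nbB (matrix G) u w = true ↔ w ∈ closedNbhd G u := fun u => by
    simp only [nbB, Bool.or_eq_true, decide_eq_true_eq, adjB_matrix, ← Fin.ext_iff]
    rfl
  rw [← h u, ← h v]
  cases nbB (matrix G) u w <;> cases nbB (matrix G) v w <;> simp

theorem badB_matrix (K : List ℕ) (u v : Fin n) : badB (matrix G) K u v = true ↔
    G.Adj u v ∧ ¬ AreTwins G u v ∧ u ∉ toSet n K ∧ v ∉ toSet n K := by
  simp only [badB, Bool.and_eq_true, Bool.not_eq_true', ← Bool.not_eq_true, adjB_matrix,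
    twinB_matrix, memB_iff, mem_toSet, and_assoc]

theorem coverB_matrix (K : List ℕ) : coverB (matrix G) K = true ↔ IsTwinCover G (toSet n K) := by
  unfold coverB badRow
  rw [List.isEmpty_iff, List.filter_eq_nil_iff, length_matrix]
  simp only [any_range_iff, not_exists, List.mem_range]
  constructor
  · intro h u v huv
    have := h u.1 u.2 v
    rw [badB_matrix] at this
    tauto
  · intro h u hu v
    rw [badB_matrix G K ⟨u, hu⟩ v]
    have := h ⟨u, hu⟩ v
    tauto

variable {G} {K : List ℕ} {T : List (ℕ × Letter)} {r k : ℕ}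

/-- The table in `c` represents the guess `φ`. -/
structure Represents (c : Ctx) (φ : Guess (Fin n)) : Prop where
  inX : ∀ v : Fin n, inXB c v = φ.inX v
  own : ∀ v : Fin n, ownB c v = φ.own v
  shr : ∀ v : Fin n, shrB c v = φ.shr v
  ptr : ∀ v : Fin n, ptrB c v = (φ.ptr v).1


namespace Represents

variable {φ : Guess (Fin n)}

theorem par (h : Represents (matrix G, K, T, r, k) φ) (v : Fin n) :
    parB (matrix G, K, T, r, k) v = (φ.par v).1 := by
  rw [parB, Guess.par, h.shr, h.ptr, h.ptr]
  split <;> rfl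

theorem root (h : Represents (matrix G, K, T, r, k) φ) (v : Fin n) :
    rootB (matrix G, K, T, r, k) v = (φ.root v).1 := by
  rw [rootB, Guess.root, Fintype.card_fin]
  dsimp only
  rw [length_matrix]
  exact (Function.Semiconj.iterate_right (f := Fin.val) (ga := φ.par)
      (gb := fun u => parB (matrix G, K, T, r, k) u) (fun v => (h.par v).symm) _ v).symm

theorem isRoot (h : Represents (matrix G, K, T, r, k) φ) (v : Fin n) :
    isRootB (matrix G, K, T, r, k) v = true ↔ φ.IsRoot v := by
  simp only [isRootB, Guess.IsRoot, h.inX, h.ptr, h.own, h.shr, Bool.and_eq_true,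
    decide_eq_true_eq, Bool.not_eq_true', ← Bool.not_eq_true, ← Fin.ext_iff, and_assoc]

theorem touched (h : Represents (matrix G, K, T, r, k) φ) (v : Fin n) :
    touchedB (matrix G, K, T, r, k) v = true ↔ φ.Touched G v := by
  simp only [touchedB, length_matrix, any_range_iff, Guess.Touched, h.inX, Bool.and_eq_true,
    adjB_matrix]

theorem forced (h : Represents (matrix G, K, T, r, k) φ) (v : Fin n) :
    forcedB (matrix G, K, T, r, k) v = true ↔ φ.Forced G (toSet n K) v := by
  simp only [forcedB, Guess.Forced, Bool.and_eq_true, Bool.not_eq_true', ← Bool.not_eq_true,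
    memB_iff, h.touched, mem_toSet]

theorem allowed (h : Represents (matrix G, K, T, r, k) φ) (w y : Fin n) :
    allowedB (matrix G, K, T, r, k) w y = true ↔ φ.Allowed G (toSet n K) w y := by
  simp only [allowedB, Guess.Allowed, Bool.and_eq_true, Bool.not_eq_true', ← Bool.not_eq_true,
    memB_iff, h.touched, mem_toSet, length_matrix, all_range_iff, h.ptr, h.shr, adjB_matrix,
    Bool.or_eq_true, decide_eq_true_eq, ← Fin.ext_iff, and_assoc, ← imp_iff_not_or, and_imp]

theorem fill (h : Represents (matrix G, K, T, r, k) φ) (ρ y : Fin n) :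
    fillB (matrix G, K, T, r, k) ρ y = true ↔ φ.Fill G (toSet n K) ρ y := by
  simp only [fillB, Guess.Fill, Bool.and_eq_true, Bool.not_eq_true', ← Bool.not_eq_true,
    memB_iff, mem_toSet, length_matrix, any_range_iff, h.inX, h.root, adjB_matrix,
    decide_eq_true_eq, ← Fin.ext_iff, and_assoc]

theorem partCard (h : Represents (matrix G, K, T, r, k) φ) (ρ : Fin n) :
    partCard (matrix G, K, T, r, k) ρ = (φ.part ρ).card := by
  rw [GroupedDom.partCard, length_matrix, length_range_filter]
  congr 1
  ext v
  simp only [Finset.mem_filter, Finset.mem_univ, true_and, Guess.mem_part, h.inX, h.root,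
    Bool.and_eq_true, decide_eq_true_eq, ← Fin.ext_iff]

theorem ownCard (h : Represents (matrix G, K, T, r, k) φ) (ρ : Fin n) :
    ownCard (matrix G, K, T, r, k) ρ = (φ.ownOf ρ).card := by
  rw [GroupedDom.ownCard, length_matrix, length_range_filter]
  congr 1
  ext v
  simp only [Finset.mem_filter, Finset.mem_univ, true_and, Guess.mem_ownOf, h.own, h.ptr, h.inX,
    h.root, Bool.and_eq_true, decide_eq_true_eq, ← Fin.ext_iff, and_assoc]

theorem demand (h : Represents (matrix G, K, T, r, k) φ) (ρ : Fin n) :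
    demandB (matrix G, K, T, r, k) ρ = φ.demand r ρ := by
  rw [demandB, Guess.demand, h.partCard, h.ownCard]

theorem tree (h : Represents (matrix G, K, T, r, k) φ) :
    treeB (matrix G, K, T, r, k) = true ↔ ∀ v, φ.inX v → φ.inX (φ.par v) ∧ φ.IsRoot (φ.root v) ∧
      (φ.own v ∨ φ.shr v ∨ φ.IsRoot v ∨ G.Adj v (φ.ptr v)) := by
  simp only [treeB, length_matrix, all_range_iff, Bool.and_eq_true, Bool.or_eq_true,
    Bool.not_eq_true', ← Bool.not_eq_true, h.inX, h.par, h.root, h.isRoot, h.own, h.shr, h.ptr,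
    adjB_matrix, ← imp_iff_not_or, and_assoc, or_assoc]

theorem own_ptr (h : Represents (matrix G, K, T, r, k) φ) :
    ownPtrB (matrix G, K, T, r, k) = true ↔
      ∀ w, φ.own w → φ.inX (φ.ptr w) ∨ (r = 1 ∧ φ.ptr w = w) := by
  simp only [ownPtrB, length_matrix, all_range_iff, Bool.and_eq_true, Bool.or_eq_true,
    Bool.not_eq_true', ← Bool.not_eq_true, h.inX, h.own, h.ptr, decide_eq_true_eq,
    ← Fin.ext_iff, or_assoc]
  simp only [← imp_iff_not_or]

theorem shr_ptr (h : Represents (matrix G, K, T, r, k) φ) :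
    shrPtrB (matrix G, K, T, r, k) = true ↔ ∀ v, φ.shr v → φ.own (φ.ptr v) := by
  simp only [shrPtrB, length_matrix, all_range_iff, Bool.or_eq_true,
    Bool.not_eq_true', ← Bool.not_eq_true, h.own, h.shr, h.ptr, ← imp_iff_not_or]

theorem cover (h : Represents (matrix G, K, T, r, k) φ) :
    dominatedB (matrix G, K, T, r, k) = true ↔ ∀ v ∈ toSet n K, φ.inX v ∨ φ.own v ∨ φ.shr v ∨
      φ.Touched G v ∨ ∃ y, φ.Forced G (toSet n K) y ∧ G.Adj v y := by
  simp only [dominatedB, length_matrix, all_range_iff, any_range_iff, Bool.or_eq_true,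
    Bool.and_eq_true, Bool.not_eq_true', ← Bool.not_eq_true, h.inX, h.own, h.shr, h.touched,
    h.forced, adjB_matrix, memB_iff, mem_toSet, or_assoc]
  simp only [← imp_iff_not_or]

open scoped Classical in
theorem clique (h : Represents (matrix G, K, T, r, k) φ) :
    cliqueB (matrix G, K, T, r, k) = true ↔ ∀ y, φ.Forced G (toSet n K) y →
      r ≤ (Finset.univ.filter fun u => u ∉ toSet n K ∧ (u = y ∨ G.Adj y u)).card := by
  simp only [cliqueB, length_matrix, all_range_iff, Bool.or_eq_true, Bool.not_eq_true',
    ← Bool.not_eq_true, h.forced, ← imp_iff_not_or, decide_eq_true_eq]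
  refine forall_congr' fun y => imp_congr_right fun _ => ?_
  rw [length_range_filter_iff (P := fun u => u ∉ toSet n K ∧ (u = y ∨ G.Adj y u))]
  · intro u
    simp only [Bool.and_eq_true, Bool.or_eq_true, Bool.not_eq_true', ← Bool.not_eq_true, memB_iff,
      adjB_matrix, mem_toSet, decide_eq_true_eq, ← Fin.ext_iff]

theorem part_le (h : Represents (matrix G, K, T, r, k) φ) :
    partLeB (matrix G, K, T, r, k) = true ↔
      ∀ ρ, φ.IsRoot ρ → (φ.part ρ).card + (φ.ownOf ρ).card ≤ r := by
  simp only [partLeB, length_matrix, all_range_iff, Bool.or_eq_true, Bool.not_eq_true',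
    ← Bool.not_eq_true, h.isRoot, ← imp_iff_not_or, decide_eq_true_eq, h.partCard, h.ownCard]

open scoped Classical in
theorem count (h : Represents (matrix G, K, T, r, k) φ) :
    countB (matrix G, K, T, r, k) = true ↔ (Finset.univ.filter fun v => φ.IsRoot v).card +
      (Finset.univ.filter fun y => φ.Forced G (toSet n K) y ∧
        ∀ u < y, ¬ (u ∉ toSet n K ∧ G.Adj y u)).card +
      (Finset.univ.filter fun w => φ.own w ∧ ¬ φ.inX (φ.ptr w)).card ≤ k := by
  rw [countB, decide_eq_true_eq, length_matrix,
    length_range_filter_iff (P := fun v => φ.IsRoot v) h.isRoot,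
    length_range_filter_iff (P := fun y => φ.Forced G (toSet n K) y ∧
        ∀ u < y, ¬ (u ∉ toSet n K ∧ G.Adj y u)),
    length_range_filter_iff (P := fun w => φ.own w ∧ ¬ φ.inX (φ.ptr w))]
  · intro w
    simp only [Bool.and_eq_true, Bool.not_eq_true', ← Bool.not_eq_true, h.own, h.ptr, h.inX]
  · intro y
    simp only [Bool.and_eq_true, Bool.not_eq_true', ← Bool.not_eq_true, h.forced, all_range_iff,
      Bool.or_eq_true, decide_eq_true_eq, memB_iff, adjB_matrix, mem_toSet, ← imp_iff_not_or,
      Fin.lt_def]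

open scoped Classical in
theorem hall (h : Represents (matrix G, K, T, r, k) φ) {S : List (ℕ × Bool × Bool)}
    {A B : Finset (Fin n)} (hA : ∀ v : Fin n, (lookup (false, false) S v).1 = true ↔ v ∈ A)
    (hB : ∀ v : Fin n, (lookup (false, false) S v).2 = true ↔ v ∈ B) :
    hallB (matrix G, K, T, r, k) S = true ↔
      (Finset.univ.filter fun w => w ∈ A ∧ φ.own w).card +
        ∑ ρ ∈ Finset.univ.filter (fun ρ => ρ ∈ B ∧ φ.IsRoot ρ), φ.demand r ρ ≤
      (Finset.univ.filter fun y => (∃ w, w ∈ A ∧ φ.own w ∧ φ.Allowed G (toSet n K) w y) ∨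
        ∃ ρ, ρ ∈ B ∧ φ.IsRoot ρ ∧ φ.Fill G (toSet n K) ρ y).card := by
  rw [hallB, decide_eq_true_eq, length_matrix, sum_range_filter,
    length_range_filter_iff (P := fun w => w ∈ A ∧ φ.own w),
    length_range_filter_iff (P := fun y =>
      (∃ w, w ∈ A ∧ φ.own w ∧ φ.Allowed G (toSet n K) w y) ∨
        ∃ ρ, ρ ∈ B ∧ φ.IsRoot ρ ∧ φ.Fill G (toSet n K) ρ y),
    Finset.sum_congr (s₂ := Finset.univ.filter fun ρ => ρ ∈ B ∧ φ.IsRoot ρ) (Finset.filter_congr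
      fun ρ _ => by simp only [Bool.and_eq_true, hB, h.isRoot]) fun ρ _ => h.demand ρ]
  · intro y
    simp only [Bool.and_eq_true, Bool.or_eq_true, any_range_iff, hA, hB, h.own, h.isRoot,
      h.allowed, h.fill, and_assoc]
  · intro w
    simp only [Bool.and_eq_true, hA, h.own]

end Represents

theorem lookup_of_notMem {β : Type} (d : β) {K : List ℕ} (w : List β) {v : ℕ} (hv : v ∉ K) :
    lookup d (table d K w) v = d := by
  have : (table d K w).filter (fun e => decide (e.1 = v)) = [] := by
    rw [List.filter_eq_nil_iff, table]
    rintro e he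
    obtain ⟨i, hi, rfl⟩ := List.mem_map.1 he
    rw [List.mem_range] at hi
    intro h
    rw [decide_eq_true_eq] at h
    rw [List.getD_eq_getElem _ _ hi] at h
    exact hv (h ▸ List.getElem_mem hi)
  rw [lookup, this, List.headD_nil]

/-- Repetitions in `K` do no harm if the values come from a function. -/
theorem lookup_map {β : Type} (d : β) {K : List ℕ} (f : ℕ → β) {v : ℕ} (hv : v ∈ K) :
    lookup d (table d K (K.map f)) v = f v := by
  have h₁ : ∀ e ∈ table d K (K.map f), e.2 = f e.1 := fun e he => by
    rw [table] at he
    obtain ⟨i, hi, rfl⟩ := List.mem_map.1 he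
    rw [List.mem_range] at hi
    simp [hi]
  have h₂ : (v, f v) ∈ table d K (K.map f) := by
    obtain ⟨i, hi, rfl⟩ := List.getElem_of_mem hv
    rw [table]
    exact List.mem_map.2 ⟨i, List.mem_range.2 hi, by simp [hi]⟩
  rw [lookup]
  rcases h : (table d K (K.map f)).filter fun e => decide (e.1 = v) with _ | ⟨e, l⟩
  · exact absurd (List.filter_eq_nil_iff.1 h _ h₂) (by simp)
  · have : e ∈ (table d K (K.map f)).filter fun e => decide (e.1 = v) := by simp [h]
    obtain ⟨h₃, h₄⟩ := List.mem_filter.1 this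
    rw [h, List.headD_cons, h₁ e h₃, of_decide_eq_true h₄]

theorem lookup_mem {β : Type} (d : β) {K : List ℕ} {w : List β} (hw : w.length = K.length) (v : ℕ) :
    lookup d (table d K w) v = d ∨ lookup d (table d K w) v ∈ w := by
  rw [lookup]
  rcases h : (table d K w).filter fun e => decide (e.1 = v) with _ | ⟨e, l⟩
  · exact Or.inl (by rw [h, List.headD_nil])
  · have : e ∈ (table d K w).filter fun e => decide (e.1 = v) := by simp [h]
    obtain ⟨h₃, -⟩ := List.mem_filter.1 this
    rw [table] at h₃
    obtain ⟨i, hi, rfl⟩ := List.mem_map.1 h₃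
    rw [List.mem_range, ← hw] at hi
    right
    rw [h, List.headD_cons, List.getD_eq_getElem _ _ hi]
    exact List.getElem_mem hi

theorem acceptB_matrix {φ : Guess (Fin n)} {w : List Letter}
    (h : Represents (matrix G, K, table noLetter K w, r, k) φ)
    (hsupp : ∀ v, φ.inX v ∨ φ.own v ∨ φ.shr v → v ∈ toSet n K) :
    acceptB (matrix G, r, k) K w = true ↔ φ.Valid G (toSet n K) r k := by
  rw [acceptB, Bool.and_eq_true, Bool.not_eq_true', ← Bool.not_eq_true, anyWord_iff, localB]
  simp only [Bool.and_eq_true, h.tree, h.own_ptr, h.shr_ptr, h.cover, h.clique, h.part_le, h.count,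
    not_exists, not_and, Bool.not_eq_true', Bool.not_eq_false]
  constructor
  · rintro ⟨⟨⟨⟨⟨⟨⟨h₁, h₂⟩, h₃⟩, h₄⟩, h₅⟩, h₆⟩, h₇⟩, h₈⟩
    refine ⟨hsupp, h₁, h₂, h₃, h₄, by convert h₅, h₆, by convert h₇, fun A B => ?_⟩
    have key := h₈ (K.map fun v => (decide (∃ u ∈ A, u.1 = v), decide (∃ u ∈ B, u.1 = v)))
      (by simp) fun x _ => mem_bitPairs x
    -- `A` and `B` only matter on the cover, where they can be tabulated
    rw [h.hall (A := A.filter fun v => v.1 ∈ K) (B := B.filter fun v => v.1 ∈ K)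
      (fun v => ?_) fun v => ?_] at key
    · have hA : ∀ w, (w ∈ A.filter fun v => v.1 ∈ K) ∧ φ.own w ↔ w ∈ A ∧ φ.own w := fun w => by
        have := hsupp w
        simp only [mem_toSet] at this
        simp only [Finset.mem_filter]
        tauto
      have hB : ∀ w, (w ∈ B.filter fun v => v.1 ∈ K) ∧ φ.IsRoot w ↔ w ∈ B ∧ φ.IsRoot w :=
        fun w => by
        have h₁ := hsupp w
        simp only [mem_toSet] at h₁
        have h₂ : φ.IsRoot w → w.1 ∈ K := fun h => h₁ (Or.inl h.1)
        simp only [Finset.mem_filter]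
        tauto
      refine le_trans (le_of_eq ?_) (key.trans (Finset.card_le_card fun y hy => ?_))
      · simp only [hA]
        congr 1
        refine Finset.sum_congr ?_ fun _ _ => rfl
        ext ρ
        simp only [Finset.mem_filter_univ, hB]
      · simp only [Finset.mem_filter_univ] at hy ⊢
        exact hy.imp (fun ⟨w, hw, h⟩ => ⟨w, (Finset.mem_filter.1 hw).1, h⟩)
          fun ⟨w, hw, h⟩ => ⟨w, (Finset.mem_filter.1 hw).1, h⟩
    all_goals
      by_cases hv : v.1 ∈ K
      · rw [lookup_map _ _ hv]
        simp [hv, ← Fin.ext_iff]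
      · rw [lookup_of_notMem _ _ hv]
        simp [hv]
  · intro hv
    refine ⟨⟨⟨⟨⟨⟨⟨hv.tree, hv.own_ptr⟩, hv.shr_ptr⟩, hv.cover⟩, by convert hv.clique⟩,
      hv.part_le⟩, by convert hv.count⟩, fun S _ _ => ?_⟩
    rw [h.hall (A := Finset.univ.filter fun v : Fin n =>
      (lookup (false, false) (table (false, false) K S) v).1 = true)
      (B := Finset.univ.filter fun v : Fin n =>
      (lookup (false, false) (table (false, false) K S) v).2 = true) (by simp) (by simp)]
    convert hv.hall _ _

theorem solveWith_matrix (hKn : ∀ v ∈ K, v < n) (hr : 0 < r) :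
    solveWith (matrix G, r, k) K = true ↔
      IsTwinCover G (toSet n K) ∧ HasGroupedDominatingSet G r k := by
  rw [solveWith, Bool.and_eq_true, coverB_matrix, anyWord_iff]
  refine and_congr_right fun hK => ⟨?_, fun h => ?_⟩
  · rintro ⟨w, hw, hlet, hacc⟩
    have hptr : ∀ v : Fin n, (lookup noLetter (table noLetter K w) v).2 < n := fun v => by
      have h0 : 0 < n := v.pos
      rcases lookup_mem noLetter hw v with h | h
      · rw [h]; exact h0
      · rcases mem_letters.1 (hlet _ h) with h | h
        · rw [h]; exact h0
        · exact hKn _ h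
    let φ : Guess (Fin n) :=
      { inX := fun v => (lookup noLetter (table noLetter K w) v).1.1
        own := fun v => (lookup noLetter (table noLetter K w) v).1.2.1
        shr := fun v => (lookup noLetter (table noLetter K w) v).1.2.2
        ptr := fun v => ⟨_, hptr v⟩ }
    have hφ : Represents (matrix G, K, table noLetter K w, r, k) φ :=
      ⟨fun v => by rw [inXB], fun v => by rw [ownB], fun v => by rw [shrB], fun v => by rw [ptrB]⟩
    refine Guess.Valid.hasGroupedDominatingSet hK hr ((acceptB_matrix hφ fun v hv => ?_).1 hacc)
    by_contra hvK
    rw [mem_toSet] at hvK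
    simp [φ, lookup_of_notMem _ _ hvK] at hv
  · obtain ⟨φ, hv, hptrK, hptr0⟩ : ∃ φ : Guess (Fin n), φ.Valid G (toSet n K) r k ∧
        (∀ v ∈ toSet n K, φ.ptr v ∈ toSet n K) ∧ ∀ v ∉ toSet n K, (φ.ptr v).1 = 0 := by
      -- the empty graph has no vertex that could serve as default value of the pointers
      rcases Nat.eq_zero_or_pos n with rfl | hn
      · refine ⟨⟨Fin.elim0, Fin.elim0, Fin.elim0, Fin.elim0⟩, ?_, by simp, by simp⟩
        constructor <;> simp
      · obtain ⟨φ, h₁, h₂, h₃⟩ := h.exists_valid hK hr ⟨0, hn⟩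
        exact ⟨φ, h₁, h₂, fun v hv => by rw [h₃ v hv]⟩
    set f : ℕ → Letter := fun v => if hv : v < n then
      ((φ.inX ⟨v, hv⟩, φ.own ⟨v, hv⟩, φ.shr ⟨v, hv⟩), (φ.ptr ⟨v, hv⟩).1) else noLetter with hf
    have hfv : ∀ v : Fin n, lookup noLetter (table noLetter K (K.map f)) v =
        ((φ.inX v, φ.own v, φ.shr v), (φ.ptr v).1) := fun v => by
      by_cases hvK : v.1 ∈ K
      · rw [lookup_map _ _ hvK]
        simp [hf]
      · have h₁ : ¬ (φ.inX v = true ∨ φ.own v = true ∨ φ.shr v = true) := fun h =>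
          hvK (mem_toSet.1 (hv.supp v h))
        have h₂ := hptr0 v (by simpa using hvK)
        rw [lookup_of_notMem _ _ hvK, h₂]
        simp only [not_or, Bool.not_eq_true] at h₁
        simp [h₁]
    refine ⟨K.map f, by simp, fun x hx => ?_, ?_⟩
    · obtain ⟨v, hvK, rfl⟩ := List.mem_map.1 hx
      refine mem_letters.2 (Or.inr ?_)
      have := hptrK ⟨v, hKn v hvK⟩ (by simpa using hvK)
      simpa [hf, hKn v hvK] using this
    · refine (acceptB_matrix (φ := φ) ⟨fun v => ?_, fun v => ?_, fun v => ?_, fun v => ?_⟩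
        hv.supp).2 hv
      · rw [inXB, hfv]
      · rw [ownB, hfv]
      · rw [shrB, hfv]
      · rw [ptrB, hfv]

end Bridge

/-! ### Finding a twin cover by branching -/

section Branching

variable {n : ℕ} {G : SimpleGraph (Fin n)}

theorem headD_range_filter {f : ℕ → Bool} {v : ℕ} (hv : v < n) (h : f v = true) :
    ((List.range n).filter f).headD 0 < n ∧ f (((List.range n).filter f).headD 0) = true := by
  rcases e : (List.range n).filter f with _ | ⟨u, l⟩
  · exact absurd (List.filter_eq_nil_iff.1 e v (List.mem_range.2 hv)) (by simpa using h)
  · have : u ∈ (List.range n).filter f := by simp [e]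
    rw [List.mem_filter, List.mem_range] at this
    rwa [List.headD_cons]

theorem coverB_eq_isEmpty (M : List (List Bool)) (K : List ℕ) :
    coverB M K = (badRow M K).isEmpty := by rw [coverB]

/-- If `K` is not a twin cover, then the two bits add the two ends of an edge that violates the
definition of a twin cover. -/
theorem exists_branchStep {K : List ℕ} (h : coverB (matrix G) K = false) :
    ∃ u v : Fin n, (G.Adj u v ∧ ¬ AreTwins G u v ∧ u ∉ toSet n K ∧ v ∉ toSet n K) ∧
      branchStep (matrix G) K true = u.1 :: K ∧ branchStep (matrix G) K false = v.1 :: K := by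
  obtain ⟨x, hx, y, hxy⟩ : ∃ x < n, ∃ y : Fin n, badB (matrix G) K x y = true := by
    by_contra hne
    push Not at hne
    refine Bool.false_ne_true (h.symm.trans ?_)
    rw [coverB_eq_isEmpty, List.isEmpty_iff, badRow, List.filter_eq_nil_iff, length_matrix]
    intro x hx
    rw [any_range_iff, not_exists]
    exact hne x (List.mem_range.1 hx)
  obtain ⟨h₁, h₂⟩ := headD_range_filter
    (f := fun u => (List.range n).any fun v => badB (matrix G) K u v) hx
    (any_range_iff.2 ⟨y, hxy⟩)
  obtain ⟨y', hy'⟩ := any_range_iff.1 h₂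
  obtain ⟨h₃, h₄⟩ := headD_range_filter y'.2 hy'
  refine ⟨⟨_, h₁⟩, ⟨_, h₃⟩, (badB_matrix G K ⟨_, h₁⟩ ⟨_, h₃⟩).1 h₄, ?_, ?_⟩ <;>
  · rw [branchStep, ← coverB_eq_isEmpty, h, badRow, length_matrix]
    simp

theorem branch_append (M : List (List Bool)) (w : List Bool) (b : Bool) :
    branch M (w ++ [b]) = branchStep M (branch M w) b := by
  simp [branch]

theorem branchStep_of_coverB {M : List (List Bool)} {K : List ℕ} (h : coverB M K = true)
    (b : Bool) : branchStep M K b = K := by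
  rw [branchStep, ← coverB_eq_isEmpty, h, if_pos rfl]

theorem branch_lt (w : List Bool) : ∀ v ∈ branch (matrix G) w, v < n := by
  induction w using List.reverseRecOn with
  | nil => simp [branch]
  | append_singleton w b ih =>
    rw [branch_append]
    rcases h : coverB (matrix G) (branch (matrix G) w) with _ | _
    · obtain ⟨x, y, -, h₁, h₂⟩ := exists_branchStep h
      intro v hv
      cases b
      · rw [h₂, List.mem_cons] at hv
        rcases hv with rfl | hv
        exacts [y.2, ih v hv]
      · rw [h₁, List.mem_cons] at hv
        rcases hv with rfl | hv
        exacts [x.2, ih v hv]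
    · rwa [branchStep_of_coverB h]

/-- Some sequence of branchings stays inside a given twin cover. -/
theorem IsTwinCover.exists_branch {S : Finset (Fin n)} (hS : IsTwinCover G S) (t : ℕ) :
    ∃ w : List Bool, w.length = t ∧ (toSet n (branch (matrix G) w)) ⊆ S ∧
      (coverB (matrix G) (branch (matrix G) w) = true ∨
        (toSet n (branch (matrix G) w)).card = t) := by
  induction t with
  | zero => exact ⟨[], rfl, by simp [branch, toSet], Or.inr (by simp [branch, toSet])⟩
  | succ t ih =>
    obtain ⟨w, hw, hsub, h⟩ := ih
    rcases hc : coverB (matrix G) (branch (matrix G) w) with _ | _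
    · obtain ⟨x, y, ⟨h₁, h₂, h₃, h₄⟩, h₅, h₆⟩ := exists_branchStep hc
      have hcard := h.resolve_left (by simp [hc])
      have hins : ∀ z : Fin n, toSet n (z.1 :: branch (matrix G) w) =
          insert z (toSet n (branch (matrix G) w)) := fun z => by
        ext v
        simp [Fin.ext_iff]
      rcases (hS x y h₁).resolve_left h₂ with hx | hy
      · refine ⟨w ++ [true], by simp [hw], ?_, Or.inr ?_⟩ <;> rw [branch_append, h₅, hins]
        · exact Finset.insert_subset hx hsub
        · rw [Finset.card_insert_of_notMem h₃, hcard]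
      · refine ⟨w ++ [false], by simp [hw], ?_, Or.inr ?_⟩ <;> rw [branch_append, h₆, hins]
        · exact Finset.insert_subset hy hsub
        · rw [Finset.card_insert_of_notMem h₄, hcard]
    · refine ⟨w ++ [true], by simp [hw], ?_, Or.inl ?_⟩ <;>
        rw [branch_append, branchStep_of_coverB hc]
      exacts [hsub, hc]

theorem IsTwinCover.coverAt_card {S : Finset (Fin n)} (hS : IsTwinCover G S) :
    coverAt (matrix G) S.card = true := by
  obtain ⟨w, hw, hsub, h⟩ := hS.exists_branch S.card
  refine anyWord_iff.2 ⟨w, hw, fun x _ => by simp, h.elim (fun h => h) fun h => ?_⟩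
  rw [coverB_matrix, Finset.eq_of_subset_of_card_le hsub h.ge]
  exact hS

theorem exists_isTwinCover_card (G : SimpleGraph (Fin n)) :
    ∃ S : Finset (Fin n), IsTwinCover G S ∧ S.card = twinCoverNumber G :=
  Nat.sInf_mem (s := {m | ∃ S : Finset (Fin n), IsTwinCover G S ∧ S.card = m})
    ⟨_, Finset.univ, fun u _ _ => Or.inr (Or.inl (Finset.mem_univ u)), rfl⟩

theorem solveAt_matrix {r k t : ℕ} (hr : 0 < r) (ht : coverAt (matrix G) t = true) :
    solveAt (matrix G, r, k) t = true ↔ HasGroupedDominatingSet G r k := by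
  rw [solveAt, anyWord_iff]
  constructor
  · rintro ⟨w, -, -, h⟩
    exact ((solveWith_matrix (branch_lt w) hr).1 h).2
  · intro h
    obtain ⟨w, hw, hw', hc⟩ := anyWord_iff.1 ht
    exact ⟨w, hw, hw', (solveWith_matrix (branch_lt w) hr).2 ⟨(coverB_matrix G _).1 hc, h⟩⟩

end Branching

/-! ### Large values of the unit size and of the number of units -/

section Capping

variable {n : ℕ} {G : SimpleGraph (Fin n)} {r k m : ℕ}

theorem IsGroupedDominatingSet.mul_le {D : Fin m → Finset (Fin n)}
    (h : IsGroupedDominatingSet G r m D) : m * r ≤ n := by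
  have h₁ : (Finset.univ.biUnion D).card = m * r := by
    rw [Finset.card_biUnion fun i _ j _ hij => h.disjoint i j hij]
    simp [h.card_eq]
  rw [← h₁]
  exact (Finset.card_le_univ _).trans (by simp)

/-- A unit can not have more vertices than the graph, so that there are no units. -/
theorem HasGroupedDominatingSet.of_lt {r' : ℕ} (hr : n < r)
    (h : HasGroupedDominatingSet G r k) : HasGroupedDominatingSet G r' k := by
  obtain ⟨m, hm, D, hD⟩ := h
  obtain rfl : m = 0 := by
    by_contra hne
    have := hD.mul_le
    have := Nat.le_mul_of_pos_left r (Nat.pos_of_ne_zero hne)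
    omega
  exact ⟨0, hm, D, fun i => i.elim0, fun i => i.elim0, fun i => i.elim0, hD.dominating⟩

theorem hasGroupedDominatingSet_min (hr : 0 < r) :
    HasGroupedDominatingSet G (min r (n + 1)) (min k (n + 1)) ↔ HasGroupedDominatingSet G r k := by
  have h₁ : ∀ k, HasGroupedDominatingSet G (min r (n + 1)) k ↔ HasGroupedDominatingSet G r k := by
    intro k
    rcases le_or_gt r n with h | h
    · rw [min_eq_left (by omega)]
    · rw [min_eq_right (by omega)]
      exact ⟨fun h' => h'.of_lt (by omega), fun h' => h'.of_lt h⟩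
  rw [h₁]
  constructor
  · rintro ⟨m, hm, D, hD⟩
    exact ⟨m, hm.trans (min_le_left _ _), D, hD⟩
  · rintro ⟨m, hm, D, hD⟩
    have := hD.mul_le
    have := Nat.le_mul_of_pos_right m hr
    exact ⟨m, le_min hm (by omega), D, hD⟩

end Capping

/-! ### Reading the input -/

/-- The value of a binary expansion, least significant bit first, capped at `c`. -/
def cappedVal (c : ℕ) (l : List Bool) : ℕ :=
  l.foldr (fun b acc => min c ((if b then 1 else 0) + (acc + acc))) 0

theorem cappedVal_bits (c m : ℕ) : cappedVal c m.bits = min c m := by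
  induction m using Nat.binaryRec' with
  | zero => simp [cappedVal]
  | bit b m h ih =>
    rw [Nat.bits_append_bit _ _ h, cappedVal, List.foldr_cons, ← cappedVal, ih, Nat.bit_val]
    cases b <;> simp <;> omega

theorem PT.cappedVal {α : Type} [Enc α] {c : α → ℕ} {l : α → List Bool} (hc : PT c) (hl : PT l) :
    PT fun a => cappedVal (c a) (l a) := by
  have : PT fun x : ℕ × List Bool => GroupedDom.cappedVal x.1 x.2 := by
    have e : ∀ (c : ℕ) (l : List Bool), GroupedDom.cappedVal c l = l.reverse.foldl
        (fun acc b => Min.min c ((if b then 1 else 0) + (acc + acc))) 0 := fun c l => by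
      rw [List.foldl_reverse]
      rfl
    have hle : ∀ (c : ℕ) (l : List Bool), GroupedDom.cappedVal c l ≤ c := fun c l => by
      cases l with
      | nil => simp [GroupedDom.cappedVal]
      | cons b l => exact min_le_left _ _
    simp only [e]
    refine foldl (f := fun (x : ℕ × List Bool) acc b =>
        Min.min x.1 ((if b then 1 else 0) + (acc + acc))) (reverse Comp.id.snd) (Comp.const 0) ?_
      Polynomial.X fun x i => ?_
    · exact min Comp.id.fst.fst (add (Comp.ite Comp.id.snd.snd (Comp.const 1) (Comp.const 0))
        (add Comp.id.snd.fst Comp.id.snd.fst))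
    · have h := hle x.1 (x.2.reverse.take i).reverse
      rw [e, List.reverse_reverse] at h
      rw [sz_nat, Polynomial.eval_X]
      have h₂ : sz x = 1 + (2 * x.1 + 1) + sz x.2 := by rw [← sz_nat]; rfl
      omega
  exact this.comp (hc.pair hl) fun _ => le_rfl

theorem comp_parts : PT fun I : Instance => (matrix I.graph, I.r.bits, I.k.bits) :=
  Comp.of_enc_eq fun I => by
    rw [enc_pair, enc_matrix, enc_pair]
    rfl

/-- The input of the algorithm; values that exceed the number of vertices make no difference. -/
noncomputable def Instance.input (I : Instance) : Input :=
  (matrix I.graph, min (I.n + 1) I.r, min (I.n + 1) I.k)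

theorem comp_input : PT Instance.input := by
  have hn : PT fun I : Instance => I.n + 1 := by
    have := PT.succ (PT.length comp_parts.fst)
    simpa only [length_matrix] using this
  have h := comp_parts.fst.pair ((PT.cappedVal hn comp_parts.snd.fst).pair
    (PT.cappedVal hn comp_parts.snd.snd))
  simp only [cappedVal_bits] at h
  exact h

/-! ### Running time -/

theorem Instance.exists_coverAt (I : Instance) : ∃ t, coverAt (matrix I.graph) t = true := by
  obtain ⟨S, hS, -⟩ := exists_isTwinCover_card I.graph
  exact ⟨_, hS.coverAt_card⟩

/-- The least number of branchings that leads to a twin cover. -/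
noncomputable def Instance.depth (I : Instance) : ℕ := Nat.find I.exists_coverAt

theorem Instance.depth_le_tau (I : Instance) : I.depth ≤ I.tau := by
  obtain ⟨S, hS, hc⟩ := exists_isTwinCover_card I.graph
  exact Nat.find_min' _ (by rw [Instance.tau, ← hc]; exact hS.coverAt_card)

theorem Instance.n_le_sz (I : Instance) : I.n ≤ sz I := by
  have h : sz I = sz (matrix I.graph, I.r.bits, I.k.bits) := by
    rw [sz, sz, enc_pair, enc_matrix, enc_pair]
    rfl
  have h₁ := length_lt_sz (matrix I.graph)
  rw [length_matrix] at h₁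
  rw [h, sz_pair]
  omega

theorem Instance.tau_le (I : Instance) : I.tau ≤ I.n := by
  obtain ⟨S, -, hc⟩ := exists_isTwinCover_card I.graph
  rw [Instance.tau, ← hc]
  exact (Finset.card_le_univ S).trans (by simp)

/-- The answer of the algorithm. -/
noncomputable def Instance.answer (I : Instance) : Bool := solveAt I.input I.depth

theorem Instance.answer_iff (I : Instance) : I.answer = true ↔ I.IsYes := by
  rw [answer, input, depth, solveAt_matrix (lt_min (Nat.succ_pos I.n) I.r_pos)
    (Nat.find_spec I.exists_coverAt), min_comm, min_comm _ I.k,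
    hasGroupedDominatingSet_min I.r_pos, IsYes]

theorem comp_depth : Comp (fun I : Instance => 2 ^ I.tau) Instance.depth := by
  have hM : PT fun x : Instance × ℕ => (matrix x.1.graph, x.2) :=
    (comp_parts.fst.comp Comp.id.fst fun _ => le_rfl).pair Comp.id.snd
  refine Comp.findLeast (c := fun I i => coverAt (matrix I.graph) i) (gc := fun x => 2 ^ x.2)
    (comp_coverAt.comp (hM.of_pt fun x => Nat.one_le_two_pow) fun _ => le_rfl) Polynomial.X
    (fun I => ?_) (fun I => Nat.find_spec I.exists_coverAt)
    (fun I i hi => by simpa using Nat.find_min I.exists_coverAt hi)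
    (fun I i hi => Nat.pow_le_pow_right (by norm_num) (hi.trans I.depth_le_tau))
  rw [Polynomial.eval_X]
  exact I.depth_le_tau.trans (I.tau_le.trans I.n_le_sz)

/-- The constant factors of the base are absorbed by the square: `64 * (t + 1) ≤ (2 * t) ^ 2` for
`t ≥ 128`, and the other values of `t` only contribute a constant. -/
theorem exists_pow_le : ∃ C, ∀ t : ℕ, (64 * (t + 1)) ^ t ≤ (2 * t) ^ (2 * t) * C := by
  refine ⟨(64 * 129) ^ 128, fun t => ?_⟩
  have h₀ : 1 ≤ (2 * t) ^ (2 * t) := by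
    rcases Nat.eq_zero_or_pos t with rfl | ht
    · simp
    · exact Nat.one_le_pow _ _ (by omega)
  rcases le_or_gt 128 t with ht | ht
  · calc (64 * (t + 1)) ^ t ≤ ((2 * t) ^ 2) ^ t := Nat.pow_le_pow_left (by nlinarith) _
      _ = (2 * t) ^ (2 * t) := by rw [← pow_mul]
      _ ≤ _ := Nat.le_mul_of_pos_right _ (Nat.pow_pos (by norm_num))
  · calc (64 * (t + 1)) ^ t ≤ (64 * 129) ^ t := Nat.pow_le_pow_left (by omega) _
      _ ≤ (64 * 129) ^ 128 := Nat.pow_le_pow_right (by norm_num) ht.le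
      _ ≤ _ := Nat.le_mul_of_pos_left _ h₀

theorem comp_answer : Comp (fun I : Instance => (2 * I.tau) ^ (2 * I.tau)) Instance.answer := by
  obtain ⟨C, hC⟩ := exists_pow_le
  have h1 : ∀ t : ℕ, 1 ≤ (64 * (t + 1)) ^ t := fun t => Nat.one_le_pow _ _ (by omega)
  have h : Comp (fun I : Instance => (64 * (I.tau + 1)) ^ I.tau) Instance.answer := by
    unfold Instance.answer
    refine comp_solveAt.comp ((comp_input.of_pt fun I => h1 _).pair
      (comp_depth.mono' fun I => Nat.pow_le_pow_left (by omega) _)) fun I => ?_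
    exact (Nat.pow_le_pow_left (by have := I.depth_le_tau; dsimp only; omega) _).trans
      (Nat.pow_le_pow_right (by omega) I.depth_le_tau)
  exact h.mono (Polynomial.C C) fun I => by rw [Polynomial.eval_C]; exact hC _

/-- The problem is solvable in `O*((2τ)^(2τ))` time. -/
theorem solvableInOStar :
    SolvableInOStar Instance.encode Instance.IsYes fun I => (2 * I.tau) ^ (2 * I.tau) := by
  obtain ⟨p, -, h⟩ := comp_answer
  obtain ⟨P, hP⟩ := h 0
  refine ⟨P, p, fun I => ?_⟩
  obtain ⟨s, t, h₁, h₂, -, h₃⟩ := hP (initStore (Instance.encode I)) I rfl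
  refine ⟨s, t, h₁, h₃, ?_⟩
  rw [h₂, ← I.answer_iff]
  cases I.answer <;> simp

theorem computable_pow : Computable fun t : ℕ => (2 * t) ^ (2 * t) := by
  have hpow : Primrec fun x : ℕ × ℕ => x.1 ^ x.2 := by
    have : Primrec fun x : ℕ × ℕ => Nat.rec (motive := fun _ => ℕ) 1 (fun _ acc => acc * x.1) x.2 :=
      Primrec.nat_rec' Primrec.snd (Primrec.const 1)
        (Primrec.nat_mul.comp (Primrec.snd.comp Primrec.snd) (Primrec.fst.comp Primrec.fst)).to₂
    refine this.of_eq fun x => ?_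
    induction x.2 with
    | zero => rfl
    | succ m ih => rw [pow_succ, ← ih]
  have h2 : Primrec fun t : ℕ => 2 * t := Primrec.nat_mul.comp (Primrec.const 2) Primrec.id
  exact (hpow.comp (h2.pair h2)).to_comp

/-! ### Large units -/

section LargeUnits

variable {V : Type*} {G : SimpleGraph V} {K : Finset V}

theorem mem_supp_of_adj {C : G.ConnectedComponent} {u v : V} (hu : u ∈ C.supp)
    (h : G.Adj u v) : v ∈ C.supp := by
  rw [SimpleGraph.ConnectedComponent.mem_supp_iff] at hu ⊢
  rw [← hu]
  exact (SimpleGraph.ConnectedComponent.sound h.reachable).symm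

theorem component_induction {C : G.ConnectedComponent} {P : V → Prop} {a b : V} (ha : a ∈ C.supp)
    (hb : b ∈ C.supp) (h₀ : P a) (hs : ∀ u v, u ∈ C.supp → G.Adj u v → P u → P v) : P b := by
  rw [SimpleGraph.ConnectedComponent.mem_supp_iff] at ha hb
  obtain ⟨p⟩ := SimpleGraph.ConnectedComponent.exact (ha.trans hb.symm)
  induction p with
  | nil => exact h₀
  | cons h p ih =>
    exact ih (mem_supp_of_adj ha h) hb (hs _ _ ha h h₀)

theorem connected_induce_singleton (v : V) : (G.induce (({v} : Finset V) : Set V)).Connected :=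
  connected_induce_of_reachable (v := v) (by simp) fun w hw => by
    obtain rfl : w = v := by simpa using hw
    exact SimpleGraph.Reachable.refl _

theorem connected_induce_insert [DecidableEq V] {D : Finset V}
    (hD : (G.induce (D : Set V)).Connected) {u v : V} (hu : u ∈ D) (huv : G.Adj u v) :
    (G.induce ((insert v D : Finset V) : Set V)).Connected := by
  have hsub : (D : Set V) ⊆ ((insert v D : Finset V) : Set V) := by simp
  have huD : u ∈ ((insert v D : Finset V) : Set V) := hsub hu
  refine connected_induce_of_reachable huD fun w hw => ?_
  rcases Finset.mem_insert.1 (Finset.mem_coe.1 hw) with rfl | hwD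
  · exact reachable_induce_of_adj hw huD huv.symm
  · exact (hD.preconnected ⟨w, hwD⟩ ⟨u, hu⟩).map (SimpleGraph.induceHomOfLE G hsub).toHom

/-- If no vertex of the cover outside `D` is adjacent to `D`, or joined to `D` by a vertex outside
the cover, then `D` dominates its component and contains the vertices of the cover in it:
consecutive vertices outside the cover are twins, so a path can not lead away from `D`. -/
theorem IsTwinCover.mem_or_adj_of_closed (hK : IsTwinCover G K) {C : G.ConnectedComponent}
    {D : Finset V} {a : V} (haC : a ∈ C.supp) (ha : a ∈ D)
    (h₁ : ∀ u ∈ D, ∀ x ∈ K, G.Adj u x → x ∈ D)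
    (h₂ : ∀ u ∈ D, ∀ y ∉ K, ∀ x ∈ K, G.Adj u y → G.Adj y x → x ∈ D) :
    ∀ v ∈ C.supp, v ∈ D ∨ (v ∉ K ∧ ∃ u ∈ D, G.Adj u v) := by
  intro v hv
  refine component_induction (P := fun v => v ∈ D ∨ (v ∉ K ∧ ∃ u ∈ D, G.Adj u v)) haC hv
    (Or.inl ha) fun v w _ hvw h => ?_
  by_cases hw : w ∈ K
  · rcases h with h | ⟨hvK, u, hu, huv⟩
    exacts [Or.inl (h₁ v h w hw hvw), Or.inl (h₂ u hu v hvK w hw huv hvw)]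
  · rcases h with h | ⟨hvK, u, hu, huv⟩
    · exact Or.inr ⟨hw, v, h, hvw⟩
    · rcases (hK.adj_iff hvK hw (Or.inr hvw) u).1 (Or.inr huv.symm) with rfl | h
      exacts [Or.inl hu, Or.inr ⟨hw, u, hu, h.symm⟩]

theorem exists_connected_extension [Finite V] {C : G.ConnectedComponent} {r : ℕ}
    (hr : r ≤ C.supp.ncard) {D : Finset V} (hDC : (D : Set V) ⊆ C.supp)
    (hD : (G.induce (D : Set V)).Connected) (hDr : D.card ≤ r) :
    ∃ E : Finset V, D ⊆ E ∧ (E : Set V) ⊆ C.supp ∧ (G.induce (E : Set V)).Connected ∧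
      E.card = r := by
  classical
  induction hd : r - D.card generalizing D with
  | zero => exact ⟨D, subset_rfl, hDC, hD, by omega⟩
  | succ d ih =>
    obtain ⟨a, ha⟩ := hD.nonempty
    obtain ⟨u, hu, v, hv, huv⟩ : ∃ u ∈ D, ∃ v ∉ D, G.Adj u v := by
      by_contra! hcl
      have hCD : C.supp ⊆ D := fun v hv => component_induction (P := fun v => v ∈ D) (hDC ha) hv
        (Finset.mem_coe.1 ha) fun u w _ huw hu => by
          by_contra hw
          exact hcl u hu w hw huw
      have := Set.ncard_le_ncard hCD (Set.toFinite _)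
      rw [Set.ncard_coe_finset] at this
      omega
    have hc := Finset.card_insert_of_notMem hv
    obtain ⟨E, h₁, h₂⟩ := ih (D := insert v D) (by
        rw [Finset.coe_insert]
        exact Set.insert_subset (mem_supp_of_adj (hDC hu) huv) hDC)
      (connected_induce_insert hD hu huv) (by omega) (by omega)
    exact ⟨E, (Finset.subset_insert v D).trans h₁, h₂⟩

/-- The vertices of a twin cover in a component can be connected through fewer additional vertices,
since two parts that are not yet connected are at distance at most two. The resulting set dominates
the component. -/
theorem IsTwinCover.exists_core [Finite V] (hK : IsTwinCover G K) (C : G.ConnectedComponent) :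
    ∃ D : Finset V, (D : Set V) ⊆ C.supp ∧ (G.induce (D : Set V)).Connected ∧
      (D.card = 1 ∨ D.card + 1 ≤ 2 * K.card) ∧
      ∀ v ∈ C.supp, v ∈ D ∨ (v ∉ K ∧ ∃ u ∈ D, G.Adj u v) := by
  classical
  have := Fintype.ofFinite V
  by_cases hne : ∃ x ∈ K, x ∈ C.supp
  · obtain ⟨x₀, hx₀, hx₀C⟩ := hne
    obtain ⟨D, hD, hmax⟩ := (Finset.univ.filter fun D : Finset V => (D : Set V) ⊆ C.supp ∧
      (G.induce (D : Set V)).Connected ∧ D.card + 1 ≤ 2 * (D ∩ K).card).exists_max_image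
      (fun D => (D ∩ K).card) ⟨{x₀}, by
        simp only [Finset.mem_filter_univ]
        refine ⟨by simpa using hx₀C, connected_induce_singleton x₀, ?_⟩
        rw [Finset.singleton_inter_of_mem hx₀]
        simp⟩
    simp only [Finset.mem_filter_univ] at hD hmax
    obtain ⟨hDC, hDc, hcard⟩ := hD
    obtain ⟨⟨a, ha⟩⟩ := hDc.nonempty
    -- a set that contains one more vertex of the cover and at most two more vertices
    have key : ∀ E : Finset V, (E : Set V) ⊆ C.supp → (G.induce (E : Set V)).Connected →
        E.card ≤ D.card + 2 → ∀ x ∈ K, x ∉ D → x ∈ E → D ⊆ E → False := by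
      intro E h₁ h₂ h₃ x hx hxD hxE hDE
      have h₄ : insert x (D ∩ K) ⊆ E ∩ K := Finset.insert_subset (Finset.mem_inter.2 ⟨hxE, hx⟩)
        (Finset.inter_subset_inter_right hDE)
      have h₅ := Finset.card_le_card h₄
      rw [Finset.card_insert_of_notMem fun h => hxD (Finset.mem_inter.1 h).1] at h₅
      have := hmax E ⟨h₁, h₂, by omega⟩
      omega
    refine ⟨D, hDC, hDc, Or.inr (hcard.trans (Nat.mul_le_mul_left 2
      (Finset.card_le_card Finset.inter_subset_right))),
      hK.mem_or_adj_of_closed (hDC ha) (Finset.mem_coe.1 ha) ?_ ?_⟩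
    · intro u hu x hx hux
      by_contra hxD
      refine key (insert x D) ?_ (connected_induce_insert hDc hu hux) ?_ x hx hxD
        (Finset.mem_insert_self _ _) (Finset.subset_insert _ _)
      · rw [Finset.coe_insert]
        exact Set.insert_subset (mem_supp_of_adj (hDC hu) hux) hDC
      · exact (Finset.card_insert_le _ _).trans (by omega)
    · intro u hu y hy x hx huy hyx
      by_contra hxD
      have hyC := mem_supp_of_adj (hDC hu) huy
      refine key (insert x (insert y D)) ?_ (connected_induce_insert
        (connected_induce_insert hDc hu huy) (Finset.mem_insert_self _ _) hyx) ?_ x hx hxD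
        (Finset.mem_insert_self _ _)
        ((Finset.subset_insert _ _).trans (Finset.subset_insert _ _))
      · rw [Finset.coe_insert, Finset.coe_insert]
        exact Set.insert_subset (mem_supp_of_adj hyC hyx) (Set.insert_subset hyC hDC)
      · have h₁ := Finset.card_insert_le x (insert y D)
        have h₂ := Finset.card_insert_le y D
        omega
  · push Not at hne
    obtain ⟨a, ha⟩ := C.nonempty_supp
    refine ⟨{a}, by simpa using ha, connected_induce_singleton a, Or.inl (by simp),
      hK.mem_or_adj_of_closed ha (by simp) ?_ ?_⟩
    · intro u hu x hx hux
      obtain rfl : u = a := by simpa using hu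
      exact absurd (mem_supp_of_adj ha hux) (hne x hx)
    · intro u hu y _ x hx huy hyx
      obtain rfl : u = a := by simpa using hu
      exact absurd (mem_supp_of_adj (mem_supp_of_adj ha huy) hyx) (hne x hx)

theorem IsTwinCover.exists_unit [Finite V] (hK : IsTwinCover G K) (C : G.ConnectedComponent)
    {r : ℕ} (hr : 0 < r) (hKr : 2 * K.card ≤ r + 1) (hC : r ≤ C.supp.ncard) :
    ∃ D : Finset V, (D : Set V) ⊆ C.supp ∧ (K : Set V) ∩ C.supp ⊆ D ∧ D.card = r ∧
      (G.induce (D : Set V)).Connected ∧ Dominates G D C.supp := by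
  obtain ⟨E, hEC, hE, hEr, hdom⟩ := hK.exists_core C
  obtain ⟨D, hED, hDC, hD, hDr⟩ := exists_connected_extension hC hEC hE (by omega)
  refine ⟨D, hDC, fun x hx => ?_, hDr, hD, fun v hv => ?_⟩
  · rcases hdom x hx.2 with h | h
    exacts [hED h, absurd hx.1 h.1]
  · rcases hdom v hv with h | ⟨-, u, hu, huv⟩
    exacts [Or.inl (hED h), Or.inr ⟨u, hED hu, huv⟩]

end LargeUnits

end GroupedDom

theorem mainTheorem2 :
    -- solvable in `O*((2τ)^(2τ))` time
    GroupedDom.SolvableInOStar GroupedDom.Instance.encode GroupedDom.Instance.IsYes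
      (fun I => (2 * I.tau) ^ (2 * I.tau)) ∧
    -- fixed-parameter tractable for `τ` alone
    GroupedDom.IsFPT GroupedDom.Instance.encode GroupedDom.Instance.IsYes
      GroupedDom.Instance.tau ∧
    -- if `r ≥ 2τ - 1`, a minimum twin cover extends, in each component with at least `r` vertices,
    -- to a single connected unit of size `r` that dominates the component
    (∀ (n : ℕ) (G : SimpleGraph (Fin n)) (r : ℕ), 0 < r →
      2 * GroupedDom.twinCoverNumber G ≤ r + 1 →
      ∀ K : Finset (Fin n), GroupedDom.IsTwinCover G K →
        K.card = GroupedDom.twinCoverNumber G →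
      ∀ C : G.ConnectedComponent, r ≤ C.supp.ncard →
        ∃ D : Finset (Fin n), (D : Set (Fin n)) ⊆ C.supp ∧ (K : Set (Fin n)) ∩ C.supp ⊆ D ∧
          D.card = r ∧ (G.induce (D : Set (Fin n))).Connected ∧
          GroupedDom.Dominates G D C.supp) :=
  ⟨GroupedDom.solvableInOStar, ⟨_, GroupedDom.computable_pow, GroupedDom.solvableInOStar⟩,
    fun _ _ _ hr hτ _ hK hc C hC => hK.exists_unit C hr (by rw [hc]; exact hτ) hC⟩
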